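/- **Language.** Linearity types are $Y ::= \phi\mid\bullet\mid\circ$; value types are $A,B ::= \alpha\mid A\to^Y C$; computation types are $C,D ::= A\,!\,\{R\}$. A row $R$ is a finite collection $K$ of entries $\ell : A_\ell\twoheadrightarrow^Y B_\ell$ (the types $A_\ell,B_\ell$ are fixed by a global signature, so an entry is written $\ell:Y$), taken up to reordering, optionally followed by a row variable: $R ::= K\mid K;\mu$. A type is $\tau ::= A\mid R\mid Y$. Let $\mathrm{dom}\,R$ be the set of labels of $R$ and $\langle R\rangle$ the set of its entries together with its row variable. A row is well-formed if no label occurs twice in it. A constraint set is a finite set of predicates $\tau_1\preceq\tau_2$, $R_1\leqslant R_2$, $R\perp\mathcal L$, where $\mathcal L$ is a finite set of labels. **Entailment** $P\vdash\pi$ is the least relation such that: $P\vdash\pi$ for $\pi\in P$; $P\vdash\tau\preceq\tau$; $P\vdash\tau\preceq\circ$; $P\vdash\bullet\preceq\tau$; $P\vdash (A\to^Y C)\preceq\tau$ iff $P\vdash Y\preceq\tau$; $P\vdash\tau\preceq R$ iff $P\vdash\tau\preceq Y$ for every entry $\ell:Y$ of $R$ and $P\vdash\tau\preceq\mu$ if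 $\mu$ is the row variable of $R$ (these two are rules in both directions); $P\vdash R_1\leqslant R_2$ if $\langle R_1\rangle\subseteq\langle R_2\rangle$; $P\vdash R\perp\mathcal L$ if $\mathrm{dom}\,R\cap\mathcal L=\emptyset$. All rows are required to be well-formed: a substitution $\theta$ is *admissible for* $P$ if it maps variables to well-formed types and all rows in $\theta P$ are well-formed. Put $\mathrm{Sat}(P)=\{\theta \text{ admissible for } P\mid \emptyset\vdash\pi\text{ for all }\pi\in\theta P\}$; $P$ is *satisfiable* if $\mathrm{Sat}(P)\neq\emptyset$. For a set of variables $N$, let $\mathrm{Sat}(Q)\theta$ (relative to $N$ and $P$) be the set of substitutions $s$ admissible for $P$ that agree on $N$ with $\theta'\theta$ (first $\theta$, then $\theta'$) for some $\theta'\in\mathrm{Sat}(Q)$. **Factorisation.** $\mathrm{factorise}$ maps $\tau\preceq\tau$, $\tau\preceq\circ$, $\bullet\preceq\tau$ to $\emptyset$; $(A\to^YC)\preceq\tau$ to $\mathrm{factorise}(Y\preceq\tau)$; $\tau\preceq R$ to the union of $\mathrm{factorise}(\tau\preceq Y)$ over the entries $\ell:Y$ of $R$ and of $\mathrm{factorise}(\tau\preceq\mu)$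 for its row variable $\mu$; $R_1\leqslant R_2$ to $\emptyset$ if $\langle R_1\rangle\subseteq\langle R_2\rangle$; $R\perp\mathcal L$ to $\emptyset$ if $\mathrm{dom}\,R\cap\mathcal L=\emptyset$; every other $\pi$ to $\{\pi\}$. It is extended to sets by unions, to schemes by $\mathrm{factorise}((\forall\bar\alpha.P\Rightarrow A)\preceq\tau)=\mathrm{factorise}(P')\cup\mathrm{factorise}(A'\preceq\tau)$ where $P',A'$ instantiate $\bar\alpha$ by fresh variables, and to contexts by $\mathrm{factorise}(\Gamma\preceq\tau)=\bigcup_{(x:\sigma)\in\Gamma}\mathrm{factorise}(\sigma\preceq\tau)$. Write $F$ for $\mathrm{factorise}$ and $U(\Gamma)=F(\Gamma\preceq\bullet)$. **Generated constraint sets.** Terms are $V ::= x\mid\lambda x.M$; $M,N ::= V\,W\mid\mathsf{return}\,V\mid\mathsf{do}\,\ell\,V\mid\mathsf{let}\,x=V\,\mathsf{in}\,M\mid\mathsf{let}\,x\leftarrow M\,\mathsf{in}\,N\mid\mathsf{handle}\,M\,\mathsf{with}\,H$; $H=\{\mathsf{return}\,x\mapsto M\}\uplus\{\ell_i\,p_i\,r_i\mapsto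 N_i\}_{i=1}^n$ with distinct $\ell_i$. Type inference $\Gamma\vdash V:A\dashv\theta,P,\Sigma$ (similarly for $M:C$ and $H:C\Rightarrow D$) takes a context $\Gamma$ of type schemes $\forall\bar\alpha.P\Rightarrow A$ and a term, and yields a type, a substitution, a constraint set and the set $\Sigma$ of used term variables. Below, $\mathrm{mgu}$ is the principal unifier computed by first-order unification with rows, $\Gamma|_\Sigma$ is restriction, $\overline\Sigma$ is complement, bound term variables are distinct from those in $\Gamma$, and $\alpha,\mu,\phi,\phi_i$ are fresh. - $x$ with $x:\forall\bar\alpha.P\Rightarrow A$ in $\Gamma$: the type is $A$ and the constraints are $P$, with $\bar\alpha$ replaced by fresh variables; $\theta=\iota$, $\Sigma=\{x\}$. - $\lambda x.M$: if $\Gamma,x:\alpha\vdash M:C\dashv\theta,P,\Sigma$, then $\theta\alpha\to^\phi C$, $\theta$, $P\cup F(\theta\Gamma|_\Sigma\preceq\phi)\cup U(\theta(x:\alpha)|_{\overline\Sigma})$, $\Sigma\setminus x$. - $V\,W$: if $\Gamma\vdash V:A\dashv\theta_1,P_1,\Sigma_1$, $\theta_1\Gamma\vdash W:B\dashv\theta_2,P_2,\Sigma_2$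 and $\theta_3=\mathrm{mgu}(\theta_2A,\,B\to^\phi\alpha\,!\,\{\mu\})$, then $\theta_3(\alpha\,!\,\{\mu\})$, $\theta_3\theta_2\theta_1$, $\theta_3(\theta_2P_1\cup P_2)\cup U(\theta_3\theta_2\theta_1\Gamma|_{\Sigma_1\cap\Sigma_2})$, $\Sigma_1\cup\Sigma_2$. - $\mathsf{return}\,V$: if $\Gamma\vdash V:A\dashv\theta,P,\Sigma$, then $A\,!\,\{\mu\}$, $\theta,P,\Sigma$. - $\mathsf{do}\,\ell\,V$: if $\Gamma\vdash V:A\dashv\theta_1,P,\Sigma$ and $\theta_2=\mathrm{mgu}(A,A_\ell)$, then $B_\ell\,!\,\{\mu\}$, $\theta_2\theta_1$, $\theta_2P\cup F((\ell:\phi)\leqslant\mu)$, $\Sigma$. - $\mathsf{let}\,x=V\,\mathsf{in}\,M$: if $\Gamma\vdash V:A\dashv\theta_1,P_1,\Sigma_1$, $\sigma$ quantifies $P_1\Rightarrow A$ over its variables not free in $\theta_1\Gamma$, and $\theta_1\Gamma,x:\sigma\vdash M:C\dashv\theta_2,P_2,\Sigma_2$, then $C$, $\theta_2\theta_1$, $P_2\cup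 U(\theta_2\theta_1\Gamma|_{\Sigma_1\cap\Sigma_2})\cup U(\theta_2(x:\sigma)|_{\overline{\Sigma_2}})$, $\Sigma_1\cup(\Sigma_2\setminus x)$. - $\mathsf{let}\,x\leftarrow M\,\mathsf{in}\,N$: if $\Gamma\vdash M:A\,!\,\{R_1\}\dashv\theta_1,P_1,\Sigma_1$ and $\theta_1\Gamma,x:A\vdash N:B\,!\,\{R_2\}\dashv\theta_2,P_2,\Sigma_2$, then $B\,!\,\{\mu\}$, $\theta_2\theta_1$, $\theta_2P_1\cup P_2\cup U(\theta_2\theta_1\Gamma|_{\Sigma_1\cap\Sigma_2})\cup U(\theta_2(x:A)|_{\overline{\Sigma_2}})\cup F(\theta_2\theta_1\Gamma|_{\Sigma_2}\preceq\theta_2R_1)\cup F(\theta_2R_1\leqslant\mu)\cup F(R_2\leqslant\mu)$, $\Sigma_1\cup(\Sigma_2\setminus x)$. - $\mathsf{handle}\,M\,\mathsf{with}\,H$: if $\Gamma\vdash H:A\,!\,\{R_1\}\Rightarrow D\dashv\theta_1,P_1,\Sigma_1$, $\theta_1\Gamma\vdash M:A'\,!\,\{R\}\dashv\theta_2,P_2,\Sigma_2$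 and $\theta_3=\mathrm{mgu}(\theta_2A,A')$, then $\theta_3\theta_2D$, $\theta_3\theta_2\theta_1$, $\theta_3(\theta_2P_1\cup P_2)\cup F(\theta_3R\leqslant\theta_3\theta_2R_1)\cup U(\theta_3\theta_2\theta_1\Gamma|_{\Sigma_1\cap\Sigma_2})$, $\Sigma_1\cup\Sigma_2$. - $H$: if $\Gamma,x:\alpha\vdash M:D\dashv\theta_0,P_0,\Sigma_0$ and, for $i=1,\dots,n$ in turn, $\theta_{i-1}(\Gamma,p_i:A_{\ell_i},r_i:B_{\ell_i}\to^{\phi_i}D)\vdash N_i:D_i\dashv\theta_i',P_i,\Sigma_i$, $\theta_i''=\mathrm{mgu}(D_i,\theta_i'\theta_{i-1}D)$, $\theta_i=\theta_i''\theta_i'\theta_{i-1}$, then, with $\theta_nD=B\,!\,\{R\}$ and $\Sigma=(\Sigma_0\setminus x)\cup\bigcup_i(\Sigma_i\setminus\{p_i,r_i\})$: the type is $\theta_n(\alpha\,!\,\{(\ell_i:\phi_i)_i;\mu\})\Rightarrow\theta_nD$, the substitution is $\theta_n$, the used variables are $\Sigma$, and the constraints are $\bigcup_{i=0}^n\theta_nP_i\cup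 U(\theta_n\Gamma|_\Sigma)\cup F(\mu\leqslant R)\cup F(\mu\perp\{\ell_i\}_i)\cup U(\theta_n(x:\alpha)|_{\overline{\Sigma_0}})\cup\bigcup_iU(\theta_n(p_i:A_{\ell_i},r_i:B_{\ell_i}\to^{\phi_i}D)|_{\overline{\Sigma_i}})$. $P$ is *generated by type inference* if it is the constraint set of such a derivation, for some value, computation or handler and some context $\Gamma$ (possibly empty) in whose qualifiers no row stands on the left, and no value type on the right, of $\preceq$. **The solver.** $\mathrm{solve}(P_0)$ starts from $(\theta,P,Q)=(\iota,\emptyset,P_0)$, where $P$ holds solved and $Q$ unsolved predicates. While $Q\ne\emptyset$, it removes some $\pi$ from $Q$: - $\tau_1\preceq\tau_2$ is moved to $P$. - $K\perp\mathcal L$ and $K;\mu\perp\mathcal L$: fail unless $\mathrm{dom}\,K\cap\mathcal L=\emptyset$; in the second case put $\mu\perp\mathcal L$ into $P$. - $R_1\leqslant R_2$, where $R_i$ is $K_i$ or $K_i;\mu_i$: unify the linearities of the labels shared by $K_1$ and $K_2$ (fail on $\bullet$ against $\circ$), giving $\theta'$, and let $K_i'=\theta'K_i$. - If $K_1'\subseteq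 K_2'$: apply $\theta'$ to $P$ and $Q$, replace $\theta$ by $\theta'\theta$, and, if $R_1$ has a row variable $\mu_1$ that is not also the row variable of $R_2$, put $\mu_1\leqslant R$ into $P$, where $R$ is $K_2'\setminus K_1'$ followed by the row variable of $R_2$ (if any). - If $K_1'\not\subseteq K_2'$: fail if $R_2$ has no row variable or the same one as $R_1$; otherwise let $\mu$ be fresh and $\theta''=[((K_1'\setminus K_2');\mu)/\mu_2]\theta'$, replace $\theta$ by $\theta''\theta$, $Q$ by $\theta''(Q\cup P)$, and $P$ by $\{\mu_1\leqslant(K_2'\setminus K_1');\mu\}$ if $R_1$ has a row variable $\mu_1$ and by $\emptyset$ otherwise. - It fails when the new $\theta$ creates a row with a duplicated label in $\theta P_0$. When $Q=\emptyset$, it computes the transitive closure of the linearity predicates in $\mathrm{factorise}(P)$ by adding them one at a time, fails if this contains $\circ\preceq\bullet$, and otherwise returns $(\theta,P)$. **Theorem (Correctness of constraint solving).** Let $P$ be a constraint set with well-formed rows that is generated by type inference, and let $N$ be a finite set of variables in use that contains those of $P$; fresh variables are chosen outside $N$ and distinct from each other. Then $\mathrm{solve}(P)$ always terminates: whatever the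 choices of predicates and fresh variables, there is no infinite run, and every maximal run fails or returns a result. Moreover: - if $\mathrm{solve}(P)$ fails, then $P$ is not satisfiable; - if $\mathrm{solve}(P)$ returns $(\theta,Q)$, then $P$ is satisfiable and $\mathrm{Sat}(P)=\mathrm{Sat}(Q)\theta$ (relative to $N$ and $P$). -/

import Mathlib

namespace Qeff

/-! ## Types, rows and predicates

The syntax is parametric in the names `ν` of type variables.  Type variables come in three kinds:
value type variables, row variables and linearity variables.  Labels and term variables are
natural numbers. -/

inductive Kind
  | ty
  | row
  | lin
  deriving DecidableEq

/-- Linearity types `Y ::= φ | • | ∘`. -/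
inductive Lin (ν : Type)
  | var (φ : ν)
  | unl
  | any
  deriving DecidableEq

/-- Concrete rows.  The parameter and result types of an operation are fixed by its label through
the global signature, so an entry `ℓ : A ↠^Y B` is recorded as `(ℓ, Y)`.  Multisets
identify rows up to reordering, but they still see duplicated labels. -/
abbrev CRow (ν : Type) := Multiset (ℕ × Lin ν)

/-- Row types: a concrete part, and possibly a row variable at the end. -/
structure Row (ν : Type) where
  labels : CRow ν
  tail : Option ν
  deriving DecidableEq

/-- Value types `A ::= α | A →^Y (B ! {R})`. -/
inductive Ty (ν : Type)
  | var (α : ν)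
  | arrow (A : Ty ν) (Y : Lin ν) (B : Ty ν) (R : Row ν)
  deriving DecidableEq

/-- Computation types `A ! {R}`. -/
structure CTy (ν : Type) where
  val : Ty ν
  eff : Row ν

/-- The category `τ ::= A | R | Y`. -/
inductive Typ (ν : Type)
  | val (A : Ty ν)
  | row (R : Row ν)
  | lin (Y : Lin ν)
  deriving DecidableEq

/-- Predicates `τ₁ ≼ τ₂`, `R₁ ⩽ R₂` and `R ⊥ L`. -/
inductive Pred (ν : Type)
  | lin (τ₁ τ₂ : Typ ν)
  | sub (R₁ R₂ : Row ν)
  | lack (R : Row ν) (L : Finset ℕ)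
  deriving DecidableEq

/-- Predicate sets over ordinary type variables. -/
abbrev PSet := Finset (Pred ℕ)

/-- The row consisting of just a row variable. -/
def Row.var {ν : Type} (μ : ν) : Row ν := ⟨0, some μ⟩

/-- The labels of a concrete row. -/
def CRow.dom {ν : Type} (K : CRow ν) : Finset ℕ := (K.map Prod.fst).toFinset

/-- `K \ K'`. -/
def CRow.diff {ν : Type} [DecidableEq ν] (K K' : CRow ν) : CRow ν := K.filter (fun e => e ∉ K')

/-! ## Free type variables -/

section FreeVariables

variable {ν : Type} [DecidableEq ν]

def Lin.fv : Lin ν → Finset (Kind × ν)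
  | .var φ => {(Kind.lin, φ)}
  | .unl => ∅
  | .any => ∅

def Row.fv (R : Row ν) : Finset (Kind × ν) :=
  R.labels.toFinset.biUnion (fun e => e.2.fv) ∪
    (match R.tail with
      | some μ => {(Kind.row, μ)}
      | none => ∅)

def Ty.fv : Ty ν → Finset (Kind × ν)
  | .var α => {(Kind.ty, α)}
  | .arrow A Y B R => A.fv ∪ Y.fv ∪ B.fv ∪ R.fv

def Typ.fv : Typ ν → Finset (Kind × ν)
  | .val A => A.fv
  | .row R => R.fv
  | .lin Y => Y.fv

def Pred.fv : Pred ν → Finset (Kind × ν)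
  | .lin τ₁ τ₂ => τ₁.fv ∪ τ₂.fv
  | .sub R₁ R₂ => R₁.fv ∪ R₂.fv
  | .lack R _ => R.fv

end FreeVariables

def PSet.fv (P : PSet) : Finset (Kind × ℕ) := P.biUnion Pred.fv

/-! ## Substitutions -/

/-- Kind-respecting simultaneous substitutions. -/
@[ext] structure Subst (ν ν' : Type) where
  ty : ν → Ty ν'
  row : ν → Row ν'
  lin : ν → Lin ν'

section Substitution

variable {ν ν' ν'' : Type}

def Lin.subst (θ : Subst ν ν') : Lin ν → Lin ν'
  | .var φ => θ.lin φ
  | .unl => .unl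
  | .any => .any

def CRow.subst (θ : Subst ν ν') (K : CRow ν) : CRow ν' :=
  K.map (fun e => (e.1, e.2.subst θ))

def Row.subst (θ : Subst ν ν') (R : Row ν) : Row ν' :=
  match R.tail with
  | some μ => ⟨CRow.subst θ R.labels + (θ.row μ).labels, (θ.row μ).tail⟩
  | none => ⟨CRow.subst θ R.labels, none⟩

def Ty.subst (θ : Subst ν ν') : Ty ν → Ty ν'
  | .var α => θ.ty α
  | .arrow A Y B R => .arrow (A.subst θ) (Y.subst θ) (B.subst θ) (R.subst θ)

def CTy.subst (θ : Subst ν ν') (C : CTy ν) : CTy ν' := ⟨C.val.subst θ, C.eff.subst θ⟩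

def Typ.subst (θ : Subst ν ν') : Typ ν → Typ ν'
  | .val A => .val (A.subst θ)
  | .row R => .row (R.subst θ)
  | .lin Y => .lin (Y.subst θ)

def Pred.subst (θ : Subst ν ν') : Pred ν → Pred ν'
  | .lin τ₁ τ₂ => .lin (τ₁.subst θ) (τ₂.subst θ)
  | .sub R₁ R₂ => .sub (R₁.subst θ) (R₂.subst θ)
  | .lack R L => .lack (R.subst θ) L

/-- The substitution that renames every variable. -/
def Subst.ren (f : Kind → ν → ν') : Subst ν ν' where
  ty α := .var (f .ty α)
  row μ := .var (f .row μ)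
  lin φ := .var (f .lin φ)

/-- The identity substitution `ι`. -/
def Subst.id : Subst ν ν := Subst.ren (fun _ x => x)

/-- `θ'.comp θ` is the composition `θ'θ`: first `θ`, then `θ'`. -/
def Subst.comp (θ' : Subst ν' ν'') (θ : Subst ν ν') : Subst ν ν'' where
  ty α := (θ.ty α).subst θ'
  row μ := (θ.row μ).subst θ'
  lin φ := (θ.lin φ).subst θ'

variable [DecidableEq ν]

/-- `[A/α]`. -/
def Subst.oneTy (α : ν) (A : Ty ν) : Subst ν ν :=
  { Subst.id with ty := Function.update Subst.id.ty α A }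

/-- `[R/μ]`. -/
def Subst.oneRow (μ : ν) (R : Row ν) : Subst ν ν :=
  { Subst.id with row := Function.update Subst.id.row μ R }

/-- `[Y/φ]`. -/
def Subst.oneLin (φ : ν) (Y : Lin ν) : Subst ν ν :=
  { Subst.id with lin := Function.update Subst.id.lin φ Y }

end Substitution

def PSet.subst (θ : Subst ℕ ℕ) (P : PSet) : PSet := P.image (Pred.subst θ)

/-- Two substitutions agree on a set of type variables. -/
def Subst.AgreeOn (N : Finset (Kind × ℕ)) (s t : Subst ℕ ℕ) : Prop :=
  (∀ α, (Kind.ty, α) ∈ N → s.ty α = t.ty α) ∧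
  (∀ μ, (Kind.row, μ) ∈ N → s.row μ = t.row μ) ∧
  (∀ φ, (Kind.lin, φ) ∈ N → s.lin φ = t.lin φ)

/-! ## Well-formedness: no duplicated labels in a row -/

section WellFormed

variable {ν : Type}

def Row.WF (R : Row ν) : Prop := (R.labels.map Prod.fst).Nodup

def Ty.WF : Ty ν → Prop
  | .var _ => True
  | .arrow A _ B R => A.WF ∧ B.WF ∧ R.WF

def Typ.WF : Typ ν → Prop
  | .val A => A.WF
  | .row R => R.WF
  | .lin _ => True

def Pred.WF : Pred ν → Prop
  | .lin τ₁ τ₂ => τ₁.WF ∧ τ₂.WF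
  | .sub R₁ R₂ => R₁.WF ∧ R₂.WF
  | .lack R _ => R.WF

end WellFormed

def PSet.WF (P : PSet) : Prop := ∀ π ∈ P, π.WF

def Subst.WF (s : Subst ℕ ℕ) : Prop := (∀ α, (s.ty α).WF) ∧ ∀ μ, (s.row μ).WF

/-! ## Entailment and solutions -/

/-- `rowset R₁ ⊆ rowset R₂`, where the elements of a row are its labels with their
signatures and its row variable. -/
def Row.Sub {ν : Type} (R₁ R₂ : Row ν) : Prop :=
  (∀ e ∈ R₁.labels, e ∈ R₂.labels) ∧ ∀ μ, R₁.tail = some μ → R₂.tail = some μ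

/-- The entailment `P ⊢ π`.  The rules for functions and for rows go both ways. -/
inductive Entails (P : PSet) : Pred ℕ → Prop
  | subsume {π : Pred ℕ} : π ∈ P → Entails P π
  | refl (τ : Typ ℕ) : Entails P (.lin τ τ)
  | lin (τ : Typ ℕ) : Entails P (.lin τ (.lin .any))
  | unl (τ : Typ ℕ) : Entails P (.lin (.lin .unl) τ)
  | func {A : Ty ℕ} {Y : Lin ℕ} {B : Ty ℕ} {R : Row ℕ} {τ : Typ ℕ} :
      Entails P (.lin (.lin Y) τ) → Entails P (.lin (.val (.arrow A Y B R)) τ)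
  | func_inv {A : Ty ℕ} {Y : Lin ℕ} {B : Ty ℕ} {R : Row ℕ} {τ : Typ ℕ} :
      Entails P (.lin (.val (.arrow A Y B R)) τ) → Entails P (.lin (.lin Y) τ)
  | row {τ : Typ ℕ} {R : Row ℕ} :
      (∀ e ∈ R.labels, Entails P (.lin τ (.lin e.2))) →
      (∀ μ, R.tail = some μ → Entails P (.lin τ (.row (Row.var μ)))) →
      Entails P (.lin τ (.row R))
  | row_inv_label {τ : Typ ℕ} {R : Row ℕ} {e : ℕ × Lin ℕ} :
      e ∈ R.labels → Entails P (.lin τ (.row R)) → Entails P (.lin τ (.lin e.2))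
  | row_inv_tail {τ : Typ ℕ} {R : Row ℕ} {μ : ℕ} :
      R.tail = some μ → Entails P (.lin τ (.row R)) → Entails P (.lin τ (.row (Row.var μ)))
  | sub {R₁ R₂ : Row ℕ} : R₁.Sub R₂ → Entails P (.sub R₁ R₂)
  | lack {R : Row ℕ} {L : Finset ℕ} : Disjoint (CRow.dom R.labels) L → Entails P (.lack R L)

/-- `P ⊢ Q`. -/
def EntailsSet (P Q : PSet) : Prop := ∀ π ∈ Q, Entails P π

/-- `s` is a well-formed substitution, and it creates no duplicated labels in the rows of `P`. -/
def Subst.WFFor (s : Subst ℕ ℕ) (P : PSet) : Prop := s.WF ∧ (PSet.subst s P).WF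

/-- The solutions of `P`: the substitutions `s` with `· ⊢ sP`, where all rows are
well-formed. -/
def Sat (P : PSet) : Set (Subst ℕ ℕ) :=
  {s | s.WFFor P ∧ EntailsSet ∅ (PSet.subst s P)}

def Satisfiable (P : PSet) : Prop := (Sat P).Nonempty

/-- The set of compositions `tθ` with `t ∈ T`, as substitutions for the constraint set `P`:
all rows are well-formed, and only the variables in `N` count. -/
def composeSet (N : Finset (Kind × ℕ)) (P : PSet) (T : Set (Subst ℕ ℕ)) (θ : Subst ℕ ℕ) :
    Set (Subst ℕ ℕ) :=
  {s | s.WFFor P ∧ ∃ t ∈ T, s.AgreeOn N (t.comp θ)}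

/-! ## Factorisation -/

/-- Factorisation of `τ ≼ τ'` when neither side can be decomposed. -/
def factAtom (τ τ' : Typ ℕ) : PSet :=
  if τ = τ' ∨ τ' = .lin .any ∨ τ = .lin .unl then ∅ else {.lin τ τ'}

/-- Factorisation of `τ ≼ τ'` when the left side cannot be decomposed. -/
def factRight (τ τ' : Typ ℕ) : PSet :=
  if τ = τ' ∨ τ' = .lin .any ∨ τ = .lin .unl then ∅ else
  match τ' with
  | .row R =>
      R.labels.toFinset.biUnion (fun e => factAtom τ (.lin e.2)) ∪
        (match R.tail with
          | some μ => factAtom τ (.row (Row.var μ))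
          | none => ∅)
  | τ' => factAtom τ τ'

def factLin (τ τ' : Typ ℕ) : PSet :=
  if τ = τ' ∨ τ' = .lin .any ∨ τ = .lin .unl then ∅ else
  match τ with
  | .val (.arrow _ Y _ _) => factRight (.lin Y) τ'
  | τ => factRight τ τ'

instance (R₁ R₂ : Row ℕ) : Decidable (R₁.Sub R₂) :=
  decidable_of_iff ((∀ e ∈ R₁.labels, e ∈ R₂.labels) ∧
      (R₁.tail = none ∨ R₁.tail = R₂.tail)) (by
    unfold Row.Sub
    refine and_congr_right (fun _ => ?_)
    cases R₁.tail <;> simp [eq_comm])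

def factorise : Pred ℕ → PSet
  | .lin τ τ' => factLin τ τ'
  | .sub R₁ R₂ => if R₁.Sub R₂ then ∅ else {.sub R₁ R₂}
  | .lack R L => if Disjoint (CRow.dom R.labels) L then ∅ else {.lack R L}

def factoriseSet (P : PSet) : PSet := P.biUnion factorise

/-! ## Unification of linearity types and of shared labels -/

/-- Unification of two linearity types; `none` is failure. -/
def ulin : Lin ℕ → Lin ℕ → Option (Subst ℕ ℕ)
  | .unl, .unl => some Subst.id
  | .any, .any => some Subst.id
  | .unl, .any => none
  | .any, .unl => none
  | .var φ, Y => if Y = .var φ then some Subst.id else some (Subst.oneLin φ Y)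
  | Y, .var φ => some (Subst.oneLin φ Y)

/-- `ULab K₁ K₂ r`: unifying the linearities of the shared labels of `K₁` and `K₂` can
return `r`, where `none` is failure.  Rows are unordered, so shared labels may be met in any
order. -/
inductive ULab : CRow ℕ → CRow ℕ → Option (Subst ℕ ℕ) → Prop
  | nil_left (K : CRow ℕ) : ULab 0 K (some Subst.id)
  | nil_right (K : CRow ℕ) : ULab K 0 (some Subst.id)
  | shared {ℓ : ℕ} {Y₁ Y₂ : Lin ℕ} {K₁ K₂ : CRow ℕ} {θ : Subst ℕ ℕ} {r : Option (Subst ℕ ℕ)} :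
      ulin Y₁ Y₂ = some θ →
      ULab (CRow.subst θ K₁) (CRow.subst θ K₂) r →
      ULab ((ℓ, Y₁) ::ₘ K₁) ((ℓ, Y₂) ::ₘ K₂) (r.map (fun θ' => θ'.comp θ))
  | clash {ℓ : ℕ} {Y₁ Y₂ : Lin ℕ} {K₁ K₂ : CRow ℕ} :
      ulin Y₁ Y₂ = none → ULab ((ℓ, Y₁) ::ₘ K₁) ((ℓ, Y₂) ::ₘ K₂) none
  | skip_left {ℓ : ℕ} {Y : Lin ℕ} {K₁ K₂ : CRow ℕ} {r : Option (Subst ℕ ℕ)} :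
      ℓ ∉ CRow.dom K₂ → ULab K₁ K₂ r → ULab ((ℓ, Y) ::ₘ K₁) K₂ r
  | skip_right {ℓ : ℕ} {Y : Lin ℕ} {K₁ K₂ : CRow ℕ} {r : Option (Subst ℕ ℕ)} :
      ℓ ∉ CRow.dom K₁ → ULab K₁ K₂ r → ULab K₁ ((ℓ, Y) ::ₘ K₂) r

/-! ## The constraint solver

The solver is a transition system.  `run N θ P Q` is a call of the row solver with current
substitution `θ`, solved predicates `P` and unsolved predicates `Q`; `N` holds the variables
used so far.  `close θ Q T W` computes the transitive closure `T` of the linearity predicates of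
the factorised set, of which `W` is still to be processed. -/

inductive Config
  | run (N : Finset (Kind × ℕ)) (θ : Subst ℕ ℕ) (P Q : PSet)
  | close (θ : Subst ℕ ℕ) (Q : PSet) (T : Finset (Typ ℕ × Typ ℕ)) (W : PSet)
  | done (θ : Subst ℕ ℕ) (Q : PSet)
  | fail

/-- The case `K₁;t₁ ⩽ K₂;t₂` of the row solver, after the shared labels have been unified by
`θ'`.  `P` and `Q` are the solved predicates and the remaining unsolved ones, and `μ` is the fresh
row variable.  `none` is failure. -/
def subCase (θ : Subst ℕ ℕ) (P Q : PSet) (μ : ℕ) (K₁ : CRow ℕ) (t₁ : Option ℕ) (K₂ : CRow ℕ)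
    (t₂ : Option ℕ) (θ' : Subst ℕ ℕ) : Option (Subst ℕ ℕ × PSet × PSet) :=
  let K₁' := CRow.subst θ' K₁
  let K₂' := CRow.subst θ' K₂
  let P' := PSet.subst θ' P
  let Q' := PSet.subst θ' Q
  match t₁, t₂ with
  | none, none =>
      if ∀ e ∈ K₁', e ∈ K₂' then some (θ'.comp θ, P', Q') else none
  | some μ₁, none =>
      if ∀ e ∈ K₁', e ∈ K₂' then
        some (θ'.comp θ, insert (.sub (Row.var μ₁) ⟨CRow.diff K₂' K₁', none⟩) P', Q')
      else none
  | none, some μ₂ =>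
      if ∀ e ∈ K₁', e ∈ K₂' then some (θ'.comp θ, P', Q')
      else
        let θ'' := (Subst.oneRow μ₂ ⟨CRow.diff K₁' K₂', some μ⟩).comp θ'
        some (θ''.comp θ, ∅, PSet.subst θ'' (Q ∪ P))
  | some μ₁, some μ₂ =>
      if μ₁ = μ₂ then
        if ∀ e ∈ K₁', e ∈ K₂' then some (θ'.comp θ, P', Q') else none
      else if ∀ e ∈ K₁', e ∈ K₂' then
        some (θ'.comp θ, insert (.sub (Row.var μ₁) ⟨CRow.diff K₂' K₁', some μ₂⟩) P', Q')
      else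
        let θ'' := (Subst.oneRow μ₂ ⟨CRow.diff K₁' K₂', some μ⟩).comp θ'
        some (θ''.comp θ, {.sub (Row.var μ₁) ⟨CRow.diff K₂' K₁', some μ⟩},
          PSet.subst θ'' (Q ∪ P))

/-- One unfolding of the row solver, by cases on the predicate it looks at. -/
inductive RowStep (θ : Subst ℕ ℕ) (P Q : PSet) (μ : ℕ) :
    Pred ℕ → Option (Subst ℕ ℕ × PSet × PSet) → Prop
  | lin (τ₁ τ₂ : Typ ℕ) : RowStep θ P Q μ (.lin τ₁ τ₂) (some (θ, insert (.lin τ₁ τ₂) P, Q))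
  | sub {K₁ K₂ : CRow ℕ} {t₁ t₂ : Option ℕ} {r : Option (Subst ℕ ℕ)} :
      ULab K₁ K₂ r →
      RowStep θ P Q μ (.sub ⟨K₁, t₁⟩ ⟨K₂, t₂⟩) (r.bind (subCase θ P Q μ K₁ t₁ K₂ t₂))
  | lack_closed (K : CRow ℕ) (L : Finset ℕ) :
      RowStep θ P Q μ (.lack ⟨K, none⟩ L)
        (if Disjoint (CRow.dom K) L then some (θ, P, Q) else none)
  | lack_open (K : CRow ℕ) (μ₁ : ℕ) (L : Finset ℕ) :
      RowStep θ P Q μ (.lack ⟨K, some μ₁⟩ L)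
        (if Disjoint (CRow.dom K) L then some (θ, insert (.lack (Row.var μ₁) L) P, Q) else none)

/-- Add the pair `τ₁ ≼ τ₂` to a transitively closed relation `T`. -/
def closeStep (T : Finset (Typ ℕ × Typ ℕ)) (τ₁ τ₂ : Typ ℕ) : Finset (Typ ℕ × Typ ℕ) :=
  let T' := T ∪ {(τ₁, τ₁), (τ₂, τ₂)}
  T ∪ ((T'.filter (fun p => p.2 = τ₁)).image Prod.fst) ×ˢ
    ((T'.filter (fun p => p.1 = τ₂)).image Prod.snd)

/-- The transitions of the solver for the constraint set `P₀`.  As all rows have to be well-formed,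
it also fails when the current substitution duplicates a label in some row of `P₀`. -/
inductive Step (P₀ : PSet) : Config → Config → Prop
  | row {N : Finset (Kind × ℕ)} {θ θ' : Subst ℕ ℕ} {P P' Q Q' : PSet} {π : Pred ℕ} {μ : ℕ} :
      π ∈ Q → (Kind.row, μ) ∉ N →
      RowStep θ P (Q.erase π) μ π (some (θ', P', Q')) →
      (PSet.subst θ' P₀).WF →
      Step P₀ (.run N θ P Q) (.run (insert (Kind.row, μ) N) θ' P' Q')
  | row_fail {N : Finset (Kind × ℕ)} {θ : Subst ℕ ℕ} {P Q : PSet} {π : Pred ℕ} {μ : ℕ} :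
      π ∈ Q → (Kind.row, μ) ∉ N →
      RowStep θ P (Q.erase π) μ π none →
      Step P₀ (.run N θ P Q) .fail
  | row_dup {N : Finset (Kind × ℕ)} {θ θ' : Subst ℕ ℕ} {P P' Q Q' : PSet} {π : Pred ℕ} {μ : ℕ} :
      π ∈ Q → (Kind.row, μ) ∉ N →
      RowStep θ P (Q.erase π) μ π (some (θ', P', Q')) →
      ¬ (PSet.subst θ' P₀).WF →
      Step P₀ (.run N θ P Q) .fail
  | row_done {N : Finset (Kind × ℕ)} {θ : Subst ℕ ℕ} {P : PSet} :
      Step P₀ (.run N θ P ∅) (.close θ P ∅ (factoriseSet P))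
  | close_lin {θ : Subst ℕ ℕ} {Q W : PSet} {T : Finset (Typ ℕ × Typ ℕ)} {τ₁ τ₂ : Typ ℕ} :
      Pred.lin τ₁ τ₂ ∈ W →
      Step P₀ (.close θ Q T W) (.close θ Q (closeStep T τ₁ τ₂) (W.erase (.lin τ₁ τ₂)))
  | close_sub {θ : Subst ℕ ℕ} {Q W : PSet} {T : Finset (Typ ℕ × Typ ℕ)} {R₁ R₂ : Row ℕ} :
      Pred.sub R₁ R₂ ∈ W →
      Step P₀ (.close θ Q T W) (.close θ Q T (W.erase (.sub R₁ R₂)))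
  | close_lack {θ : Subst ℕ ℕ} {Q W : PSet} {T : Finset (Typ ℕ × Typ ℕ)} {R : Row ℕ}
      {L : Finset ℕ} :
      Pred.lack R L ∈ W →
      Step P₀ (.close θ Q T W) (.close θ Q T (W.erase (.lack R L)))
  | accept {θ : Subst ℕ ℕ} {Q : PSet} {T : Finset (Typ ℕ × Typ ℕ)} :
      (Typ.lin Lin.any, Typ.lin Lin.unl) ∉ T →
      Step P₀ (.close θ Q T ∅) (.done θ Q)
  | reject {θ : Subst ℕ ℕ} {Q : PSet} {T : Finset (Typ ℕ × Typ ℕ)} :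
      (Typ.lin Lin.any, Typ.lin Lin.unl) ∈ T →
      Step P₀ (.close θ Q T ∅) .fail

/-- The call `solve(P)`, in a context where the variables in `N` are in use. -/
def solveInit (N : Finset (Kind × ℕ)) (P : PSet) : Config := .run N Subst.id ∅ P

/-- `solve(P)` always terminates: there is no infinite run, whatever the choices of predicates and
fresh variables, and no run gets stuck before it fails or returns a result. -/
def SolveTerminates (N : Finset (Kind × ℕ)) (P : PSet) : Prop :=
  Acc (fun c' c => Step P c c') (solveInit N P) ∧
  ∀ c, Relation.ReflTransGen (Step P) (solveInit N P) c →
    (∃ c', Step P c c') ∨ c = .fail ∨ ∃ θ Q, c = .done θ Q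

/-- `solve(P)` fails. -/
def SolveFails (N : Finset (Kind × ℕ)) (P : PSet) : Prop :=
  Relation.ReflTransGen (Step P) (solveInit N P) .fail

/-- `solve(P)` returns `(θ, Q)`. -/
def SolveReturns (N : Finset (Kind × ℕ)) (P : PSet) (θ : Subst ℕ ℕ) (Q : PSet) : Prop :=
  Relation.ReflTransGen (Step P) (solveInit N P) (.done θ Q)

/-! ## Unification -/

/-- Unification predicates. -/
inductive UEq
  | val (A B : Ty ℕ)
  | comp (C D : CTy ℕ)
  | row (R R' : Row ℕ)
  | lin (Y Y' : Lin ℕ)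

def UEq.subst (θ : Subst ℕ ℕ) : UEq → UEq
  | .val A B => .val (A.subst θ) (B.subst θ)
  | .comp C D => .comp (C.subst θ) (D.subst θ)
  | .row R R' => .row (R.subst θ) (R'.subst θ)
  | .lin Y Y' => .lin (Y.subst θ) (Y'.subst θ)

/-- `Unify N U θ N'`: unification of `U` succeeds with `θ`; the variables in use are `N` before
and `N'` after. -/
inductive Unify : Finset (Kind × ℕ) → List UEq → Subst ℕ ℕ → Finset (Kind × ℕ) → Prop
  | nil {N : Finset (Kind × ℕ)} : Unify N [] Subst.id N
  | var_refl {N N' : Finset (Kind × ℕ)} {U : List UEq} {θ : Subst ℕ ℕ} {α : ℕ} :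
      Unify N U θ N' → Unify N (.val (.var α) (.var α) :: U) θ N'
  | var_left {N N' : Finset (Kind × ℕ)} {U : List UEq} {θ : Subst ℕ ℕ} {α : ℕ} {A : Ty ℕ} :
      (Kind.ty, α) ∉ A.fv →
      Unify N (U.map (UEq.subst (Subst.oneTy α A))) θ N' →
      Unify N (.val (.var α) A :: U) (θ.comp (Subst.oneTy α A)) N'
  | var_right {N N' : Finset (Kind × ℕ)} {U : List UEq} {θ : Subst ℕ ℕ} {α : ℕ} {A : Ty ℕ} :
      Unify N (.val (.var α) A :: U) θ N' → Unify N (.val A (.var α) :: U) θ N'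
  | comp {N N' : Finset (Kind × ℕ)} {U : List UEq} {θ : Subst ℕ ℕ} {C D : CTy ℕ} :
      Unify N (.val C.val D.val :: .row C.eff D.eff :: U) θ N' →
      Unify N (.comp C D :: U) θ N'
  | arrow {N N' : Finset (Kind × ℕ)} {U : List UEq} {θ : Subst ℕ ℕ} {A A' B B' : Ty ℕ}
      {Y Y' : Lin ℕ} {R R' : Row ℕ} :
      Unify N (.val A A' :: .comp ⟨B, R⟩ ⟨B', R'⟩ :: .lin Y Y' :: U) θ N' →
      Unify N (.val (.arrow A Y B R) (.arrow A' Y' B' R') :: U) θ N'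
  | lin {N N' : Finset (Kind × ℕ)} {U : List UEq} {θ θ' : Subst ℕ ℕ} {Y Y' : Lin ℕ} :
      ulin Y Y' = some θ →
      Unify N (U.map (UEq.subst θ)) θ' N' →
      Unify N (.lin Y Y' :: U) (θ'.comp θ) N'
  | row_closed {N N' : Finset (Kind × ℕ)} {U : List UEq} {θ θ' : Subst ℕ ℕ} {K₁ K₂ : CRow ℕ} :
      ULab K₁ K₂ (some θ) →
      (∀ e, e ∈ CRow.subst θ K₁ ↔ e ∈ CRow.subst θ K₂) →
      Unify N (U.map (UEq.subst θ)) θ' N' →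
      Unify N (.row ⟨K₁, none⟩ ⟨K₂, none⟩ :: U) (θ'.comp θ) N'
  | row_same_tail {N N' : Finset (Kind × ℕ)} {U : List UEq} {θ θ' : Subst ℕ ℕ} {K₁ K₂ : CRow ℕ}
      {μ : ℕ} :
      ULab K₁ K₂ (some θ) →
      (∀ e, e ∈ CRow.subst θ K₁ ↔ e ∈ CRow.subst θ K₂) →
      Unify N (U.map (UEq.subst θ)) θ' N' →
      Unify N (.row ⟨K₁, some μ⟩ ⟨K₂, some μ⟩ :: U) (θ'.comp θ) N'
  | row_open_closed {N N' : Finset (Kind × ℕ)} {U : List UEq} {θ θ' θ'' : Subst ℕ ℕ}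
      {K₁ K₂ : CRow ℕ} {μ₁ : ℕ} :
      ULab K₁ K₂ (some θ) →
      (∀ e ∈ CRow.subst θ K₁, e ∈ CRow.subst θ K₂) →
      θ' = Subst.oneRow μ₁ ⟨CRow.diff (CRow.subst θ K₂) (CRow.subst θ K₁), none⟩ →
      Unify N (U.map (UEq.subst (θ'.comp θ))) θ'' N' →
      Unify N (.row ⟨K₁, some μ₁⟩ ⟨K₂, none⟩ :: U) (θ''.comp (θ'.comp θ)) N'
  | row_closed_open {N N' : Finset (Kind × ℕ)} {U : List UEq} {θ : Subst ℕ ℕ}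
      {K₁ K₂ : CRow ℕ} {μ₁ : ℕ} :
      Unify N (.row ⟨K₁, some μ₁⟩ ⟨K₂, none⟩ :: U) θ N' →
      Unify N (.row ⟨K₂, none⟩ ⟨K₁, some μ₁⟩ :: U) θ N'
  | row_open {N N' : Finset (Kind × ℕ)} {U : List UEq} {θ θ' θ'' : Subst ℕ ℕ}
      {K₁ K₂ : CRow ℕ} {μ₁ μ₂ μ : ℕ} :
      μ₁ ≠ μ₂ →
      ULab K₁ K₂ (some θ) →
      (Kind.row, μ) ∉ N →
      θ' = (Subst.oneRow μ₁ ⟨CRow.diff (CRow.subst θ K₂) (CRow.subst θ K₁), some μ⟩).comp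
        (Subst.oneRow μ₂ ⟨CRow.diff (CRow.subst θ K₁) (CRow.subst θ K₂), some μ⟩) →
      Unify (insert (Kind.row, μ) N) (U.map (UEq.subst (θ'.comp θ))) θ'' N' →
      Unify N (.row ⟨K₁, some μ₁⟩ ⟨K₂, some μ₂⟩ :: U) (θ''.comp (θ'.comp θ)) N'

/-! ## Type schemes and contexts -/

/-- Type schemes `∀ ᾱ. P ⇒ A`.  Variables `Sum.inl n` are free and variables `Sum.inr n` are bound
by the quantifier prefix. -/
structure Scheme where
  quals : Finset (Pred (ℕ ⊕ ℕ))
  body : Ty (ℕ ⊕ ℕ)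

/-- All variables that occur in a scheme. -/
def Scheme.vars (σ : Scheme) : Finset (Kind × (ℕ ⊕ ℕ)) := σ.quals.biUnion Pred.fv ∪ σ.body.fv

/-- The free variables of a scheme. -/
def Scheme.fv (σ : Scheme) : Finset (Kind × ℕ) :=
  σ.vars.biUnion (fun x => match x with
    | (k, .inl n) => {(k, n)}
    | (_, .inr _) => ∅)

/-- The quantified variables of a scheme. -/
def Scheme.bv (σ : Scheme) : Finset (Kind × ℕ) :=
  σ.vars.biUnion (fun x => match x with
    | (k, .inr n) => {(k, n)}
    | (_, .inl _) => ∅)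

/-- A substitution of free variables, which leaves bound variables alone. -/
def Subst.lift (θ : Subst ℕ ℕ) : Subst (ℕ ⊕ ℕ) (ℕ ⊕ ℕ) where
  ty := Sum.elim (fun n => (θ.ty n).subst (Subst.ren (fun _ => Sum.inl))) (fun n => .var (.inr n))
  row := Sum.elim (fun n => (θ.row n).subst (Subst.ren (fun _ => Sum.inl)))
    (fun n => .var (.inr n))
  lin := Sum.elim (fun n => (θ.lin n).subst (Subst.ren (fun _ => Sum.inl)))
    (fun n => .var (.inr n))

def Scheme.subst (θ : Subst ℕ ℕ) (σ : Scheme) : Scheme :=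
  ⟨σ.quals.image (Pred.subst θ.lift), σ.body.subst θ.lift⟩

/-- A value type as a scheme without quantifiers and qualifiers. -/
def Scheme.mono (A : Ty ℕ) : Scheme := ⟨∅, A.subst (Subst.ren (fun _ => Sum.inl))⟩

/-- The substitution that renames the bound variables to `f`. -/
def instSubst (f : Kind → ℕ → ℕ) : Subst (ℕ ⊕ ℕ) ℕ :=
  Subst.ren (fun k => Sum.elim (fun n => n) (f k))

def Scheme.instQuals (f : Kind → ℕ → ℕ) (σ : Scheme) : PSet :=
  σ.quals.image (Pred.subst (instSubst f))

def Scheme.instBody (f : Kind → ℕ → ℕ) (σ : Scheme) : Ty ℕ := σ.body.subst (instSubst f)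

/-- `f` names the bound variables of `σ` by distinct variables outside `N`. -/
def FreshInst (N : Finset (Kind × ℕ)) (σ : Scheme) (f : Kind → ℕ → ℕ) : Prop :=
  (∀ x ∈ σ.bv, (x.1, f x.1 x.2) ∉ N) ∧
  ∀ x ∈ σ.bv, ∀ y ∈ σ.bv, x.1 = y.1 → f x.1 x.2 = f y.1 y.2 → x = y

/-- The names that `f` gives to the bound variables of `σ`. -/
def freshNames (σ : Scheme) (f : Kind → ℕ → ℕ) : Finset (Kind × ℕ) :=
  σ.bv.image (fun x => (x.1, f x.1 x.2))

/-- Type contexts. -/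
abbrev Env := List (ℕ × Scheme)

def Env.dom (Γ : Env) : Finset ℕ := (Γ.map Prod.fst).toFinset

def Env.fv : Env → Finset (Kind × ℕ)
  | [] => ∅
  | (_, σ) :: Γ => σ.fv ∪ Env.fv Γ

def Env.subst (θ : Subst ℕ ℕ) (Γ : Env) : Env := Γ.map (fun p => (p.1, p.2.subst θ))

/-- `Γ|_S`. -/
def Env.restrict (Γ : Env) (S : Finset ℕ) : Env := Γ.filter (fun p => p.1 ∈ S)

/-- `Γ` restricted to the complement of `S`. -/
def Env.unused (Γ : Env) (S : Finset ℕ) : Env := Γ.filter (fun p => p.1 ∉ S)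

/-- `gen(Γ, P ⇒ A)`: quantify the variables that are not free in `Γ`. -/
def gen (Γ : Env) (P : PSet) (A : Ty ℕ) : Scheme :=
  let g : Subst ℕ (ℕ ⊕ ℕ) :=
    Subst.ren (fun k n => if (k, n) ∈ Env.fv Γ then Sum.inl n else Sum.inr n)
  ⟨P.image (Pred.subst g), A.subst g⟩

/-- `MakeLeq N Γ τ Q N'`: the factorisation of `Γ ≼ τ` is `Q`; quantified variables of `Γ` are
instantiated by fresh ones. -/
inductive MakeLeq : Finset (Kind × ℕ) → Env → Typ ℕ → PSet → Finset (Kind × ℕ) → Prop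
  | nil {N : Finset (Kind × ℕ)} {τ : Typ ℕ} : MakeLeq N [] τ ∅ N
  | cons {N N' : Finset (Kind × ℕ)} {x : ℕ} {σ : Scheme} {Γ : Env} {τ : Typ ℕ} {Q : PSet}
      {f : Kind → ℕ → ℕ} :
      FreshInst N σ f →
      MakeLeq (N ∪ freshNames σ f) Γ τ Q N' →
      MakeLeq N ((x, σ) :: Γ) τ
        (factoriseSet (σ.instQuals f) ∪ factorise (.lin (.val (σ.instBody f)) τ) ∪ Q) N'

/-- The factorisation of `Γ ≼ •`. -/
def MakeUnl (N : Finset (Kind × ℕ)) (Γ : Env) (Q : PSet) (N' : Finset (Kind × ℕ)) : Prop :=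
  MakeLeq N Γ (.lin .unl) Q N'

/-! ## Terms -/

mutual

inductive Val
  | var (x : ℕ)
  | lam (x : ℕ) (M : Comp)

inductive Comp
  | app (V W : Val)
  | ret (V : Val)
  | perform (ℓ : ℕ) (V : Val)
  | letval (x : ℕ) (V : Val) (M : Comp)
  | seq (x : ℕ) (M N : Comp)
  | handle (M : Comp) (H : Handler)

/-- A handler: the clause `return x ↦ M` and the operation clauses. -/
inductive Handler
  | mk (x : ℕ) (M : Comp) (cs : Clauses)

/-- Operation clauses `ℓ p r ↦ M`. -/
inductive Clauses
  | nil
  | cons (ℓ p r : ℕ) (M : Comp) (cs : Clauses)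

end

/-! ## Type inference -/

/-- The global context that gives the parameter and result types of the operations. -/
abbrev Sig := List (ℕ × (Ty ℕ × Ty ℕ))

def Sig.fv : Sig → Finset (Kind × ℕ)
  | [] => ∅
  | (_, A, B) :: S => A.fv ∪ B.fv ∪ Sig.fv S

/-- What the inference for an operation clause `ℓ p r ↦ M` records: the signature of `ℓ`, the fresh
linearity variable `φ`, the predicates and the used term variables. -/
structure OpInfo where
  label : ℕ
  param : ℕ
  resume : ℕ
  argTy : Ty ℕ
  resTy : Ty ℕ
  φ : ℕ
  preds : PSet
  used : Finset ℕ

/-- The context `p : A_ℓ, r : B_ℓ →^φ D` of an operation clause. -/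
def OpInfo.env (i : OpInfo) (D : CTy ℕ) : Env :=
  [(i.param, Scheme.mono i.argTy),
    (i.resume, Scheme.mono (.arrow i.resTy (.var i.φ) D.val D.eff))]

mutual

/-- `InferV S N Γ V A θ P Σ N'`: from `Γ` and `V`, inference produces the type `A`, the
substitution `θ`, the predicate set `P` and the set `Σ` of used term variables.  `N` and `N'` hold
the type variables in use before and after. -/
inductive InferV (S : Sig) : Finset (Kind × ℕ) → Env → Val → Ty ℕ → Subst ℕ ℕ → PSet →
    Finset ℕ → Finset (Kind × ℕ) → Prop
  | var {N : Finset (Kind × ℕ)} {Γ : Env} {x : ℕ} {σ : Scheme} {f : Kind → ℕ → ℕ} :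
      Γ.lookup x = some σ →
      FreshInst N σ f →
      InferV S N Γ (.var x) (σ.instBody f) Subst.id (σ.instQuals f) {x} (N ∪ freshNames σ f)
  | lam {N N₁ N₂ N₃ : Finset (Kind × ℕ)} {Γ : Env} {x α φ : ℕ} {M : Comp} {C : CTy ℕ}
      {θ : Subst ℕ ℕ} {P Q₁ Q₂ : PSet} {used : Finset ℕ} :
      x ∉ Env.dom Γ →
      (Kind.ty, α) ∉ N → (Kind.lin, φ) ∉ N →
      InferC S ({(Kind.ty, α), (Kind.lin, φ)} ∪ N) ((x, Scheme.mono (.var α)) :: Γ) M C θ P used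
        N₁ →
      MakeLeq N₁ (Env.restrict (Env.subst θ Γ) used) (.lin (.var φ)) Q₁ N₂ →
      MakeUnl N₂ (Env.unused (Env.subst θ [(x, Scheme.mono (.var α))]) used) Q₂ N₃ →
      InferV S N Γ (.lam x M) (.arrow (θ.ty α) (.var φ) C.val C.eff) θ (P ∪ (Q₁ ∪ Q₂))
        (used.erase x) N₃

/-- Inference for computations. -/
inductive InferC (S : Sig) : Finset (Kind × ℕ) → Env → Comp → CTy ℕ → Subst ℕ ℕ → PSet →
    Finset ℕ → Finset (Kind × ℕ) → Prop
  | app {N N₁ N₂ N₃ N₄ : Finset (Kind × ℕ)} {Γ : Env} {V W : Val} {A B : Ty ℕ}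
      {θ₁ θ₂ θ₃ : Subst ℕ ℕ} {P₁ P₂ Q : PSet} {used₁ used₂ : Finset ℕ} {α μ φ : ℕ} :
      InferV S N Γ V A θ₁ P₁ used₁ N₁ →
      InferV S N₁ (Env.subst θ₁ Γ) W B θ₂ P₂ used₂ N₂ →
      (Kind.ty, α) ∉ N₂ → (Kind.row, μ) ∉ N₂ → (Kind.lin, φ) ∉ N₂ →
      Unify ({(Kind.ty, α), (Kind.row, μ), (Kind.lin, φ)} ∪ N₂)
        [.val (A.subst θ₂) (.arrow B (.var φ) (.var α) (Row.var μ))] θ₃ N₃ →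
      MakeUnl N₃ (Env.restrict (Env.subst θ₃ (Env.subst θ₂ (Env.subst θ₁ Γ))) (used₁ ∩ used₂)) Q
        N₄ →
      InferC S N Γ (.app V W) (CTy.subst θ₃ ⟨.var α, Row.var μ⟩) (θ₃.comp (θ₂.comp θ₁))
        (PSet.subst θ₃ (PSet.subst θ₂ P₁ ∪ P₂) ∪ Q) (used₁ ∪ used₂) N₄
  | ret {N N₁ : Finset (Kind × ℕ)} {Γ : Env} {V : Val} {A : Ty ℕ} {θ : Subst ℕ ℕ} {P : PSet}
      {used : Finset ℕ} {μ : ℕ} :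
      InferV S N Γ V A θ P used N₁ →
      (Kind.row, μ) ∉ N₁ →
      InferC S N Γ (.ret V) ⟨A, Row.var μ⟩ θ P used (insert (Kind.row, μ) N₁)
  | perform {N N₁ N₂ : Finset (Kind × ℕ)} {Γ : Env} {ℓ : ℕ} {V : Val} {A Aℓ Bℓ : Ty ℕ}
      {θ₁ θ₂ : Subst ℕ ℕ} {P : PSet} {used : Finset ℕ} {μ φ : ℕ} :
      S.lookup ℓ = some (Aℓ, Bℓ) →
      InferV S N Γ V A θ₁ P used N₁ →
      Unify N₁ [.val A Aℓ] θ₂ N₂ →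
      (Kind.row, μ) ∉ N₂ → (Kind.lin, φ) ∉ N₂ →
      InferC S N Γ (.perform ℓ V) ⟨Bℓ, Row.var μ⟩ (θ₂.comp θ₁)
        (PSet.subst θ₂ P ∪ factorise (.sub ⟨{(ℓ, .var φ)}, none⟩ (Row.var μ))) used
        ({(Kind.row, μ), (Kind.lin, φ)} ∪ N₂)
  | letval {N N₁ N₂ N₃ N₄ : Finset (Kind × ℕ)} {Γ : Env} {x : ℕ} {V : Val} {M : Comp} {A : Ty ℕ}
      {C : CTy ℕ} {θ₁ θ₂ : Subst ℕ ℕ} {P₁ P₂ Q₁ Q₂ : PSet} {used₁ used₂ : Finset ℕ} {σ : Scheme} :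
      x ∉ Env.dom Γ →
      InferV S N Γ V A θ₁ P₁ used₁ N₁ →
      σ = gen (Env.subst θ₁ Γ) P₁ A →
      InferC S N₁ ((x, σ) :: Env.subst θ₁ Γ) M C θ₂ P₂ used₂ N₂ →
      MakeUnl N₂ (Env.restrict (Env.subst θ₂ (Env.subst θ₁ Γ)) (used₁ ∩ used₂)) Q₁ N₃ →
      MakeUnl N₃ (Env.unused (Env.subst θ₂ [(x, σ)]) used₂) Q₂ N₄ →
      InferC S N Γ (.letval x V M) C (θ₂.comp θ₁) (P₂ ∪ (Q₁ ∪ Q₂)) (used₁ ∪ used₂.erase x) N₄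
  | seq {N N₁ N₂ N₃ N₄ N₅ : Finset (Kind × ℕ)} {Γ : Env} {x : ℕ} {L M : Comp} {A B : Ty ℕ}
      {R₁ R₂ : Row ℕ} {θ₁ θ₂ : Subst ℕ ℕ} {P₁ P₂ Q₁ Q₂ Q₃ : PSet} {used₁ used₂ : Finset ℕ}
      {μ : ℕ} :
      x ∉ Env.dom Γ →
      InferC S N Γ L ⟨A, R₁⟩ θ₁ P₁ used₁ N₁ →
      InferC S N₁ ((x, Scheme.mono A) :: Env.subst θ₁ Γ) M ⟨B, R₂⟩ θ₂ P₂ used₂ N₂ →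
      (Kind.row, μ) ∉ N₂ →
      MakeUnl (insert (Kind.row, μ) N₂)
        (Env.restrict (Env.subst θ₂ (Env.subst θ₁ Γ)) (used₁ ∩ used₂)) Q₁ N₃ →
      MakeUnl N₃ (Env.unused (Env.subst θ₂ [(x, Scheme.mono A)]) used₂) Q₂ N₄ →
      MakeLeq N₄ (Env.restrict (Env.subst θ₂ (Env.subst θ₁ Γ)) used₂) (.row (R₁.subst θ₂)) Q₃
        N₅ →
      InferC S N Γ (.seq x L M) ⟨B, Row.var μ⟩ (θ₂.comp θ₁)
        (PSet.subst θ₂ P₁ ∪ P₂ ∪ (Q₁ ∪ Q₂ ∪ Q₃ ∪ factorise (.sub (R₁.subst θ₂) (Row.var μ)) ∪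
          factorise (.sub R₂ (Row.var μ))))
        (used₁ ∪ used₂.erase x) N₅
  | handle {N N₁ N₂ N₃ N₄ : Finset (Kind × ℕ)} {Γ : Env} {M : Comp} {H : Handler} {A A' : Ty ℕ}
      {R R₁ : Row ℕ} {D : CTy ℕ} {θ₁ θ₂ θ₃ : Subst ℕ ℕ} {P₁ P₂ Q : PSet}
      {used₁ used₂ : Finset ℕ} :
      InferH S N Γ H ⟨A, R₁⟩ D θ₁ P₁ used₁ N₁ →
      InferC S N₁ (Env.subst θ₁ Γ) M ⟨A', R⟩ θ₂ P₂ used₂ N₂ →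
      Unify N₂ [.val (A.subst θ₂) A'] θ₃ N₃ →
      MakeUnl N₃ (Env.restrict (Env.subst θ₃ (Env.subst θ₂ (Env.subst θ₁ Γ))) (used₁ ∩ used₂)) Q
        N₄ →
      InferC S N Γ (.handle M H) (CTy.subst θ₃ (CTy.subst θ₂ D)) (θ₃.comp (θ₂.comp θ₁))
        (PSet.subst θ₃ (PSet.subst θ₂ P₁ ∪ P₂) ∪
          (factorise (.sub (R.subst θ₃) ((R₁.subst θ₂).subst θ₃)) ∪ Q))
        (used₁ ∪ used₂) N₄

/-- Inference for handlers, with the handler type `C ⇉ D`. -/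
inductive InferH (S : Sig) : Finset (Kind × ℕ) → Env → Handler → CTy ℕ → CTy ℕ → Subst ℕ ℕ →
    PSet → Finset ℕ → Finset (Kind × ℕ) → Prop
  | mk {N N₀ N₁ N₂ N₃ N₄ : Finset (Kind × ℕ)} {Γ : Env} {x : ℕ} {M : Comp} {cs : Clauses}
      {D : CTy ℕ} {θ₀ θ : Subst ℕ ℕ} {P₀ Q₁ Q₂ Q₃ : PSet} {used₀ used : Finset ℕ} {α μ : ℕ}
      {ops : List OpInfo} :
      x ∉ Env.dom Γ →
      (Kind.ty, α) ∉ N → (Kind.row, μ) ∉ N →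
      InferC S ({(Kind.ty, α), (Kind.row, μ)} ∪ N) ((x, Scheme.mono (.var α)) :: Γ) M D θ₀ P₀
        used₀ N₀ →
      InferOps S N₀ Γ D θ₀ cs θ ops N₁ →
      (ops.map OpInfo.label).Nodup →
      used = used₀.erase x ∪
        ops.foldr (fun i T => (i.used \ {i.param, i.resume}) ∪ T) ∅ →
      MakeUnl N₁ (Env.restrict (Env.subst θ Γ) used) Q₁ N₂ →
      MakeUnl N₂ (Env.unused (Env.subst θ [(x, Scheme.mono (.var α))]) used₀) Q₂ N₃ →
      MakeUnl N₃ (ops.flatMap (fun i => Env.unused (Env.subst θ (i.env D)) i.used)) Q₃ N₄ →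
      InferH S N Γ (.mk x M cs)
        (CTy.subst θ ⟨.var α,
          ⟨((ops.map (fun i => (i.label, Lin.var i.φ)) : List (ℕ × Lin ℕ)) : CRow ℕ), some μ⟩⟩)
        (D.subst θ) θ
        (PSet.subst θ P₀ ∪ ops.foldr (fun i T => PSet.subst θ i.preds ∪ T) ∅ ∪ Q₁ ∪
          factorise (.sub (Row.var μ) (D.eff.subst θ)) ∪
          factorise (.lack (Row.var μ) (ops.map OpInfo.label).toFinset) ∪ (Q₂ ∪ Q₃))
        used N₄

/-- Inference for the operation clauses of a handler, in order.  `θ` is the substitution so far,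
and `D` is the computation type of the return clause. -/
inductive InferOps (S : Sig) : Finset (Kind × ℕ) → Env → CTy ℕ → Subst ℕ ℕ → Clauses →
    Subst ℕ ℕ → List OpInfo → Finset (Kind × ℕ) → Prop
  | nil {N : Finset (Kind × ℕ)} {Γ : Env} {D : CTy ℕ} {θ : Subst ℕ ℕ} :
      InferOps S N Γ D θ .nil θ [] N
  | cons {N N₁ N₂ N₃ : Finset (Kind × ℕ)} {Γ : Env} {D D' : CTy ℕ}
      {θ θ' θ'' θn : Subst ℕ ℕ} {M : Comp} {cs : Clauses} {i : OpInfo} {ops : List OpInfo} :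
      S.lookup i.label = some (i.argTy, i.resTy) →
      i.param ∉ Env.dom Γ → i.resume ∉ Env.dom Γ → i.param ≠ i.resume →
      (Kind.lin, i.φ) ∉ N →
      InferC S (insert (Kind.lin, i.φ) N) (Env.subst θ (i.env D ++ Γ)) M D' θ' i.preds i.used
        N₁ →
      Unify N₁ [.comp D' (CTy.subst θ' (CTy.subst θ D))] θ'' N₂ →
      InferOps S N₂ Γ D (θ''.comp (θ'.comp θ)) cs θn ops N₃ →
      InferOps S N Γ D θ (.cons i.label i.param i.resume M cs) θn (i :: ops) N₃

end

/-- A predicate in which rows do not stand on the left of `≼` and value types do not stand on the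
right of it. -/
def Pred.Directed {ν : Type} : Pred ν → Prop
  | .lin τ₁ τ₂ => (∀ R, τ₁ ≠ .row R) ∧ ∀ A, τ₂ ≠ .val A
  | .sub _ _ => True
  | .lack _ _ => True

/-- The constraint set `P` is generated by type inference for some value, computation or handler,
in some context whose qualifiers are directed. -/
def Generated (P : PSet) : Prop :=
  ∃ (S : Sig) (N N' : Finset (Kind × ℕ)) (Γ : Env) (θ : Subst ℕ ℕ) (used : Finset ℕ),
    Sig.fv S ⊆ N ∧ Env.fv Γ ⊆ N ∧ (∀ p ∈ Γ, ∀ π ∈ p.2.quals, π.Directed) ∧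
    ((∃ V A, InferV S N Γ V A θ P used N') ∨
      (∃ M C, InferC S N Γ M C θ P used N') ∨
      (∃ H C D, InferH S N Γ H C D θ P used N'))

end Qeff

namespace Qeff

/-! ## Substitution lemmas -/

section SubstLemmas

variable {ν ν' ν'' : Type}

theorem Lin.subst_id (Y : Lin ν) : Y.subst Subst.id = Y := by cases Y <;> rfl

theorem Lin.subst_comp (t : Subst ν' ν'') (θ : Subst ν ν') (Y : Lin ν) :
    (Y.subst θ).subst t = Y.subst (t.comp θ) := by cases Y <;> rfl

theorem CRow.subst_id (K : CRow ν) : CRow.subst Subst.id K = K := by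
  simp [CRow.subst, Lin.subst_id]

theorem CRow.subst_add (θ : Subst ν ν') (K K' : CRow ν) :
    CRow.subst θ (K + K') = CRow.subst θ K + CRow.subst θ K' := by simp [CRow.subst]

theorem CRow.subst_comp (t : Subst ν' ν'') (θ : Subst ν ν') (K : CRow ν) :
    CRow.subst t (CRow.subst θ K) = CRow.subst (t.comp θ) K := by
  simp [CRow.subst, Lin.subst_comp]

theorem CRow.mem_subst {θ : Subst ν ν'} {K : CRow ν} {e : ℕ × Lin ν'} :
    e ∈ CRow.subst θ K ↔ ∃ e' ∈ K, (e'.1, e'.2.subst θ) = e := by simp [CRow.subst]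

theorem CRow.map_fst_subst (θ : Subst ν ν') (K : CRow ν) :
    (CRow.subst θ K).map Prod.fst = K.map Prod.fst := by
  simp [CRow.subst, Multiset.map_map]

theorem CRow.dom_subst (θ : Subst ν ν') (K : CRow ν) :
    CRow.dom (CRow.subst θ K) = CRow.dom K := by
  simp only [CRow.dom, CRow.map_fst_subst]

theorem CRow.mem_dom {K : CRow ν} {ℓ : ℕ} : ℓ ∈ CRow.dom K ↔ ∃ Y, (ℓ, Y) ∈ K := by
  simp [CRow.dom]

theorem CRow.mem_diff [DecidableEq ν] {K K' : CRow ν} {e : ℕ × Lin ν} :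
    e ∈ CRow.diff K K' ↔ e ∈ K ∧ e ∉ K' := by simp [CRow.diff]

theorem Row.subst_labels (θ : Subst ν ν') (R : Row ν) :
    (R.subst θ).labels =
      CRow.subst θ R.labels + R.tail.elim 0 (fun μ => (θ.row μ).labels) := by
  obtain ⟨K, _ | μ⟩ := R <;> simp [Row.subst]

theorem Row.subst_tail (θ : Subst ν ν') (R : Row ν) :
    (R.subst θ).tail = R.tail.bind (fun μ => (θ.row μ).tail) := by
  obtain ⟨K, _ | μ⟩ := R <;> simp [Row.subst]

theorem Row.mem_subst {θ : Subst ν ν'} {R : Row ν} {e : ℕ × Lin ν'} :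
    e ∈ (R.subst θ).labels ↔
      (∃ e' ∈ R.labels, (e'.1, e'.2.subst θ) = e) ∨
        ∃ μ, R.tail = some μ ∧ e ∈ (θ.row μ).labels := by
  rw [Row.subst_labels, Multiset.mem_add, CRow.mem_subst]
  cases R.tail <;> simp

theorem Row.ext_iff' {R R' : Row ν} : R = R' ↔ R.labels = R'.labels ∧ R.tail = R'.tail := by
  cases R; cases R'; simp

theorem Row.subst_var (θ : Subst ν ν') (μ : ν) : (Row.var μ).subst θ = θ.row μ := by
  simp [Row.ext_iff', Row.subst_labels, Row.subst_tail, Row.var, CRow.subst]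

theorem Row.subst_id (R : Row ν) : R.subst Subst.id = R := by
  rw [Row.ext_iff', Row.subst_labels, Row.subst_tail, CRow.subst_id]
  cases R.tail <;> simp [Subst.id, Subst.ren, Row.var]

theorem Row.subst_comp (t : Subst ν' ν'') (θ : Subst ν ν') (R : Row ν) :
    (R.subst θ).subst t = R.subst (t.comp θ) := by
  obtain ⟨K, _ | μ⟩ := R
  · simp [Row.subst, CRow.subst_comp]
  · simp only [Row.ext_iff', Row.subst_labels, Row.subst_tail, CRow.subst_add, CRow.subst_comp,
      Option.elim_some, Option.bind_some, Subst.comp, add_assoc, and_self]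

theorem Ty.subst_id (A : Ty ν) : A.subst Subst.id = A := by
  induction A with
  | var α => rfl
  | arrow A Y B R hA hB => simp [Ty.subst, hA, hB, Lin.subst_id, Row.subst_id]

theorem Ty.subst_comp (t : Subst ν' ν'') (θ : Subst ν ν') (A : Ty ν) :
    (A.subst θ).subst t = A.subst (t.comp θ) := by
  induction A with
  | var α => rfl
  | arrow A Y B R hA hB => simp [Ty.subst, hA, hB, Lin.subst_comp, Row.subst_comp]

theorem Typ.subst_id (τ : Typ ν) : τ.subst Subst.id = τ := by
  cases τ <;> simp [Typ.subst, Ty.subst_id, Row.subst_id, Lin.subst_id]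

theorem Typ.subst_comp (t : Subst ν' ν'') (θ : Subst ν ν') (τ : Typ ν) :
    (τ.subst θ).subst t = τ.subst (t.comp θ) := by
  cases τ <;> simp [Typ.subst, Ty.subst_comp, Row.subst_comp, Lin.subst_comp]

theorem Pred.subst_id (π : Pred ν) : π.subst Subst.id = π := by
  cases π <;> simp [Pred.subst, Typ.subst_id, Row.subst_id]

theorem Pred.subst_comp (t : Subst ν' ν'') (θ : Subst ν ν') (π : Pred ν) :
    (π.subst θ).subst t = π.subst (t.comp θ) := by
  cases π <;> simp [Pred.subst, Typ.subst_comp, Row.subst_comp]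

theorem Subst.comp_id (θ : Subst ν ν') : θ.comp Subst.id = θ := by
  ext x
  · rfl
  · exact Row.subst_var θ x
  · rfl

theorem Subst.id_comp (θ : Subst ν ν') : Subst.id.comp θ = θ := by
  ext x
  · exact Ty.subst_id _
  · exact Row.subst_id _
  · exact Lin.subst_id _

theorem Subst.comp_assoc {ν₃ : Type} (θ₃ : Subst ν'' ν₃) (θ₂ : Subst ν' ν'') (θ₁ : Subst ν ν') :
    (θ₃.comp θ₂).comp θ₁ = θ₃.comp (θ₂.comp θ₁) := by
  ext x
  · exact (Ty.subst_comp _ _ _).symm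
  · exact (Row.subst_comp _ _ _).symm
  · exact (Lin.subst_comp _ _ _).symm

end SubstLemmas

theorem PSet.subst_id (P : PSet) : PSet.subst Subst.id P = P := by
  rw [PSet.subst, show Pred.subst Subst.id = id from funext Pred.subst_id, Finset.image_id]

theorem PSet.mem_subst {θ : Subst ℕ ℕ} {P : PSet} {π : Pred ℕ} :
    π ∈ PSet.subst θ P ↔ ∃ κ ∈ P, κ.subst θ = π := by simp [PSet.subst]

/-! ## Free variables -/

section FreeVariableLemmas

variable {s t : Subst ℕ ℕ} {N N' : Finset (Kind × ℕ)}

theorem Row.mem_fv {R : Row ℕ} {x : Kind × ℕ} :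
    x ∈ R.fv ↔ (∃ e ∈ R.labels, x ∈ e.2.fv) ∨ ∃ μ, R.tail = some μ ∧ x = (Kind.row, μ) := by
  unfold Row.fv
  cases R.tail <;> simp [or_comm]

theorem Lin.subst_congr (h : s.AgreeOn N t) {Y : Lin ℕ} (hY : Y.fv ⊆ N) :
    Y.subst s = Y.subst t := by
  cases Y with
  | var φ => exact h.2.2 φ (hY (by simp [Lin.fv]))
  | unl => rfl
  | any => rfl

theorem CRow.subst_congr (h : s.AgreeOn N t) {K : CRow ℕ} (hK : ∀ e ∈ K, e.2.fv ⊆ N) :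
    CRow.subst s K = CRow.subst t K :=
  Multiset.map_congr rfl fun e he => by rw [Lin.subst_congr h (hK e he)]

theorem Row.labels_fv_subset {R : Row ℕ} (hR : R.fv ⊆ N) : ∀ e ∈ R.labels, e.2.fv ⊆ N :=
  fun e he _ hx => hR (Row.mem_fv.2 (.inl ⟨e, he, hx⟩))

theorem Row.tail_fv_subset {R : Row ℕ} (hR : R.fv ⊆ N) :
    ∀ μ, R.tail = some μ → (Kind.row, μ) ∈ N :=
  fun μ hμ => hR (Row.mem_fv.2 (.inr ⟨μ, hμ, rfl⟩))

theorem Row.fv_subset_iff {R : Row ℕ} :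
    R.fv ⊆ N ↔ (∀ e ∈ R.labels, e.2.fv ⊆ N) ∧ ∀ μ, R.tail = some μ → (Kind.row, μ) ∈ N := by
  refine ⟨fun h => ⟨labels_fv_subset h, tail_fv_subset h⟩, fun h x hx => ?_⟩
  rcases Row.mem_fv.1 hx with ⟨e, he, hxe⟩ | ⟨μ, hμ, rfl⟩
  · exact h.1 e he hxe
  · exact h.2 μ hμ

theorem Row.subst_congr (h : s.AgreeOn N t) {R : Row ℕ} (hR : R.fv ⊆ N) :
    R.subst s = R.subst t := by
  have h1 := CRow.subst_congr h (Row.labels_fv_subset hR)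
  have h2 := Row.tail_fv_subset hR
  obtain ⟨K, _ | μ⟩ := R
  · simpa [Row.subst] using h1
  · have h3 := h.2.1 μ (h2 μ rfl)
    simp only [Row.subst]
    rw [h3, show CRow.subst s K = CRow.subst t K from h1]

theorem Ty.subst_congr (h : s.AgreeOn N t) {A : Ty ℕ} (hA : A.fv ⊆ N) :
    A.subst s = A.subst t := by
  induction A with
  | var α => exact h.1 α (hA (by simp [Ty.fv]))
  | arrow A Y B R ihA ihB =>
    simp only [Ty.fv, Finset.union_subset_iff] at hA
    simp only [Ty.subst, ihA hA.1.1.1, ihB hA.1.2, Lin.subst_congr h hA.1.1.2,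
      Row.subst_congr h hA.2]

theorem Typ.subst_congr (h : s.AgreeOn N t) {τ : Typ ℕ} (hτ : τ.fv ⊆ N) :
    τ.subst s = τ.subst t := by
  cases τ with
  | val A => exact congrArg _ (Ty.subst_congr h hτ)
  | row R => exact congrArg _ (Row.subst_congr h hτ)
  | lin Y => exact congrArg _ (Lin.subst_congr h hτ)

theorem Pred.subst_congr (h : s.AgreeOn N t) {π : Pred ℕ} (hπ : π.fv ⊆ N) :
    π.subst s = π.subst t := by
  cases π with
  | lin τ₁ τ₂ =>
    simp only [Pred.fv, Finset.union_subset_iff] at hπ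
    simp only [Pred.subst, Typ.subst_congr h hπ.1, Typ.subst_congr h hπ.2]
  | sub R₁ R₂ =>
    simp only [Pred.fv, Finset.union_subset_iff] at hπ
    simp only [Pred.subst, Row.subst_congr h hπ.1, Row.subst_congr h hπ.2]
  | lack R L => simp only [Pred.subst, Row.subst_congr h (show R.fv ⊆ N from hπ)]

theorem PSet.subst_congr (h : s.AgreeOn N t) {P : PSet} (hP : P.fv ⊆ N) :
    PSet.subst s P = PSet.subst t P :=
  Finset.image_congr fun _ hπ =>
    Pred.subst_congr h ((Finset.subset_biUnion_of_mem Pred.fv hπ).trans hP)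

theorem Subst.AgreeOn.refl (s : Subst ℕ ℕ) : s.AgreeOn N s :=
  ⟨fun _ _ => rfl, fun _ _ => rfl, fun _ _ => rfl⟩

theorem Subst.AgreeOn.symm (h : s.AgreeOn N t) : t.AgreeOn N s :=
  ⟨fun x hx => (h.1 x hx).symm, fun x hx => (h.2.1 x hx).symm, fun x hx => (h.2.2 x hx).symm⟩

theorem Subst.AgreeOn.trans {u : Subst ℕ ℕ} (h : s.AgreeOn N t) (h' : t.AgreeOn N u) :
    s.AgreeOn N u :=
  ⟨fun x hx => (h.1 x hx).trans (h'.1 x hx), fun x hx => (h.2.1 x hx).trans (h'.2.1 x hx),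
    fun x hx => (h.2.2 x hx).trans (h'.2.2 x hx)⟩

/-- `θ` sends the variables in `N` to types over the variables in `N'`. -/
def Subst.MapsVars (θ : Subst ℕ ℕ) (N N' : Finset (Kind × ℕ)) : Prop :=
  (∀ α, (Kind.ty, α) ∈ N → (θ.ty α).fv ⊆ N') ∧
  (∀ μ, (Kind.row, μ) ∈ N → (θ.row μ).fv ⊆ N') ∧
  (∀ φ, (Kind.lin, φ) ∈ N → (θ.lin φ).fv ⊆ N')

variable {θ : Subst ℕ ℕ}

theorem Lin.fv_subst (h : θ.MapsVars N N') {Y : Lin ℕ} (hY : Y.fv ⊆ N) :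
    (Y.subst θ).fv ⊆ N' := by
  cases Y with
  | var φ => exact h.2.2 φ (hY (by simp [Lin.fv]))
  | unl => simp [Lin.subst, Lin.fv]
  | any => simp [Lin.subst, Lin.fv]

theorem CRow.fv_subst (h : θ.MapsVars N N') {K : CRow ℕ} (hK : ∀ e ∈ K, e.2.fv ⊆ N) :
    ∀ e ∈ CRow.subst θ K, e.2.fv ⊆ N' := by
  intro e he
  obtain ⟨e', he', rfl⟩ := CRow.mem_subst.1 he
  exact Lin.fv_subst h (hK e' he')

theorem Row.fv_subst (h : θ.MapsVars N N') {R : Row ℕ} (hR : R.fv ⊆ N) :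
    (R.subst θ).fv ⊆ N' := by
  rw [Row.fv_subset_iff] at hR ⊢
  refine ⟨fun e he => ?_, fun μ hμ => ?_⟩
  · rcases Row.mem_subst.1 he with ⟨e', he', rfl⟩ | ⟨μ, hμ, he'⟩
    · exact Lin.fv_subst h (hR.1 e' he')
    · exact Row.labels_fv_subset (h.2.1 μ (hR.2 μ hμ)) e he'
  · rw [Row.subst_tail, Option.bind_eq_some_iff] at hμ
    obtain ⟨μ', h1, h2⟩ := hμ
    exact Row.tail_fv_subset (h.2.1 μ' (hR.2 μ' h1)) μ h2

theorem Ty.fv_subst (h : θ.MapsVars N N') {A : Ty ℕ} (hA : A.fv ⊆ N) :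
    (A.subst θ).fv ⊆ N' := by
  induction A with
  | var α => exact h.1 α (hA (by simp [Ty.fv]))
  | arrow A Y B R ihA ihB =>
    simp only [Ty.fv, Ty.subst, Finset.union_subset_iff] at hA ⊢
    exact ⟨⟨⟨ihA hA.1.1.1, Lin.fv_subst h hA.1.1.2⟩, ihB hA.1.2⟩, Row.fv_subst h hA.2⟩

theorem Typ.fv_subst (h : θ.MapsVars N N') {τ : Typ ℕ} (hτ : τ.fv ⊆ N) :
    (τ.subst θ).fv ⊆ N' := by
  cases τ with
  | val A => exact Ty.fv_subst h hτ
  | row R => exact Row.fv_subst h hτ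
  | lin Y => exact Lin.fv_subst h hτ

theorem Pred.fv_subst (h : θ.MapsVars N N') {π : Pred ℕ} (hπ : π.fv ⊆ N) :
    (π.subst θ).fv ⊆ N' := by
  cases π with
  | lin τ₁ τ₂ =>
    simp only [Pred.fv, Pred.subst, Finset.union_subset_iff] at hπ ⊢
    exact ⟨Typ.fv_subst h hπ.1, Typ.fv_subst h hπ.2⟩
  | sub R₁ R₂ =>
    simp only [Pred.fv, Pred.subst, Finset.union_subset_iff] at hπ ⊢
    exact ⟨Row.fv_subst h hπ.1, Row.fv_subst h hπ.2⟩
  | lack R L => exact Row.fv_subst h hπ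

theorem Subst.MapsVars.comp {N'' : Finset (Kind × ℕ)} {θ' : Subst ℕ ℕ}
    (h' : θ'.MapsVars N' N'') (h : θ.MapsVars N N') : (θ'.comp θ).MapsVars N N'' :=
  ⟨fun x hx => Ty.fv_subst h' (h.1 x hx), fun x hx => Row.fv_subst h' (h.2.1 x hx),
    fun x hx => Lin.fv_subst h' (h.2.2 x hx)⟩

theorem Row.fv_var (μ : ℕ) : (Row.var μ).fv = {(Kind.row, μ)} := by
  simp [Row.fv, Row.var]

theorem Subst.MapsVars.id (h : N ⊆ N') : Subst.id.MapsVars N N' := by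
  refine ⟨fun x hx => ?_, fun x hx => ?_, fun x hx => ?_⟩
  · simpa [Subst.id, Subst.ren, Ty.fv] using h hx
  · simpa [Subst.id, Subst.ren, Row.fv_var] using h hx
  · simpa [Subst.id, Subst.ren, Lin.fv] using h hx

theorem Subst.MapsVars.oneLin {φ : ℕ} {Y : Lin ℕ} (hY : Y.fv ⊆ N) :
    (Subst.oneLin φ Y).MapsVars N N := by
  refine ⟨(MapsVars.id subset_rfl).1, (MapsVars.id subset_rfl).2.1, fun x hx => ?_⟩
  by_cases h : x = φ
  · subst h; simpa [Subst.oneLin] using hY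
  · simpa [Subst.oneLin, h] using (MapsVars.id subset_rfl).2.2 x hx

theorem Subst.MapsVars.oneRow {μ : ℕ} {R : Row ℕ} (h : N ⊆ N') (hR : R.fv ⊆ N') :
    (Subst.oneRow μ R).MapsVars N N' := by
  refine ⟨(MapsVars.id h).1, fun x hx => ?_, (MapsVars.id h).2.2⟩
  by_cases h' : x = μ
  · subst h'; simpa [Subst.oneRow] using hR
  · simpa [Subst.oneRow, h'] using (MapsVars.id h).2.1 x hx

theorem Subst.AgreeOn.comp_right {N₀ : Finset (Kind × ℕ)} (h : s.AgreeOn N t)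
    (hθ : θ.MapsVars N₀ N) : (s.comp θ).AgreeOn N₀ (t.comp θ) :=
  ⟨fun x hx => Ty.subst_congr h (hθ.1 x hx), fun x hx => Row.subst_congr h (hθ.2.1 x hx),
    fun x hx => Lin.subst_congr h (hθ.2.2 x hx)⟩

end FreeVariableLemmas

/-! ## Well-formedness -/

section WellFormedLemmas

variable {t : Subst ℕ ℕ}

theorem CRow.nodup_map_fst_of_le {K K' : CRow ℕ} (h : K ≤ K') (h' : (K'.map Prod.fst).Nodup) :
    (K.map Prod.fst).Nodup := Multiset.nodup_of_le (Multiset.map_le_map h) h'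

theorem CRow.eq_of_fst_eq {K : CRow ℕ} (h : (K.map Prod.fst).Nodup) {ℓ : ℕ} {Y Y' : Lin ℕ}
    (hY : (ℓ, Y) ∈ K) (hY' : (ℓ, Y') ∈ K) : Y = Y' :=
  congrArg Prod.snd (Multiset.inj_on_of_nodup_map h _ hY _ hY' rfl)

theorem CRow.not_mem_of_nodup_add {K K' : CRow ℕ} (h : ((K + K').map Prod.fst).Nodup) {ℓ : ℕ}
    {Y Y' : Lin ℕ} (hY : (ℓ, Y) ∈ K) : (ℓ, Y') ∉ K' := by
  intro hY'
  rw [Multiset.map_add, Multiset.nodup_add] at h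
  exact Multiset.disjoint_left.1 h.2.2 (Multiset.mem_map_of_mem Prod.fst hY)
    (show ℓ ∈ _ from Multiset.mem_map_of_mem Prod.fst hY')

theorem CRow.subst_nodup_iff {K : CRow ℕ} :
    ((CRow.subst t K).map Prod.fst).Nodup ↔ (K.map Prod.fst).Nodup := by
  rw [CRow.map_fst_subst]

theorem Row.WF.of_subst {R : Row ℕ} (h : (R.subst t).WF) : R.WF := by
  unfold Row.WF at *
  rw [Row.subst_labels] at h
  exact CRow.subst_nodup_iff.1 (CRow.nodup_map_fst_of_le (Multiset.le_add_right _ _) h)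

theorem Row.WF.row_of_subst {R : Row ℕ} (h : (R.subst t).WF) {μ : ℕ} (hμ : R.tail = some μ) :
    (t.row μ).WF := by
  unfold Row.WF at *
  rw [Row.subst_labels, hμ] at h
  exact CRow.nodup_map_fst_of_le (Multiset.le_add_left _ _) h

theorem Ty.WF.of_subst {A : Ty ℕ} (h : (A.subst t).WF) : A.WF := by
  induction A with
  | var α => trivial
  | arrow A Y B R ihA ihB => exact ⟨ihA h.1, ihB h.2.1, Row.WF.of_subst h.2.2⟩

theorem Typ.WF.of_subst {τ : Typ ℕ} (h : (τ.subst t).WF) : τ.WF := by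
  cases τ with
  | val A => exact Ty.WF.of_subst h
  | row R => exact Row.WF.of_subst h
  | lin Y => trivial

theorem Pred.WF.of_subst {π : Pred ℕ} (h : (π.subst t).WF) : π.WF := by
  cases π with
  | lin τ₁ τ₂ => exact ⟨Typ.WF.of_subst h.1, Typ.WF.of_subst h.2⟩
  | sub R₁ R₂ => exact ⟨Row.WF.of_subst h.1, Row.WF.of_subst h.2⟩
  | lack R L => exact Row.WF.of_subst (R := R) h

theorem Lin.row_not_mem_fv {Y : Lin ℕ} {μ : ℕ} : (Kind.row, μ) ∉ Y.fv := by
  cases Y <;> simp [Lin.fv]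

theorem Lin.ty_not_mem_fv {Y : Lin ℕ} {α : ℕ} : (Kind.ty, α) ∉ Y.fv := by
  cases Y <;> simp [Lin.fv]

theorem Row.ty_not_mem_fv {R : Row ℕ} {α : ℕ} : (Kind.ty, α) ∉ R.fv := by
  intro h
  rcases Row.mem_fv.1 h with ⟨e, _, h⟩ | ⟨μ, _, h⟩
  · exact Lin.ty_not_mem_fv h
  · simp at h

theorem Row.tail_eq_of_mem_fv {R : Row ℕ} {μ : ℕ} (h : (Kind.row, μ) ∈ R.fv) :
    R.tail = some μ := by
  rcases Row.mem_fv.1 h with ⟨e, _, h⟩ | ⟨μ', h, h'⟩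
  · exact absurd h Lin.row_not_mem_fv
  · cases h'; exact h

theorem Ty.WF.row_of_subst {A : Ty ℕ} (h : (A.subst t).WF) {μ : ℕ}
    (hμ : (Kind.row, μ) ∈ A.fv) : (t.row μ).WF := by
  induction A with
  | var α => simp [Ty.fv] at hμ
  | arrow A Y B R ihA ihB =>
    simp only [Ty.fv, Finset.mem_union] at hμ
    rcases hμ with ((hμ | hμ) | hμ) | hμ
    · exact ihA h.1 hμ
    · exact absurd hμ Lin.row_not_mem_fv
    · exact ihB h.2.1 hμ
    · exact Row.WF.row_of_subst h.2.2 (Row.tail_eq_of_mem_fv hμ)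

theorem Typ.WF.row_of_subst {τ : Typ ℕ} (h : (τ.subst t).WF) {μ : ℕ}
    (hμ : (Kind.row, μ) ∈ τ.fv) : (t.row μ).WF := by
  cases τ with
  | val A => exact Ty.WF.row_of_subst h hμ
  | row R => exact Row.WF.row_of_subst h (Row.tail_eq_of_mem_fv hμ)
  | lin Y => exact absurd hμ Lin.row_not_mem_fv

theorem Pred.WF.row_of_subst {π : Pred ℕ} (h : (π.subst t).WF) {μ : ℕ}
    (hμ : (Kind.row, μ) ∈ π.fv) : (t.row μ).WF := by
  cases π with
  | lin τ₁ τ₂ =>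
    rcases Finset.mem_union.1 hμ with hμ | hμ
    · exact Typ.WF.row_of_subst h.1 hμ
    · exact Typ.WF.row_of_subst h.2 hμ
  | sub R₁ R₂ =>
    rcases Finset.mem_union.1 hμ with hμ | hμ
    · exact Row.WF.row_of_subst h.1 (Row.tail_eq_of_mem_fv hμ)
    · exact Row.WF.row_of_subst h.2 (Row.tail_eq_of_mem_fv hμ)
  | lack R L =>
    exact Row.WF.row_of_subst (R := R) h (Row.tail_eq_of_mem_fv hμ)

theorem PSet.WF.of_subst {P : PSet} {θ : Subst ℕ ℕ} (h : (PSet.subst (t.comp θ) P).WF) :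
    (PSet.subst θ P).WF := by
  intro π hπ
  obtain ⟨κ, hκ, rfl⟩ := PSet.mem_subst.1 hπ
  refine Pred.WF.of_subst (t := t) ?_
  rw [Pred.subst_comp]
  exact h _ (PSet.mem_subst.2 ⟨κ, hκ, rfl⟩)

theorem Ty.WF.ty_of_subst {A : Ty ℕ} (h : (A.subst t).WF) {α : ℕ}
    (hα : (Kind.ty, α) ∈ A.fv) : (t.ty α).WF := by
  induction A with
  | var β =>
    simp only [Ty.fv, Finset.mem_singleton, Prod.mk.injEq, true_and] at hα
    subst hα
    exact h
  | arrow A Y B R ihA ihB =>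
    simp only [Ty.fv, Finset.mem_union] at hα
    rcases hα with ((hα | hα) | hα) | hα
    · exact ihA h.1 hα
    · exact absurd hα Lin.ty_not_mem_fv
    · exact ihB h.2.1 hα
    · exact absurd hα Row.ty_not_mem_fv

theorem Typ.WF.ty_of_subst {τ : Typ ℕ} (h : (τ.subst t).WF) {α : ℕ}
    (hα : (Kind.ty, α) ∈ τ.fv) : (t.ty α).WF := by
  cases τ with
  | val A => exact Ty.WF.ty_of_subst h hα
  | row R => exact absurd hα Row.ty_not_mem_fv
  | lin Y => exact absurd hα Lin.ty_not_mem_fv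

theorem PSet.WF.ty_of_subst {P : PSet} {θ : Subst ℕ ℕ} (h : (PSet.subst θ P).WF) {α : ℕ}
    (hα : (Kind.ty, α) ∈ P.fv) : (θ.ty α).WF := by
  obtain ⟨π, hπ, hα⟩ := Finset.mem_biUnion.1 hα
  have hwf := h _ (PSet.mem_subst.2 ⟨π, hπ, rfl⟩)
  cases π with
  | lin τ₁ τ₂ =>
    exact (Finset.mem_union.1 hα).elim (Typ.WF.ty_of_subst hwf.1) (Typ.WF.ty_of_subst hwf.2)
  | sub R₁ R₂ =>
    exact (Finset.mem_union.1 hα).elim (fun h => absurd h Row.ty_not_mem_fv)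
      (fun h => absurd h Row.ty_not_mem_fv)
  | lack R L => exact absurd hα (Row.ty_not_mem_fv (R := R))

theorem PSet.WF.row_of_subst {P : PSet} {θ : Subst ℕ ℕ} (h : (PSet.subst θ P).WF) {μ : ℕ}
    (hμ : (Kind.row, μ) ∈ P.fv) : (θ.row μ).WF := by
  obtain ⟨π, hπ, hμ⟩ := Finset.mem_biUnion.1 hμ
  exact Pred.WF.row_of_subst (h _ (PSet.mem_subst.2 ⟨π, hπ, rfl⟩)) hμ

theorem Row.WF.subst_closed (ht : ∀ μ, t.row μ = ⟨0, none⟩) {R : Row ℕ} (h : R.WF) :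
    (R.subst t).WF := by
  unfold Row.WF at *
  rw [Row.subst_labels]
  cases R.tail <;> simpa [ht, CRow.map_fst_subst] using h

theorem Ty.WF.subst_closed (ht : ∀ μ, t.row μ = ⟨0, none⟩) (ht' : ∀ α, (t.ty α).WF) {A : Ty ℕ}
    (h : A.WF) : (A.subst t).WF := by
  induction A with
  | var α => exact ht' α
  | arrow A Y B R ihA ihB => exact ⟨ihA h.1, ihB h.2.1, Row.WF.subst_closed ht h.2.2⟩

theorem Typ.WF.subst_closed (ht : ∀ μ, t.row μ = ⟨0, none⟩) (ht' : ∀ α, (t.ty α).WF)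
    {τ : Typ ℕ} (h : τ.WF) : (τ.subst t).WF := by
  cases τ with
  | val A => exact Ty.WF.subst_closed ht ht' h
  | row R => exact Row.WF.subst_closed ht h
  | lin Y => trivial

theorem Pred.WF.subst_closed (ht : ∀ μ, t.row μ = ⟨0, none⟩) (ht' : ∀ α, (t.ty α).WF)
    {π : Pred ℕ} (h : π.WF) : (π.subst t).WF := by
  cases π with
  | lin τ₁ τ₂ => exact ⟨Typ.WF.subst_closed ht ht' h.1, Typ.WF.subst_closed ht ht' h.2⟩
  | sub R₁ R₂ => exact ⟨Row.WF.subst_closed ht h.1, Row.WF.subst_closed ht h.2⟩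
  | lack R L => exact Row.WF.subst_closed (R := R) ht h

end WellFormedLemmas

/-! ## Directed predicates -/

section DirectedLemmas

theorem Pred.Directed.subst {ν ν' : Type} {π : Pred ν} (h : π.Directed) (θ : Subst ν ν') :
    (π.subst θ).Directed := by
  cases π with
  | lin τ₁ τ₂ =>
    refine ⟨fun R hR => ?_, fun A hA => ?_⟩
    · cases τ₁ with
      | row R' => exact h.1 R' rfl
      | val A => simp [Typ.subst] at hR
      | lin Y => simp [Typ.subst] at hR
    · cases τ₂ with
      | val A' => exact h.2 A' rfl
      | row R => simp [Typ.subst] at hA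
      | lin Y => simp [Typ.subst] at hA
  | sub R₁ R₂ => trivial
  | lack R L => trivial

theorem directed_of_mem_factAtom {τ τ' : Typ ℕ} (h : (Pred.lin τ τ').Directed) :
    ∀ π ∈ factAtom τ τ', π.Directed := by
  unfold factAtom
  split_ifs <;> simp [h]

theorem directed_of_mem_factRight {τ τ' : Typ ℕ} (h : (Pred.lin τ τ').Directed) :
    ∀ π ∈ factRight τ τ', π.Directed := by
  unfold factRight
  split_ifs
  · simp
  · cases τ' with
    | row R =>
      intro π hπ
      rcases Finset.mem_union.1 hπ with hπ | hπ
      · obtain ⟨e, _, hπ⟩ := Finset.mem_biUnion.1 hπ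
        exact directed_of_mem_factAtom ⟨h.1, by simp⟩ π hπ
      · cases hR : R.tail <;> rw [hR] at hπ
        · simp at hπ
        · exact directed_of_mem_factAtom ⟨h.1, by simp⟩ π hπ
    | val A => exact directed_of_mem_factAtom h
    | lin Y => exact directed_of_mem_factAtom h

theorem directed_of_mem_factLin {τ τ' : Typ ℕ} (h : (Pred.lin τ τ').Directed) :
    ∀ π ∈ factLin τ τ', π.Directed := by
  unfold factLin
  split_ifs
  · simp
  · cases τ with
    | val A =>
      cases A with
      | var α => exact directed_of_mem_factRight h
      | arrow A Y B R => exact directed_of_mem_factRight ⟨by simp, h.2⟩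
    | row R => exact directed_of_mem_factRight h
    | lin Y => exact directed_of_mem_factRight h

theorem directed_of_mem_factorise {π : Pred ℕ} (h : π.Directed) :
    ∀ κ ∈ factorise π, κ.Directed := by
  cases π with
  | lin τ τ' => exact directed_of_mem_factLin h
  | sub R₁ R₂ => simp only [factorise]; split_ifs <;> simp [Pred.Directed]
  | lack R L => simp only [factorise]; split_ifs <;> simp [Pred.Directed]

/-- All predicates of the set are directed. -/
def PSet.Directed (P : PSet) : Prop := ∀ π ∈ P, π.Directed

/-- All qualifiers of the schemes in the context are directed. -/
def Env.Directed (Γ : Env) : Prop := ∀ p ∈ Γ, ∀ π ∈ p.2.quals, π.Directed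

theorem PSet.Directed.union {P Q : PSet} (hP : P.Directed) (hQ : Q.Directed) :
    PSet.Directed (P ∪ Q) := fun π hπ => (Finset.mem_union.1 hπ).elim (hP π) (hQ π)

theorem PSet.Directed.subst {P : PSet} (hP : P.Directed) (θ : Subst ℕ ℕ) :
    (PSet.subst θ P).Directed := by
  intro π hπ
  obtain ⟨κ, hκ, rfl⟩ := PSet.mem_subst.1 hπ
  exact (hP κ hκ).subst θ

theorem PSet.Directed.factoriseSet {P : PSet} (hP : P.Directed) :
    (factoriseSet P).Directed := by
  intro π hπ
  obtain ⟨κ, hκ, hπ⟩ := Finset.mem_biUnion.1 hπ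
  exact directed_of_mem_factorise (hP κ hκ) π hπ

theorem PSet.Directed.empty : PSet.Directed ∅ := by simp [PSet.Directed]

theorem PSet.Directed.factorise_sub (R₁ R₂ : Row ℕ) : (factorise (.sub R₁ R₂)).Directed :=
  directed_of_mem_factorise trivial

theorem PSet.Directed.factorise_lack (R : Row ℕ) (L : Finset ℕ) :
    (factorise (.lack R L)).Directed := directed_of_mem_factorise trivial

theorem Env.Directed.subst {Γ : Env} (h : Γ.Directed) (θ : Subst ℕ ℕ) :
    (Env.subst θ Γ).Directed := by
  intro p hp π hπ
  obtain ⟨q, hq, rfl⟩ := List.mem_map.1 hp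
  obtain ⟨κ, hκ, rfl⟩ := Finset.mem_image.1 hπ
  exact (h q hq κ hκ).subst _

theorem Env.Directed.filter {Γ : Env} (h : Γ.Directed) (f : ℕ × Scheme → Bool) :
    Env.Directed (List.filter f Γ) := fun p hp => h p (List.mem_filter.1 hp).1

theorem Env.Directed.restrict {Γ : Env} (h : Γ.Directed) (S : Finset ℕ) :
    (Env.restrict Γ S).Directed := h.filter _

theorem Env.Directed.unused {Γ : Env} (h : Γ.Directed) (S : Finset ℕ) :
    (Env.unused Γ S).Directed := h.filter _

theorem Env.Directed.cons {Γ : Env} (h : Γ.Directed) {x : ℕ} {σ : Scheme}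
    (hσ : ∀ π ∈ σ.quals, π.Directed) : Env.Directed ((x, σ) :: Γ) := by
  intro p hp
  rcases List.mem_cons.1 hp with rfl | hp
  · exact hσ
  · exact h p hp

theorem Env.Directed.nil : Env.Directed [] := by simp [Env.Directed]

theorem Env.Directed.cons_mono {Γ : Env} (h : Γ.Directed) (x : ℕ) (A : Ty ℕ) :
    Env.Directed ((x, Scheme.mono A) :: Γ) := h.cons (by simp [Scheme.mono])

theorem Env.Directed.append {Γ Γ' : Env} (h : Γ.Directed) (h' : Γ'.Directed) :
    Env.Directed (Γ ++ Γ') := fun p hp => (List.mem_append.1 hp).elim (h p) (h' p)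

theorem OpInfo.env_directed (i : OpInfo) (D : CTy ℕ) : (i.env D).Directed :=
  (Env.Directed.nil.cons_mono _ _).cons_mono _ _

theorem instQuals_directed {σ : Scheme} (h : ∀ π ∈ σ.quals, π.Directed) (f : Kind → ℕ → ℕ) :
    (σ.instQuals f).Directed := by
  intro π hπ
  obtain ⟨κ, hκ, rfl⟩ := Finset.mem_image.1 hπ
  exact (h κ hκ).subst _

theorem gen_directed {P : PSet} (h : P.Directed) (Γ : Env) (A : Ty ℕ) :
    ∀ π ∈ (gen Γ P A).quals, π.Directed := by
  intro π hπ
  obtain ⟨κ, hκ, rfl⟩ := Finset.mem_image.1 hπ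
  exact (h κ hκ).subst _

theorem MakeLeq.directed {N N' : Finset (Kind × ℕ)} {Γ : Env} {τ : Typ ℕ} {Q : PSet}
    (h : MakeLeq N Γ τ Q N') (hτ : ∀ A, τ ≠ .val A) (hΓ : Γ.Directed) : Q.Directed := by
  induction h with
  | nil => exact PSet.Directed.empty
  | cons _ _ ih =>
    refine ((instQuals_directed (hΓ _ List.mem_cons_self) _).factoriseSet.union ?_).union
      (ih hτ fun p hp => hΓ p (List.mem_cons_of_mem _ hp))
    exact directed_of_mem_factorise ⟨by simp, hτ⟩

theorem MakeUnl.directed {N N' : Finset (Kind × ℕ)} {Γ : Env} {Q : PSet}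
    (h : MakeUnl N Γ Q N') (hΓ : Γ.Directed) : Q.Directed :=
  MakeLeq.directed h (by simp) hΓ

theorem Env.mem_of_lookup {Γ : Env} {x : ℕ} {σ : Scheme} (h : Γ.lookup x = some σ) :
    (x, σ) ∈ Γ := by
  induction Γ with
  | nil => simp at h
  | cons p Γ ih =>
    obtain ⟨y, σ'⟩ := p
    rw [List.lookup_cons] at h
    by_cases hxy : x = y
    · subst hxy; simp at h; simp [h]
    · have : (x == y) = false := by simpa using hxy
      rw [this] at h
      exact List.mem_cons_of_mem _ (ih h)

theorem foldr_preds_directed {ops : List OpInfo} (h : ∀ i ∈ ops, i.preds.Directed)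
    (θ : Subst ℕ ℕ) :
    PSet.Directed (ops.foldr (fun i T => PSet.subst θ i.preds ∪ T) ∅) := by
  induction ops with
  | nil => exact PSet.Directed.empty
  | cons i ops ih =>
    exact ((h i List.mem_cons_self).subst _).union
      (ih fun j hj => h j (List.mem_cons_of_mem _ hj))

mutual

theorem InferV.directed {S : Sig} {N N' : Finset (Kind × ℕ)} {Γ : Env} {V : Val} {A : Ty ℕ}
    {θ : Subst ℕ ℕ} {P : PSet} {used : Finset ℕ} (h : InferV S N Γ V A θ P used N')
    (hΓ : Γ.Directed) : P.Directed := by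
  cases h with
  | var hx _ => exact instQuals_directed (hΓ _ (Env.mem_of_lookup hx)) _
  | lam _ _ _ hM hQ₁ hQ₂ =>
    exact (InferC.directed hM (hΓ.cons_mono _ _)).union
      ((hQ₁.directed (by simp) ((hΓ.subst _).restrict _)).union
        (hQ₂.directed (((Env.Directed.nil.cons_mono _ _).subst _).unused _)))

theorem InferC.directed {S : Sig} {N N' : Finset (Kind × ℕ)} {Γ : Env} {M : Comp} {C : CTy ℕ}
    {θ : Subst ℕ ℕ} {P : PSet} {used : Finset ℕ} (h : InferC S N Γ M C θ P used N')
    (hΓ : Γ.Directed) : P.Directed := by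
  cases h with
  | app hV hW _ _ _ _ hQ =>
    exact ((((InferV.directed hV hΓ).subst _).union
      (InferV.directed hW (hΓ.subst _))).subst _).union
        (hQ.directed ((((hΓ.subst _).subst _).subst _).restrict _))
  | ret hV _ => exact InferV.directed hV hΓ
  | perform _ hV _ _ _ =>
    exact ((InferV.directed hV hΓ).subst _).union (PSet.Directed.factorise_sub _ _)
  | letval _ hV hσ hM hQ₁ hQ₂ =>
    have h₁ := gen_directed (InferV.directed hV hΓ)
    subst hσ
    exact (InferC.directed hM ((hΓ.subst _).cons (h₁ _ _))).union
      ((hQ₁.directed (((hΓ.subst _).subst _).restrict _)).union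
        (hQ₂.directed (((Env.Directed.nil.cons (h₁ _ _)).subst _).unused _)))
  | seq _ hL hM _ hQ₁ hQ₂ hQ₃ =>
    exact (((InferC.directed hL hΓ).subst _).union
      (InferC.directed hM ((hΓ.subst _).cons_mono _ _))).union
        (((((hQ₁.directed (((hΓ.subst _).subst _).restrict _)).union
          (hQ₂.directed (((Env.Directed.nil.cons_mono _ _).subst _).unused _))).union
          (hQ₃.directed (by simp) (((hΓ.subst _).subst _).restrict _))).union
          (PSet.Directed.factorise_sub _ _)).union (PSet.Directed.factorise_sub _ _))
  | handle hH hM _ hQ =>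
    exact ((((InferH.directed hH hΓ).subst _).union
      (InferC.directed hM (hΓ.subst _))).subst _).union
        ((PSet.Directed.factorise_sub _ _).union
          (hQ.directed ((((hΓ.subst _).subst _).subst _).restrict _)))

theorem InferH.directed {S : Sig} {N N' : Finset (Kind × ℕ)} {Γ : Env} {H : Handler}
    {C D : CTy ℕ} {θ : Subst ℕ ℕ} {P : PSet} {used : Finset ℕ}
    (h : InferH S N Γ H C D θ P used N') (hΓ : Γ.Directed) : P.Directed := by
  cases h with
  | mk _ _ _ hM hops _ _ hQ₁ hQ₂ hQ₃ =>
    refine ((((((InferC.directed hM (hΓ.cons_mono _ _)).subst _).union ?_).union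
      (hQ₁.directed ((hΓ.subst _).restrict _))).union (PSet.Directed.factorise_sub _ _)).union
      (PSet.Directed.factorise_lack _ _)).union
        ((hQ₂.directed (((Env.Directed.nil.cons_mono _ _).subst _).unused _)).union
          (hQ₃.directed ?_))
    · exact foldr_preds_directed (InferOps.directed hops hΓ) _
    · intro p hp
      obtain ⟨i, _, hi⟩ := List.mem_flatMap.1 hp
      exact (((OpInfo.env_directed i _).subst _).unused _) p hi

theorem InferOps.directed {S : Sig} : ∀ {N N' : Finset (Kind × ℕ)} {Γ : Env} {D : CTy ℕ}
    {θ θ' : Subst ℕ ℕ} {cs : Clauses} {ops : List OpInfo},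
    InferOps S N Γ D θ cs θ' ops N' → Γ.Directed → ∀ i ∈ ops, i.preds.Directed
  | _, _, _, _, _, _, _, _, .nil, _ => by simp
  | _, _, _, _, _, _, _, _, .cons _ _ _ _ _ hM _ hops, hΓ => fun j hj =>
    (List.mem_cons.1 hj).elim
      (fun h => h ▸ InferC.directed hM (((OpInfo.env_directed _ _).append hΓ).subst _))
      (fun h => InferOps.directed hops hΓ j h)

end

theorem Generated.directed {P : PSet} (h : Generated P) : P.Directed := by
  obtain ⟨S, N, N', Γ, θ, used, _, _, hΓ, ⟨V, A, h⟩ | ⟨M, C, h⟩ | ⟨H, C, D, h⟩⟩ := h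
  · exact h.directed hΓ
  · exact h.directed hΓ
  · exact h.directed hΓ

end DirectedLemmas

/-! ## Unification of linearity types and shared labels -/

section Unification

/-- The substitution changes linearity variables only. -/
def Subst.LinOnly (θ : Subst ℕ ℕ) : Prop := (∀ α, θ.ty α = .var α) ∧ ∀ μ, θ.row μ = Row.var μ

theorem Subst.LinOnly.id : Subst.LinOnly Subst.id := ⟨fun _ => rfl, fun _ => rfl⟩

theorem Subst.LinOnly.oneLin (φ : ℕ) (Y : Lin ℕ) : (Subst.oneLin φ Y).LinOnly :=
  ⟨fun _ => rfl, fun _ => rfl⟩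

theorem Subst.LinOnly.comp {θ θ' : Subst ℕ ℕ} (h' : θ'.LinOnly) (h : θ.LinOnly) :
    (θ'.comp θ).LinOnly :=
  ⟨fun α => by simp [Subst.comp, h.1, Ty.subst, h'.1],
    fun μ => by simp [Subst.comp, h.2, Row.subst_var, h'.2]⟩

theorem Subst.comp_oneLin {t : Subst ℕ ℕ} {φ : ℕ} {Y : Lin ℕ} (h : t.lin φ = Y.subst t) :
    t.comp (Subst.oneLin φ Y) = t := by
  ext x
  · rfl
  · exact Row.subst_var t x
  · by_cases hx : x = φ
    · subst hx; simp [Subst.comp, Subst.oneLin, h]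
    · simp [Subst.comp, Subst.oneLin, hx, Subst.id, Subst.ren, Lin.subst]

theorem Lin.subst_oneLin_self (φ : ℕ) (Y : Lin ℕ) :
    Y.subst (Subst.oneLin φ Y) = Y := by
  cases Y with
  | var ψ =>
    by_cases h : ψ = φ
    · subst h; simp [Lin.subst, Subst.oneLin]
    · simp [Lin.subst, Subst.oneLin, h, Subst.id, Subst.ren]
  | unl => rfl
  | any => rfl

theorem ulin_cases {Y₁ Y₂ : Lin ℕ} {θ : Subst ℕ ℕ} (h : ulin Y₁ Y₂ = some θ) :
    (Y₁ = Y₂ ∧ θ = Subst.id) ∨ (∃ φ, Y₁ = .var φ ∧ θ = Subst.oneLin φ Y₂) ∨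
      ∃ φ, Y₂ = .var φ ∧ θ = Subst.oneLin φ Y₁ := by
  cases Y₁ <;> cases Y₂ <;> simp [ulin] at h ⊢
  all_goals first
    | exact h.symm
    | (split_ifs at h with hφ
       · simp at h; exact .inl ⟨hφ.symm, h.symm⟩
       · simp at h; exact .inr (.inl h.symm))

theorem ulin_unifies {Y₁ Y₂ : Lin ℕ} {θ : Subst ℕ ℕ} (h : ulin Y₁ Y₂ = some θ) :
    Y₁.subst θ = Y₂.subst θ := by
  rcases ulin_cases h with ⟨rfl, rfl⟩ | ⟨φ, rfl, rfl⟩ | ⟨φ, rfl, rfl⟩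
  · rfl
  · rw [Lin.subst_oneLin_self]; simp [Lin.subst, Subst.oneLin]
  · rw [Lin.subst_oneLin_self]; simp [Lin.subst, Subst.oneLin]

theorem ulin_linOnly {Y₁ Y₂ : Lin ℕ} {θ : Subst ℕ ℕ} (h : ulin Y₁ Y₂ = some θ) :
    θ.LinOnly := by
  rcases ulin_cases h with ⟨rfl, rfl⟩ | ⟨φ, rfl, rfl⟩ | ⟨φ, rfl, rfl⟩
  · exact .id
  · exact .oneLin _ _
  · exact .oneLin _ _

theorem ulin_mapsVars {Y₁ Y₂ : Lin ℕ} {θ : Subst ℕ ℕ} {N : Finset (Kind × ℕ)}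
    (h : ulin Y₁ Y₂ = some θ) (h₁ : Y₁.fv ⊆ N) (h₂ : Y₂.fv ⊆ N) : θ.MapsVars N N := by
  rcases ulin_cases h with ⟨rfl, rfl⟩ | ⟨φ, rfl, rfl⟩ | ⟨φ, rfl, rfl⟩
  · exact .id subset_rfl
  · exact .oneLin h₂
  · exact .oneLin h₁

theorem ulin_complete {Y₁ Y₂ : Lin ℕ} {t : Subst ℕ ℕ} (h : Y₁.subst t = Y₂.subst t) :
    ∃ θ, ulin Y₁ Y₂ = some θ ∧ t.comp θ = t := by
  have key : ∃ θ, ulin Y₁ Y₂ = some θ := by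
    cases Y₁ <;> cases Y₂ <;> simp [ulin] <;> first | (split_ifs <;> simp) | cases h
  obtain ⟨θ, hθ⟩ := key
  refine ⟨θ, hθ, ?_⟩
  rcases ulin_cases hθ with ⟨rfl, rfl⟩ | ⟨φ, rfl, rfl⟩ | ⟨φ, rfl, rfl⟩
  · exact Subst.comp_id t
  · exact Subst.comp_oneLin h
  · exact Subst.comp_oneLin h.symm

theorem ULab.linOnly {K₁ K₂ : CRow ℕ} {r : Option (Subst ℕ ℕ)} (h : ULab K₁ K₂ r) :
    ∀ θ, r = some θ → θ.LinOnly := by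
  induction h with
  | nil_left | nil_right => rintro _ ⟨⟩; exact .id
  | shared hu _ ih =>
    intro θ hθ
    obtain ⟨θ', hθ', rfl⟩ := Option.map_eq_some_iff.1 hθ
    exact (ih θ' hθ').comp (ulin_linOnly hu)
  | clash => rintro _ ⟨⟩
  | skip_left _ _ ih => exact ih
  | skip_right _ _ ih => exact ih

theorem ULab.mapsVars {N : Finset (Kind × ℕ)} {K₁ K₂ : CRow ℕ} {r : Option (Subst ℕ ℕ)}
    (h : ULab K₁ K₂ r) :
    (∀ e ∈ K₁, e.2.fv ⊆ N) → (∀ e ∈ K₂, e.2.fv ⊆ N) → ∀ θ, r = some θ → θ.MapsVars N N := by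
  induction h with
  | nil_left | nil_right => rintro _ _ _ ⟨⟩; exact .id subset_rfl
  | shared hu _ ih =>
    intro h₁ h₂ θ hθ
    obtain ⟨θ', hθ', rfl⟩ := Option.map_eq_some_iff.1 hθ
    have hm := ulin_mapsVars hu (h₁ _ (Multiset.mem_cons_self _ _))
      (h₂ _ (Multiset.mem_cons_self _ _))
    exact (ih (CRow.fv_subst hm fun e he => h₁ e (Multiset.mem_cons_of_mem he))
      (CRow.fv_subst hm fun e he => h₂ e (Multiset.mem_cons_of_mem he)) θ' hθ').comp hm
  | clash => rintro _ _ _ ⟨⟩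
  | skip_left _ _ ih => exact fun h₁ => ih fun e he => h₁ e (Multiset.mem_cons_of_mem he)
  | skip_right _ _ ih =>
    exact fun h₁ h₂ => ih h₁ fun e he => h₂ e (Multiset.mem_cons_of_mem he)

theorem ULab.complete {K₁ K₂ : CRow ℕ} {r : Option (Subst ℕ ℕ)} (h : ULab K₁ K₂ r)
    {t : Subst ℕ ℕ} :
    (∀ ℓ Y₁ Y₂, (ℓ, Y₁) ∈ K₁ → (ℓ, Y₂) ∈ K₂ → Y₁.subst t = Y₂.subst t) →
    ∃ θ, r = some θ ∧ t.comp θ = t := by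
  induction h with
  | nil_left | nil_right => exact fun _ => ⟨_, rfl, Subst.comp_id t⟩
  | @shared ℓ Y₁ Y₂ K₁ K₂ θ r hu _ ih =>
    intro H
    have hθ : t.comp θ = t := by
      obtain ⟨θ', hu', h'⟩ := ulin_complete
        (H ℓ Y₁ Y₂ (Multiset.mem_cons_self _ _) (Multiset.mem_cons_self _ _))
      rw [hu] at hu'; cases hu'; exact h'
    obtain ⟨θ', rfl, hθ'⟩ := ih (by
      intro ℓ' Z₁ Z₂ hZ₁ hZ₂
      obtain ⟨⟨_, Z₁⟩, h₁, e₁⟩ := CRow.mem_subst.1 hZ₁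
      obtain ⟨⟨_, Z₂⟩, h₂, e₂⟩ := CRow.mem_subst.1 hZ₂
      cases e₁; cases e₂
      rw [Lin.subst_comp, Lin.subst_comp, hθ]
      exact H _ _ _ (Multiset.mem_cons_of_mem h₁) (Multiset.mem_cons_of_mem h₂))
    exact ⟨_, rfl, by rw [← Subst.comp_assoc, hθ', hθ]⟩
  | clash hu =>
    intro H
    obtain ⟨θ', hu', _⟩ := ulin_complete
      (H _ _ _ (Multiset.mem_cons_self _ _) (Multiset.mem_cons_self _ _))
    rw [hu] at hu'; cases hu'
  | skip_left _ _ ih =>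
    exact fun H => ih fun ℓ Y₁ Y₂ h₁ h₂ => H ℓ Y₁ Y₂ (Multiset.mem_cons_of_mem h₁) h₂
  | skip_right _ _ ih =>
    exact fun H => ih fun ℓ Y₁ Y₂ h₁ h₂ => H ℓ Y₁ Y₂ h₁ (Multiset.mem_cons_of_mem h₂)

theorem ULab.unifies {K₁ K₂ : CRow ℕ} {r : Option (Subst ℕ ℕ)} (h : ULab K₁ K₂ r) :
    (K₁.map Prod.fst).Nodup → (K₂.map Prod.fst).Nodup → ∀ θ, r = some θ →
    ∀ ℓ Y₁ Y₂, (ℓ, Y₁) ∈ K₁ → (ℓ, Y₂) ∈ K₂ → Y₁.subst θ = Y₂.subst θ := by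
  induction h with
  | nil_left => intro _ _ _ _ _ _ _ h; simp at h
  | nil_right => intro _ _ _ _ _ _ _ _ h; simp at h
  | @shared ℓ Y₁ Y₂ K₁ K₂ θ r hu _ ih =>
    intro hK₁ hK₂ θ' hθ' ℓ' Z₁ Z₂ hZ₁ hZ₂
    obtain ⟨θ', rfl, rfl⟩ := Option.map_eq_some_iff.1 hθ'
    rw [Multiset.map_cons, Multiset.nodup_cons] at hK₁ hK₂
    rw [← Lin.subst_comp, ← Lin.subst_comp]
    rcases Multiset.mem_cons.1 hZ₁ with h₁ | h₁ <;> rcases Multiset.mem_cons.1 hZ₂ with h₂ | h₂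
    · cases h₁; cases h₂; rw [ulin_unifies hu]
    · cases h₁; exact absurd (Multiset.mem_map_of_mem Prod.fst h₂) hK₂.1
    · cases h₂; exact absurd (Multiset.mem_map_of_mem Prod.fst h₁) hK₁.1
    · exact ih (CRow.subst_nodup_iff.2 hK₁.2) (CRow.subst_nodup_iff.2 hK₂.2) θ' rfl ℓ' _ _
        (CRow.mem_subst.2 ⟨_, h₁, rfl⟩) (CRow.mem_subst.2 ⟨_, h₂, rfl⟩)
  | clash => rintro _ _ _ ⟨⟩
  | skip_left hℓ _ ih =>
    intro hK₁ hK₂ θ hθ ℓ' Z₁ Z₂ hZ₁ hZ₂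
    rw [Multiset.map_cons, Multiset.nodup_cons] at hK₁
    rcases Multiset.mem_cons.1 hZ₁ with h₁ | h₁
    · cases h₁; exact absurd (CRow.mem_dom.2 ⟨_, hZ₂⟩) hℓ
    · exact ih hK₁.2 hK₂ θ hθ ℓ' Z₁ Z₂ h₁ hZ₂
  | skip_right hℓ _ ih =>
    intro hK₁ hK₂ θ hθ ℓ' Z₁ Z₂ hZ₁ hZ₂
    rw [Multiset.map_cons, Multiset.nodup_cons] at hK₂
    rcases Multiset.mem_cons.1 hZ₂ with h₂ | h₂
    · cases h₂; exact absurd (CRow.mem_dom.2 ⟨_, hZ₁⟩) hℓ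
    · exact ih hK₁ hK₂.2 θ hθ ℓ' Z₁ Z₂ hZ₁ h₂

theorem ULab.exists_result (K₁ K₂ : CRow ℕ) : ∃ r, ULab K₁ K₂ r := by
  induction hn : K₁.card + K₂.card using Nat.strong_induction_on generalizing K₁ K₂ with
  | _ n ih =>
    subst hn
    induction K₁ using Multiset.induction_on with
    | empty => exact ⟨_, .nil_left _⟩
    | cons e K₁ _ =>
      obtain ⟨ℓ, Y₁⟩ := e
      by_cases hℓ : ℓ ∈ CRow.dom K₂
      · obtain ⟨Y₂, hY₂⟩ := CRow.mem_dom.1 hℓ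
        obtain ⟨K₂, rfl⟩ := Multiset.exists_cons_of_mem hY₂
        cases hu : ulin Y₁ Y₂ with
        | none => exact ⟨_, .clash hu⟩
        | some θ =>
          obtain ⟨r, hr⟩ := ih ((CRow.subst θ K₁).card + (CRow.subst θ K₂).card)
            (by simp [CRow.subst]; omega) _ _ rfl
          exact ⟨_, .shared hu hr⟩
      · obtain ⟨r, hr⟩ := ih (K₁.card + K₂.card) (by simp) _ _ rfl
        exact ⟨r, .skip_left hℓ hr⟩

end Unification

/-! ## One step of the row solver -/

section RowSolver

theorem entails_empty_sub {R₁ R₂ : Row ℕ} : Entails ∅ (.sub R₁ R₂) ↔ R₁.Sub R₂ := by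
  refine ⟨fun h => ?_, .sub⟩
  cases h with
  | subsume h => simp at h
  | sub h => exact h

theorem entails_empty_lack {R : Row ℕ} {L : Finset ℕ} :
    Entails ∅ (.lack R L) ↔ Disjoint (CRow.dom R.labels) L := by
  refine ⟨fun h => ?_, .lack⟩
  cases h with
  | subsume h => simp at h
  | lack h => exact h

/-- The predicate that remains of `K₁;t₁ ⩽ R₂` when the labels in `K₁` have been removed, and the
rest of `R₂` is `R`. -/
def leftover (t₁ : Option ℕ) (R : Row ℕ) : PSet :=
  t₁.elim ∅ (fun μ₁ => {.sub (Row.var μ₁) R})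

/-- `Reduce μ π δ X`: the row solver simplifies `π` under the substitution `δ`, which may use the
fresh variable `μ`, to the predicates in `X`. -/
inductive Reduce (μ : ℕ) : Pred ℕ → Subst ℕ ℕ → PSet → Prop
  | lin (τ₁ τ₂ : Typ ℕ) : Reduce μ (.lin τ₁ τ₂) Subst.id {.lin τ₁ τ₂}
  | lack_closed {K : CRow ℕ} {L : Finset ℕ} :
      Disjoint (CRow.dom K) L → Reduce μ (.lack ⟨K, none⟩ L) Subst.id ∅
  | lack_open {K : CRow ℕ} {μ₁ : ℕ} {L : Finset ℕ} :
      Disjoint (CRow.dom K) L → Reduce μ (.lack ⟨K, some μ₁⟩ L) Subst.id {.lack (Row.var μ₁) L}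
  | sub {K₁ K₂ : CRow ℕ} {t₁ t₂ : Option ℕ} {θ : Subst ℕ ℕ} :
      ULab K₁ K₂ (some θ) →
      (∀ e ∈ CRow.subst θ K₁, e ∈ CRow.subst θ K₂) →
      Reduce μ (.sub ⟨K₁, t₁⟩ ⟨K₂, t₂⟩) θ
        (if t₁ = t₂ then ∅
          else leftover t₁ ⟨CRow.diff (CRow.subst θ K₂) (CRow.subst θ K₁), t₂⟩)
  | extend {K₁ K₂ : CRow ℕ} {t₁ : Option ℕ} {μ₂ : ℕ} {θ : Subst ℕ ℕ} :
      ULab K₁ K₂ (some θ) →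
      t₁ ≠ some μ₂ →
      ¬ (∀ e ∈ CRow.subst θ K₁, e ∈ CRow.subst θ K₂) →
      Reduce μ (.sub ⟨K₁, t₁⟩ ⟨K₂, some μ₂⟩)
        ((Subst.oneRow μ₂ ⟨CRow.diff (CRow.subst θ K₁) (CRow.subst θ K₂), some μ⟩).comp θ)
        (leftover t₁ ⟨CRow.diff (CRow.subst θ K₂) (CRow.subst θ K₁), some μ⟩)

theorem subCase_eq (θ : Subst ℕ ℕ) (P Q : PSet) (μ : ℕ) (K₁ : CRow ℕ) (t₁ : Option ℕ)
    (K₂ : CRow ℕ) (t₂ : Option ℕ) (θ' : Subst ℕ ℕ) :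
    subCase θ P Q μ K₁ t₁ K₂ t₂ θ' =
      if ∀ e ∈ CRow.subst θ' K₁, e ∈ CRow.subst θ' K₂ then
        some (θ'.comp θ,
          (if t₁ = t₂ then ∅
            else leftover t₁ ⟨CRow.diff (CRow.subst θ' K₂) (CRow.subst θ' K₁), t₂⟩) ∪
              PSet.subst θ' P,
          PSet.subst θ' Q)
      else if t₁ = t₂ then none
      else t₂.bind fun μ₂ =>
        let δ := (Subst.oneRow μ₂
          ⟨CRow.diff (CRow.subst θ' K₁) (CRow.subst θ' K₂), some μ⟩).comp θ'
        some (δ.comp θ,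
          leftover t₁ ⟨CRow.diff (CRow.subst θ' K₂) (CRow.subst θ' K₁), some μ⟩,
          PSet.subst δ (Q ∪ P)) := by
  unfold subCase leftover
  rcases t₁ with _ | μ₁ <;> rcases t₂ with _ | μ₂
  · simp
  · simp
  · simp
  · by_cases h : μ₁ = μ₂
    · simp [h]
    · simp [h]

theorem RowStep.reduce {θ θ₁ : Subst ℕ ℕ} {P Q P₁ Q₁ : PSet} {μ : ℕ} {π : Pred ℕ}
    (h : RowStep θ P Q μ π (some (θ₁, P₁, Q₁))) :
    ∃ δ X, Reduce μ π δ X ∧ θ₁ = δ.comp θ ∧ P₁ ∪ Q₁ = X ∪ PSet.subst δ (P ∪ Q) ∧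
      ((δ.LinOnly ∧ P₁ = X ∪ PSet.subst δ P ∧ Q₁ = PSet.subst δ Q) ∨
        P₁ = X ∧ ∃ K₁ t₁ K₂ μ₂ K, π = .sub ⟨K₁, t₁⟩ ⟨K₂, some μ₂⟩ ∧
        δ.row μ₂ = ⟨K, some μ⟩ ∧ 0 < K.card) := by
  generalize hr : some (θ₁, P₁, Q₁) = r at h
  cases h with
  | lin τ₁ τ₂ =>
    cases hr
    exact ⟨_, _, .lin τ₁ τ₂, (Subst.id_comp _).symm, by simp [PSet.subst_id],
      .inl ⟨.id, by simp [PSet.subst_id], (PSet.subst_id _).symm⟩⟩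
  | lack_closed K L =>
    split_ifs at hr with hK
    cases hr
    exact ⟨_, _, .lack_closed hK, (Subst.id_comp _).symm, by simp [PSet.subst_id],
      .inl ⟨.id, by simp [PSet.subst_id], (PSet.subst_id _).symm⟩⟩
  | lack_open K μ₁ L =>
    split_ifs at hr with hK
    cases hr
    exact ⟨_, _, .lack_open hK, (Subst.id_comp _).symm, by simp [PSet.subst_id],
      .inl ⟨.id, by simp [PSet.subst_id], (PSet.subst_id _).symm⟩⟩
  | @sub K₁ K₂ t₁ t₂ r hu =>
    obtain ⟨θ', rfl, hr'⟩ := Option.bind_eq_some_iff.1 hr.symm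
    clear hr
    rename _ = _ => hr
    rw [subCase_eq] at hr
    split_ifs at hr with hK ht ht
    · cases hr
      refine ⟨_, _, .sub hu hK, rfl, ?_, .inl ⟨hu.linOnly _ rfl, by rw [if_pos ht], rfl⟩⟩
      rw [if_pos ht, Finset.union_assoc, PSet.subst, PSet.subst, ← Finset.image_union]; rfl
    · cases hr
      refine ⟨_, _, .sub hu hK, rfl, ?_, .inl ⟨hu.linOnly _ rfl, by rw [if_neg ht], rfl⟩⟩
      rw [if_neg ht, Finset.union_assoc, PSet.subst, PSet.subst, ← Finset.image_union]; rfl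
    · obtain ⟨μ₂, rfl, hr⟩ := Option.bind_eq_some_iff.1 hr
      cases hr
      refine ⟨_, _, .extend hu ht hK, rfl, by rw [Finset.union_comm Q P],
        .inr ⟨rfl, K₁, t₁, K₂, μ₂, CRow.diff (CRow.subst θ' K₁) (CRow.subst θ' K₂), rfl, ?_, ?_⟩⟩
      · change (θ'.row μ₂).subst _ = _
        rw [(hu.linOnly _ rfl).2, Row.subst_var]
        simp [Subst.oneRow]
      · push Not at hK
        obtain ⟨e, he, he'⟩ := hK
        exact Multiset.card_pos_iff_exists_mem.2 ⟨e, CRow.mem_diff.2 ⟨he, he'⟩⟩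

theorem RowStep.exists_result (θ : Subst ℕ ℕ) (P Q : PSet) (μ : ℕ) (π : Pred ℕ) :
    ∃ r, RowStep θ P Q μ π r := by
  rcases π with ⟨τ₁, τ₂⟩ | ⟨⟨K₁, t₁⟩, ⟨K₂, t₂⟩⟩ | ⟨⟨K, _ | μ₁⟩, L⟩
  · exact ⟨_, .lin τ₁ τ₂⟩
  · obtain ⟨r, hr⟩ := ULab.exists_result K₁ K₂
    exact ⟨_, .sub hr⟩
  · exact ⟨_, .lack_closed K L⟩
  · exact ⟨_, .lack_open K μ₁ L⟩

end RowSolver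

section RowSolver

theorem CRow.disjoint_dom {ν : Type} {K : CRow ν} {L : Finset ℕ} :
    Disjoint (CRow.dom K) L ↔ ∀ e ∈ K, e.1 ∉ L := by
  simp [Finset.disjoint_left, CRow.mem_dom]

theorem Row.subst_linOnly {θ : Subst ℕ ℕ} (h : θ.LinOnly) (R : Row ℕ) :
    R.subst θ = ⟨CRow.subst θ R.labels, R.tail⟩ := by
  rw [Row.ext_iff', Row.subst_labels, Row.subst_tail]
  cases R.tail <;> simp [h.2, Row.var]

theorem CRow.subst_lin_congr {s t : Subst ℕ ℕ} (h : s.lin = t.lin) (K : CRow ℕ) :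
    CRow.subst s K = CRow.subst t K := by
  refine Multiset.map_congr rfl fun e _ => ?_
  cases hY : e.2 <;> simp [Lin.subst, h]

theorem CRow.subst_oneRow (μ : ℕ) (R : Row ℕ) (K : CRow ℕ) :
    CRow.subst (Subst.oneRow μ R) K = K :=
  (CRow.subst_lin_congr (t := Subst.id) rfl K).trans (CRow.subst_id K)

theorem Row.subst_oneRow_of_ne {μ : ℕ} {t : Option ℕ} (h : t ≠ some μ) (R : Row ℕ)
    (K : CRow ℕ) : (⟨K, t⟩ : Row ℕ).subst (Subst.oneRow μ R) = ⟨K, t⟩ := by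
  rw [Row.ext_iff', Row.subst_labels, Row.subst_tail, CRow.subst_oneRow]
  cases t with
  | none => simp
  | some ν =>
    have h' : ν ≠ μ := fun e => h (by rw [e])
    simp [Subst.oneRow, h', Subst.id, Subst.ren, Row.var]

theorem Row.subst_oneRow_self (μ : ℕ) (R : Row ℕ) (K : CRow ℕ) :
    (⟨K, some μ⟩ : Row ℕ).subst (Subst.oneRow μ R) = ⟨K + R.labels, R.tail⟩ := by
  rw [Row.ext_iff', Row.subst_labels, Row.subst_tail, CRow.subst_oneRow]
  simp [Subst.oneRow]

theorem CRow.subst_le {t : Subst ℕ ℕ} {K K' : CRow ℕ} (h : K ≤ K') :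
    CRow.subst t K ≤ CRow.subst t K' := Multiset.map_le_map h

theorem CRow.diff_le (K K' : CRow ℕ) : CRow.diff K K' ≤ K := Multiset.filter_le _ _

/-- The containment of rows, from that of the concrete parts and that of the tails. -/
theorem Row.sub_subst {t : Subst ℕ ℕ} {K₁ K₂ D : CRow ℕ} {t₁ t₂ : Option ℕ}
    (hK : ∀ e ∈ K₁, e ∈ K₂) (hD : ∀ e ∈ D, e ∈ K₂)
    (h : ∀ μ₁, t₁ = some μ₁ → t₁ ≠ t₂ → (t.row μ₁).Sub ((⟨D, t₂⟩ : Row ℕ).subst t)) :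
    ((⟨K₁, t₁⟩ : Row ℕ).subst t).Sub ((⟨K₂, t₂⟩ : Row ℕ).subst t) := by
  refine ⟨fun e he => ?_, fun μ hμ => ?_⟩
  · rcases Row.mem_subst.1 he with ⟨e', he', rfl⟩ | ⟨μ₁, hμ₁, he⟩
    · exact Row.mem_subst.2 (.inl ⟨e', hK e' he', rfl⟩)
    · by_cases ht : t₁ = t₂
      · exact Row.mem_subst.2 (.inr ⟨μ₁, ht ▸ hμ₁, he⟩)
      · rcases Row.mem_subst.1 ((h μ₁ hμ₁ ht).1 e he) with ⟨e', he', rfl⟩ | h'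
        · exact Row.mem_subst.2 (.inl ⟨e', hD e' he', rfl⟩)
        · exact Row.mem_subst.2 (.inr h')
  · by_cases ht : t₁ = t₂
    · subst ht; rw [Row.subst_tail] at hμ ⊢; exact hμ
    · rw [Row.subst_tail, Option.bind_eq_some_iff] at hμ
      obtain ⟨μ₁, hμ₁, hμ⟩ := hμ
      have := (h μ₁ hμ₁ ht).2 μ hμ
      rwa [Row.subst_tail] at this ⊢

theorem mem_leftover {t₁ : Option ℕ} {R : Row ℕ} {κ : Pred ℕ} :
    κ ∈ leftover t₁ R ↔ ∃ μ₁, t₁ = some μ₁ ∧ κ = .sub (Row.var μ₁) R := by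
  cases t₁ <;> simp [leftover]

theorem entails_leftover {t : Subst ℕ ℕ} {t₁ : Option ℕ} {R : Row ℕ}
    (h : ∀ κ ∈ leftover t₁ R, Entails ∅ (κ.subst t)) {μ₁ : ℕ} (hμ₁ : t₁ = some μ₁) :
    (t.row μ₁).Sub (R.subst t) := by
  have := h _ (mem_leftover.2 ⟨μ₁, hμ₁, rfl⟩)
  rwa [Pred.subst, entails_empty_sub, Row.subst_var] at this

/-- Solutions of the residual solve the predicate. -/
theorem Reduce.sound {μ : ℕ} {π : Pred ℕ} {δ : Subst ℕ ℕ} {X : PSet} (h : Reduce μ π δ X)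
    {t : Subst ℕ ℕ} (hX : ∀ κ ∈ X, Entails ∅ (κ.subst t)) :
    Entails ∅ ((π.subst δ).subst t) := by
  cases h with
  | lin τ₁ τ₂ => rw [Pred.subst_id]; exact hX _ (by simp)
  | lack_closed hK =>
    rw [Pred.subst_id, Pred.subst, entails_empty_lack, Row.subst_labels]
    simpa [CRow.dom_subst] using hK
  | @lack_open K μ₁ L hK =>
    have := hX _ (Finset.mem_singleton_self _)
    rw [Pred.subst, entails_empty_lack, Row.subst_var, CRow.disjoint_dom] at this
    rw [Pred.subst_id, Pred.subst, entails_empty_lack, CRow.disjoint_dom]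
    rw [CRow.disjoint_dom] at hK
    intro e he
    rcases Row.mem_subst.1 he with ⟨e', he', rfl⟩ | ⟨_, ⟨⟩, he⟩
    · exact hK e' he'
    · exact this e he
  | @sub K₁ K₂ t₁ t₂ _ hu hK =>
    rw [Pred.subst, Pred.subst, entails_empty_sub, Row.subst_linOnly (hu.linOnly _ rfl),
      Row.subst_linOnly (hu.linOnly _ rfl)]
    refine Row.sub_subst (D := CRow.diff (CRow.subst δ K₂) (CRow.subst δ K₁)) hK
      (fun e he => (CRow.mem_diff.1 he).1) fun μ₁ hμ₁ ht => ?_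
    rw [if_neg ht] at hX
    exact entails_leftover hX hμ₁
  | @extend K₁ K₂ t₁ μ₂ θ hu ht hK =>
    rw [Pred.subst, Pred.subst, entails_empty_sub, ← Row.subst_comp, ← Row.subst_comp,
      Row.subst_linOnly (hu.linOnly _ rfl), Row.subst_linOnly (hu.linOnly _ rfl),
      Row.subst_oneRow_of_ne ht, Row.subst_oneRow_self]
    refine Row.sub_subst (D := CRow.diff (CRow.subst θ K₂) (CRow.subst θ K₁))
      (fun e he => Multiset.mem_add.2 ?_)
      (fun e he => Multiset.mem_add.2 (.inl (CRow.mem_diff.1 he).1))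
      fun μ₁ hμ₁ _ => entails_leftover hX hμ₁
    by_cases he' : e ∈ CRow.subst θ K₂
    · exact .inl he'
    · exact .inr (CRow.mem_diff.2 ⟨he, he'⟩)

section Containment

variable {t : Subst ℕ ℕ} {K₁ K₂ : CRow ℕ} {t₁ t₂ : Option ℕ}

theorem Row.Sub.shared_eq (hs : ((⟨K₁, t₁⟩ : Row ℕ).subst t).Sub ((⟨K₂, t₂⟩ : Row ℕ).subst t))
    (h₂ : ((⟨K₂, t₂⟩ : Row ℕ).subst t).WF) :
    ∀ ℓ Y₁ Y₂, (ℓ, Y₁) ∈ K₁ → (ℓ, Y₂) ∈ K₂ → Y₁.subst t = Y₂.subst t :=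
  fun _ _ _ hY₁ hY₂ => CRow.eq_of_fst_eq h₂ (hs.1 _ (Row.mem_subst.2 (.inl ⟨_, hY₁, rfl⟩)))
    (Row.mem_subst.2 (.inl ⟨_, hY₂, rfl⟩))

theorem Row.WF.not_mem_tail (h₁ : ((⟨K₁, t₁⟩ : Row ℕ).subst t).WF) {μ₁ : ℕ}
    (ht : t₁ = some μ₁) {e e' : ℕ × Lin ℕ} (he : e ∈ K₁) (he' : e' ∈ (t.row μ₁).labels) :
    e.1 ≠ e'.1 := by
  subst ht
  rw [Row.WF, Row.subst_labels] at h₁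
  intro h
  obtain ⟨ℓ', Y'⟩ := e'
  cases h
  exact CRow.not_mem_of_nodup_add h₁ (CRow.mem_subst.2 ⟨e, he, rfl⟩) he'

theorem Row.Sub.tail_sub (hs : ((⟨K₁, t₁⟩ : Row ℕ).subst t).Sub ((⟨K₂, t₂⟩ : Row ℕ).subst t))
    (h₁ : ((⟨K₁, t₁⟩ : Row ℕ).subst t).WF) {μ₁ : ℕ} (ht : t₁ = some μ₁) :
    (t.row μ₁).Sub ((⟨CRow.diff K₂ K₁, t₂⟩ : Row ℕ).subst t) := by
  refine ⟨fun e he => ?_, fun μ hμ => ?_⟩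
  · rcases Row.mem_subst.1 (hs.1 e (Row.mem_subst.2 (.inr ⟨μ₁, ht, he⟩))) with
      ⟨e', he', rfl⟩ | h'
    · refine Row.mem_subst.2 (.inl ⟨e', CRow.mem_diff.2 ⟨he', fun h => ?_⟩, rfl⟩)
      exact h₁.not_mem_tail ht h he rfl
    · exact Row.mem_subst.2 (.inr h')
  · have := hs.2 μ (by rw [Row.subst_tail, ht]; exact hμ)
    rwa [Row.subst_tail] at this ⊢

theorem Row.Sub.mem_tail (hs : ((⟨K₁, t₁⟩ : Row ℕ).subst t).Sub ((⟨K₂, t₂⟩ : Row ℕ).subst t))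
    (hU : ∀ ℓ Y₁ Y₂, (ℓ, Y₁) ∈ K₁ → (ℓ, Y₂) ∈ K₂ → Y₁ = Y₂) {e : ℕ × Lin ℕ} (he : e ∈ K₁)
    (he' : e ∉ K₂) : ∃ μ₂, t₂ = some μ₂ ∧ (e.1, e.2.subst t) ∈ (t.row μ₂).labels := by
  rcases Row.mem_subst.1 (hs.1 _ (Row.mem_subst.2 (.inl ⟨e, he, rfl⟩))) with ⟨⟨ℓ, Y⟩, h, h'⟩ | h
  · obtain ⟨ℓ', Y'⟩ := e
    cases congrArg Prod.fst h'
    cases hU _ _ _ he h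
    exact absurd h he'
  · exact h

theorem Row.Sub.tail_ne (hs : ((⟨K₁, t₁⟩ : Row ℕ).subst t).Sub ((⟨K₂, t₂⟩ : Row ℕ).subst t))
    (h₁ : ((⟨K₁, t₁⟩ : Row ℕ).subst t).WF)
    (hU : ∀ ℓ Y₁ Y₂, (ℓ, Y₁) ∈ K₁ → (ℓ, Y₂) ∈ K₂ → Y₁ = Y₂)
    (hK : ¬ ∀ e ∈ K₁, e ∈ K₂) : ∃ μ₂, t₂ = some μ₂ ∧ t₁ ≠ t₂ := by
  push Not at hK
  obtain ⟨e, he, he'⟩ := hK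
  obtain ⟨μ₂, hμ₂, h⟩ := hs.mem_tail hU he he'
  exact ⟨μ₂, hμ₂, fun ht => h₁.not_mem_tail (ht.trans hμ₂) he h rfl⟩

theorem Row.WF.diff (h₂ : ((⟨K₂, t₂⟩ : Row ℕ).subst t).WF) :
    ((⟨CRow.diff K₂ K₁, t₂⟩ : Row ℕ).subst t).WF := by
  rw [Row.WF, Row.subst_labels] at *
  exact CRow.nodup_map_fst_of_le
    (add_le_add_left (CRow.subst_le (CRow.diff_le K₂ K₁)) _) h₂

/-- `t` with the value of `μ₂` split into the labels in `D` and the rest, which becomes the value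
of `μ`. -/
def Subst.split (t : Subst ℕ ℕ) (μ₂ : ℕ) (D : CRow ℕ) (μ : ℕ) : Subst ℕ ℕ :=
  { t with
    row := Function.update t.row μ ⟨(t.row μ₂).labels - CRow.subst t D, (t.row μ₂).tail⟩ }

theorem Subst.split_row_self (t : Subst ℕ ℕ) (μ₂ : ℕ) (D : CRow ℕ) (μ : ℕ) :
    (t.split μ₂ D μ).row μ = ⟨(t.row μ₂).labels - CRow.subst t D, (t.row μ₂).tail⟩ := by
  simp [Subst.split]

theorem CRow.subst_split (t : Subst ℕ ℕ) (μ₂ : ℕ) (D : CRow ℕ) (μ : ℕ) (K : CRow ℕ) :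
    CRow.subst (t.split μ₂ D μ) K = CRow.subst t K := CRow.subst_lin_congr rfl K

theorem Subst.split_row_of_ne (t : Subst ℕ ℕ) (μ₂ : ℕ) (D : CRow ℕ) {μ ν : ℕ} (h : ν ≠ μ) :
    (t.split μ₂ D μ).row ν = t.row ν := by
  simp [Subst.split, h]

theorem Subst.WF.split (ht : t.WF) (μ₂ : ℕ) (D : CRow ℕ) (μ : ℕ) : (t.split μ₂ D μ).WF := by
  refine ⟨ht.1, fun ν => ?_⟩
  by_cases h : ν = μ
  · subst h
    rw [Subst.split_row_self]
    exact CRow.nodup_map_fst_of_le tsub_le_self (ht.2 μ₂)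
  · rw [Subst.split_row_of_ne _ _ _ h]; exact ht.2 ν

theorem Subst.split_comp_agreeOn {N : Finset (Kind × ℕ)} {μ μ₂ : ℕ} {D : CRow ℕ}
    (hμ : (Kind.row, μ) ∉ N) (hD : CRow.subst t D ≤ (t.row μ₂).labels) :
    ((t.split μ₂ D μ).comp (Subst.oneRow μ₂ ⟨D, some μ⟩)).AgreeOn N t := by
  refine ⟨fun _ _ => rfl, fun ν hν => ?_, fun _ _ => rfl⟩
  have hne : ν ≠ μ := by rintro rfl; exact hμ hν
  by_cases h : ν = μ₂
  · rw [h]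
    change Row.subst _ (Function.update Subst.id.row μ₂ _ _) = _
    rw [Function.update_self, Row.ext_iff', Row.subst_labels, Row.subst_tail]
    simp [CRow.subst_split, Subst.split_row_self, add_tsub_cancel_of_le hD]
  · change Row.subst _ (Function.update Subst.id.row μ₂ _ _) = _
    rw [Function.update_of_ne h]
    exact (Row.subst_var _ _).trans (Subst.split_row_of_ne _ _ _ hne)

end Containment

theorem ULab.unifies_subst {K₁ K₂ : CRow ℕ} {θ : Subst ℕ ℕ} (h : ULab K₁ K₂ (some θ))
    (hK₁ : (K₁.map Prod.fst).Nodup) (hK₂ : (K₂.map Prod.fst).Nodup) :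
    ∀ ℓ Y₁ Y₂, (ℓ, Y₁) ∈ CRow.subst θ K₁ → (ℓ, Y₂) ∈ CRow.subst θ K₂ → Y₁ = Y₂ := by
  intro ℓ Y₁ Y₂ hY₁ hY₂
  obtain ⟨⟨_, Z₁⟩, z₁, e₁⟩ := CRow.mem_subst.1 hY₁
  obtain ⟨⟨_, Z₂⟩, z₂, e₂⟩ := CRow.mem_subst.1 hY₂
  cases e₁; cases e₂
  exact h.unifies hK₁ hK₂ _ rfl _ _ _ z₁ z₂

/-- A solution of the predicate is, up to the fresh variable, a solution of the residual. -/
theorem Reduce.complete {μ : ℕ} {π : Pred ℕ} {δ : Subst ℕ ℕ} {X : PSet} (h : Reduce μ π δ X)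
    {t : Subst ℕ ℕ} (ht : t.WF) (hπ : (π.subst t).WF) (he : Entails ∅ (π.subst t))
    {N : Finset (Kind × ℕ)} (hN : π.fv ⊆ N) (hμ : (Kind.row, μ) ∉ N) :
    ∃ t' : Subst ℕ ℕ, t'.WF ∧ (t'.comp δ).AgreeOn N t ∧
      ∀ κ ∈ X, (κ.subst t').WF ∧ Entails ∅ (κ.subst t') := by
  cases h with
  | lin τ₁ τ₂ =>
    refine ⟨t, ht, by rw [Subst.comp_id]; exact .refl _, fun κ hκ => ?_⟩
    rw [Finset.mem_singleton.1 hκ]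
    exact ⟨hπ, he⟩
  | lack_closed hK =>
    exact ⟨t, ht, by rw [Subst.comp_id]; exact .refl _, by simp⟩
  | @lack_open K μ₁ L hK =>
    refine ⟨t, ht, by rw [Subst.comp_id]; exact .refl _, fun κ hκ => ?_⟩
    rw [Finset.mem_singleton.1 hκ]
    rw [Pred.subst, entails_empty_lack, CRow.disjoint_dom] at *
    rw [Pred.WF, Row.subst_var]
    exact ⟨ht.2 μ₁, fun e he' => he e (Row.mem_subst.2 (.inr ⟨μ₁, rfl, he'⟩))⟩
  | @sub K₁ K₂ t₁ t₂ _ hu hK =>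
    rw [Pred.subst, entails_empty_sub] at he
    obtain ⟨h₁, h₂⟩ := hπ
    obtain ⟨_, ⟨⟩, hδ⟩ := hu.complete (he.shared_eq h₂)
    rw [← hδ, ← Row.subst_comp, ← Row.subst_comp, Row.subst_linOnly (hu.linOnly _ rfl),
      Row.subst_linOnly (hu.linOnly _ rfl)] at he
    rw [← hδ, ← Row.subst_comp, Row.subst_linOnly (hu.linOnly _ rfl)] at h₁ h₂
    refine ⟨t, ht, by rw [hδ]; exact .refl _, fun κ hκ => ?_⟩
    split_ifs at hκ with htt
    · simp at hκ
    · obtain ⟨μ₁, hμ₁, rfl⟩ := mem_leftover.1 hκ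
      rw [Pred.subst, entails_empty_sub, Row.subst_var]
      exact ⟨⟨ht.2 μ₁, h₂.diff⟩, he.tail_sub h₁ hμ₁⟩
  | @extend K₁ K₂ t₁ μ₂ θ hu htt hK =>
    rw [Pred.subst, entails_empty_sub] at he
    obtain ⟨h₁, h₂⟩ := hπ
    have hU := hu.unifies_subst (Row.WF.of_subst h₁) (Row.WF.of_subst h₂)
    obtain ⟨_, ⟨⟩, hθ⟩ := hu.complete (he.shared_eq h₂)
    have hfv := Finset.union_subset_iff.1 hN
    have hmaps : θ.MapsVars N N := hu.mapsVars (Row.labels_fv_subset hfv.1)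
      (Row.labels_fv_subset hfv.2) _ rfl
    rw [← hθ, ← Row.subst_comp, ← Row.subst_comp, Row.subst_linOnly (hu.linOnly _ rfl),
      Row.subst_linOnly (hu.linOnly _ rfl)] at he
    rw [← hθ, ← Row.subst_comp, Row.subst_linOnly (hu.linOnly _ rfl)] at h₁ h₂
    dsimp only at he h₁ h₂
    generalize CRow.subst θ K₁ = K₁' at *
    generalize CRow.subst θ K₂ = K₂' at *
    have hD : CRow.subst t (CRow.diff K₁' K₂') ≤ (t.row μ₂).labels := by
      have hnd : ((CRow.subst t (CRow.diff K₁' K₂')).map Prod.fst).Nodup :=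
        CRow.subst_nodup_iff.2 (CRow.nodup_map_fst_of_le (CRow.diff_le _ _) (Row.WF.of_subst h₁))
      refine (Multiset.le_iff_subset (Multiset.Nodup.of_map _ hnd)).2 fun e hmem => ?_
      obtain ⟨e', he', rfl⟩ := CRow.mem_subst.1 hmem
      obtain ⟨_, ⟨⟩, h⟩ := he.mem_tail hU (CRow.mem_diff.1 he').1 (CRow.mem_diff.1 he').2
      exact h
    refine ⟨t.split μ₂ (CRow.diff K₁' K₂') μ, ht.split _ _ _, ?_, fun κ hκ => ?_⟩
    · rw [← Subst.comp_assoc]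
      have := (Subst.split_comp_agreeOn hμ hD).comp_right hmaps
      rwa [hθ] at this
    · obtain ⟨μ₁, hμ₁, rfl⟩ := mem_leftover.1 hκ
      have hne : μ₁ ≠ μ := by
        rintro rfl
        exact hμ (Row.tail_fv_subset hfv.1 _ hμ₁)
      rw [Pred.subst, entails_empty_sub, Row.subst_var, Subst.split_row_of_ne _ _ _ hne]
      have hlab : ((⟨CRow.diff K₂' K₁', some μ⟩ : Row ℕ).subst
          (t.split μ₂ (CRow.diff K₁' K₂') μ)) =
          ⟨CRow.subst t (CRow.diff K₂' K₁') +
            ((t.row μ₂).labels - CRow.subst t (CRow.diff K₁' K₂')), (t.row μ₂).tail⟩ := by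
        rw [Row.ext_iff', Row.subst_labels, Row.subst_tail]
        simp [CRow.subst_split, Subst.split_row_self]
      rw [hlab]
      refine ⟨⟨ht.2 μ₁, ?_⟩, ?_, ?_⟩
      · rw [Row.WF, Row.subst_labels] at h₂
        exact CRow.nodup_map_fst_of_le
          (add_le_add (CRow.subst_le (CRow.diff_le _ _)) tsub_le_self) h₂
      · intro e hmem
        rcases Row.mem_subst.1 ((he.tail_sub h₁ hμ₁).1 e hmem) with ⟨e', he', rfl⟩ | ⟨_, ⟨⟩, h⟩
        · exact Multiset.mem_add.2 (.inl (CRow.mem_subst.2 ⟨e', he', rfl⟩))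
        · refine Multiset.mem_add.2 (.inr ?_)
          rw [← add_tsub_cancel_of_le hD] at h
          rcases Multiset.mem_add.1 h with h | h
          · obtain ⟨e', he', rfl⟩ := CRow.mem_subst.1 h
            exact absurd rfl (h₁.not_mem_tail (e := e') (e' := (e'.1, e'.2.subst t)) hμ₁
              (CRow.mem_diff.1 he').1 hmem)
          · exact h
      · intro ν hν
        simpa [Row.subst_tail] using (he.tail_sub h₁ hμ₁).2 ν hν

/-- When the row solver fails, the predicate has no solution. -/
theorem RowStep.not_entails {θ : Subst ℕ ℕ} {P Q : PSet} {μ : ℕ} {π : Pred ℕ}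
    (h : RowStep θ P Q μ π none) {t : Subst ℕ ℕ} (hπ : (π.subst t).WF) :
    ¬ Entails ∅ (π.subst t) := by
  intro he
  generalize hr : none = r at h
  cases h with
  | lin τ₁ τ₂ => cases hr
  | lack_closed K L =>
    split_ifs at hr with hK
    rw [Pred.subst, entails_empty_lack, CRow.disjoint_dom] at he
    exact hK (CRow.disjoint_dom.2 fun e h =>
      he (e.1, e.2.subst t) (Row.mem_subst.2 (.inl ⟨e, h, rfl⟩)))
  | lack_open K μ₁ L =>
    split_ifs at hr with hK
    rw [Pred.subst, entails_empty_lack, CRow.disjoint_dom] at he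
    exact hK (CRow.disjoint_dom.2 fun e h =>
      he (e.1, e.2.subst t) (Row.mem_subst.2 (.inl ⟨e, h, rfl⟩)))
  | @sub K₁ K₂ t₁ t₂ r hu =>
    rw [Pred.subst, entails_empty_sub] at he
    obtain ⟨h₁, h₂⟩ := hπ
    obtain ⟨δ, rfl, hδ⟩ := hu.complete (he.shared_eq h₂)
    have hU := hu.unifies_subst (Row.WF.of_subst h₁) (Row.WF.of_subst h₂)
    rw [Option.bind_some, subCase_eq] at hr
    rw [← hδ, ← Row.subst_comp, ← Row.subst_comp, Row.subst_linOnly (hu.linOnly _ rfl),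
      Row.subst_linOnly (hu.linOnly _ rfl)] at he
    rw [← hδ, ← Row.subst_comp, Row.subst_linOnly (hu.linOnly _ rfl)] at h₁
    dsimp only at he h₁
    split_ifs at hr with hK ht
    · obtain ⟨_, _, h⟩ := he.tail_ne h₁ hU hK
      exact h ht
    · obtain ⟨_, rfl, _⟩ := he.tail_ne h₁ hU hK
      simp at hr

end RowSolver

/-! ## Linearity predicates -/

section LinearityPredicates

/-- A function type counts as its linearity. -/
def Typ.strip : Typ ℕ → Typ ℕ
  | .val (.arrow _ Y _ _) => .lin Y
  | τ => τ

/-- The predicates that hold when `∘` is not below any linearity type but itself. -/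
def Pred.AnyIsTop : Pred ℕ → Prop
  | .lin τ τ' => τ.strip = .lin .any →
    match τ' with
    | .lin Y => Y = .any
    | .val B => (Typ.val B).strip = .lin .any
    | .row R => (∀ e ∈ R.labels, e.2 = .any) ∧ R.tail = none
  | _ => True

theorem Entails.anyIsTop {π : Pred ℕ} (h : Entails ∅ π) : π.AnyIsTop := by
  induction h with
  | subsume h => simp at h
  | refl τ =>
    intro h
    rcases τ with A | R | Y
    · exact h
    · simp [Typ.strip] at h
    · simpa [Typ.strip] using h
  | lin τ => exact fun _ => rfl
  | unl τ => intro h; simp [Typ.strip] at h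
  | func _ ih => exact ih
  | func_inv _ ih => exact ih
  | @row τ R _ _ ih₁ ih₂ =>
    refine fun h => ⟨fun e he => ih₁ e he h, ?_⟩
    cases ht : R.tail with
    | none => rfl
    | some μ => simpa [Row.var] using (ih₂ μ ht h).2
  | row_inv_label he _ ih => exact fun h => (ih h).1 _ he
  | row_inv_tail ht _ ih => exact fun h => absurd (ih h).2 (by simp [ht])
  | sub | lack => trivial

/-- The image of `τ` under `t` is above `∘`. -/
def Typ.AboveAny (t : Subst ℕ ℕ) (τ : Typ ℕ) : Prop :=
  Entails ∅ (.lin (.lin .any) (τ.subst t))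

theorem Typ.AboveAny.any (t : Subst ℕ ℕ) : Typ.AboveAny t (.lin .any) := .lin _

theorem Typ.AboveAny.not_unl (t : Subst ℕ ℕ) : ¬ Typ.AboveAny t (.lin .unl) := by
  intro h
  have := h.anyIsTop rfl
  simp [Typ.subst, Lin.subst] at this

theorem Typ.AboveAny.mono {t : Subst ℕ ℕ} {τ τ' : Typ ℕ} (h : Typ.AboveAny t τ)
    (hd : (Pred.lin τ τ').Directed) (he : Entails ∅ ((Pred.lin τ τ').subst t)) :
    Typ.AboveAny t τ' := by
  have h' := h.anyIsTop rfl
  rcases τ with A | R | Y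
  · simp only [Typ.subst, Pred.subst] at h' he
    cases hA : A.subst t with
    | var α => rw [hA] at h'; simp [Typ.strip] at h'
    | arrow A' Y B R =>
      rw [hA] at h' he
      simp only [Typ.strip, Typ.lin.injEq] at h'
      rw [h'] at he
      exact he.func_inv
  · exact absurd rfl (hd.1 R)
  · simp only [Typ.subst, Pred.subst] at h' he
    rwa [h'] at he

theorem entails_row_subst {t : Subst ℕ ℕ} {τ : Typ ℕ} {R : Row ℕ} :
    Entails ∅ (.lin τ (.row (R.subst t))) ↔
      (∀ e ∈ R.labels, Entails ∅ (.lin τ (.lin (e.2.subst t)))) ∧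
        ∀ μ, R.tail = some μ → Entails ∅ (.lin τ (.row (t.row μ))) := by
  refine ⟨fun h => ⟨fun e he => ?_, fun μ hμ => .row (fun e he => ?_) fun ν hν => ?_⟩,
    fun h => .row (fun e he => ?_) fun ν hν => ?_⟩
  · exact Entails.row_inv_label (Row.mem_subst.2 (.inl ⟨e, he, rfl⟩)) h
  · exact Entails.row_inv_label (Row.mem_subst.2 (.inr ⟨μ, hμ, he⟩)) h
  · exact Entails.row_inv_tail (by rw [Row.subst_tail, hμ]; exact hν) h
  · rcases Row.mem_subst.1 he with ⟨e', he', rfl⟩ | ⟨μ, hμ, he⟩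
    · exact h.1 e' he'
    · exact Entails.row_inv_label he (h.2 μ hμ)
  · rw [Row.subst_tail, Option.bind_eq_some_iff] at hν
    obtain ⟨μ, hμ, hν⟩ := hν
    exact Entails.row_inv_tail hν (h.2 μ hμ)

theorem entails_of_trivial {t : Subst ℕ ℕ} {τ τ' : Typ ℕ}
    (h : τ = τ' ∨ τ' = .lin .any ∨ τ = .lin .unl) : Entails ∅ ((Pred.lin τ τ').subst t) := by
  rcases h with rfl | rfl | rfl
  · exact .refl _
  · exact .lin _
  · exact .unl _

theorem entails_factAtom {t : Subst ℕ ℕ} {τ τ' : Typ ℕ} :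
    (∀ κ ∈ factAtom τ τ', Entails ∅ (κ.subst t)) ↔ Entails ∅ ((Pred.lin τ τ').subst t) := by
  unfold factAtom
  split_ifs with h
  · simpa using entails_of_trivial h
  · simp

theorem entails_factRight {t : Subst ℕ ℕ} {τ τ' : Typ ℕ} :
    (∀ κ ∈ factRight τ τ', Entails ∅ (κ.subst t)) ↔ Entails ∅ ((Pred.lin τ τ').subst t) := by
  unfold factRight
  split_ifs with h
  · simpa using entails_of_trivial h
  · rcases τ' with A | R | Y
    · exact entails_factAtom
    · simp only [Pred.subst, Typ.subst]
      rw [entails_row_subst]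
      have hunion : ∀ (s₁ s₂ : PSet) (p : Pred ℕ → Prop),
          (∀ κ ∈ s₁ ∪ s₂, p κ) ↔ (∀ κ ∈ s₁, p κ) ∧ ∀ κ ∈ s₂, p κ := by
        intro s₁ s₂ p
        exact Finset.forall_mem_union
      rw [hunion]
      refine and_congr ?_ ?_
      · have key := fun e : ℕ × Lin ℕ => entails_factAtom (t := t) (τ := τ) (τ' := .lin e.2)
        refine ⟨fun H e he => (key e).1 fun κ hκ => H κ ?_, fun H κ hκ => ?_⟩
        · exact Finset.mem_biUnion.2 ⟨e, Multiset.mem_toFinset.2 he, hκ⟩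
        · obtain ⟨e, he, hκ⟩ := Finset.mem_biUnion.1 hκ
          exact (key e).2 (H e (Multiset.mem_toFinset.1 he)) κ hκ
      · cases R.tail with
        | none => simp
        | some μ =>
          have key := entails_factAtom (t := t) (τ := τ) (τ' := .row (Row.var μ))
          simp only [Pred.subst, Typ.subst, Row.subst_var] at key
          simpa using key
    · exact entails_factAtom

theorem entails_func_iff {A B : Ty ℕ} {Y : Lin ℕ} {R : Row ℕ} {τ : Typ ℕ} :
    Entails ∅ (.lin (.val (.arrow A Y B R)) τ) ↔ Entails ∅ (.lin (.lin Y) τ) :=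
  ⟨.func_inv, .func⟩

/-- Factorisation of linearity predicates preserves solutions. -/
theorem entails_factLin {t : Subst ℕ ℕ} {τ τ' : Typ ℕ} :
    (∀ κ ∈ factLin τ τ', Entails ∅ (κ.subst t)) ↔ Entails ∅ ((Pred.lin τ τ').subst t) := by
  unfold factLin
  split_ifs with h
  · simpa using entails_of_trivial h
  · rcases τ with (α | ⟨A, Y, B, R⟩) | R | Y
    · exact entails_factRight
    · refine entails_factRight.trans ?_
      simp only [Pred.subst, Typ.subst, Ty.subst]
      exact entails_func_iff.symm
    · exact entails_factRight
    · exact entails_factRight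

/-- Linearity predicates that factorisation leaves alone. -/
def Pred.Atomic : Pred ℕ → Prop
  | .lin τ τ' => (∀ A Y B R, τ ≠ .val (.arrow A Y B R)) ∧ ∀ R, τ' = .row R → R.labels = 0
  | _ => True

theorem atomic_of_mem_factAtom {τ τ' : Typ ℕ} (h : (Pred.lin τ τ').Atomic) :
    ∀ κ ∈ factAtom τ τ', κ.Atomic := by
  unfold factAtom
  split_ifs <;> simp [h]

theorem atomic_of_mem_factRight {τ τ' : Typ ℕ} (h : ∀ A Y B R, τ ≠ .val (.arrow A Y B R)) :
    ∀ κ ∈ factRight τ τ', κ.Atomic := by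
  unfold factRight
  split_ifs
  · simp
  · rcases τ' with A | R | Y
    · exact atomic_of_mem_factAtom ⟨h, by simp⟩
    · intro κ hκ
      rcases Finset.mem_union.1 hκ with hκ | hκ
      · obtain ⟨e, _, hκ⟩ := Finset.mem_biUnion.1 hκ
        exact atomic_of_mem_factAtom ⟨h, by simp⟩ κ hκ
      · cases hR : R.tail <;> rw [hR] at hκ
        · simp at hκ
        · exact atomic_of_mem_factAtom ⟨h, by simp [Row.var]⟩ κ hκ
    · exact atomic_of_mem_factAtom ⟨h, by simp⟩

theorem atomic_of_mem_factLin {τ τ' : Typ ℕ} : ∀ κ ∈ factLin τ τ', κ.Atomic := by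
  unfold factLin
  split_ifs
  · simp
  · rcases τ with (α | ⟨A, Y, B, R⟩) | R | Y <;> exact atomic_of_mem_factRight (by simp)

theorem mem_factoriseSet_lin {P : PSet} {τ τ' : Typ ℕ} (h : Pred.lin τ τ' ∈ factoriseSet P) :
    ∃ τ₁ τ₂, Pred.lin τ₁ τ₂ ∈ P ∧ Pred.lin τ τ' ∈ factLin τ₁ τ₂ := by
  obtain ⟨π, hπ, h⟩ := Finset.mem_biUnion.1 h
  cases π with
  | lin τ₁ τ₂ => exact ⟨τ₁, τ₂, hπ, h⟩
  | sub R₁ R₂ => simp only [factorise] at h; split_ifs at h <;> simp at h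
  | lack R L => simp only [factorise] at h; split_ifs at h <;> simp at h

/-! ## Transitive closure -/

theorem mem_closeStep {T : Finset (Typ ℕ × Typ ℕ)} {τ₁ τ₂ a b : Typ ℕ} :
    (a, b) ∈ closeStep T τ₁ τ₂ ↔ (a, b) ∈ T ∨
      ((a = τ₁ ∨ (a, τ₁) ∈ T) ∧ (b = τ₂ ∨ (τ₂, b) ∈ T)) := by
  simp only [closeStep, Finset.mem_union, Finset.mem_product, Finset.mem_image,
    Finset.mem_filter, Finset.mem_insert, Finset.mem_singleton, Prod.exists, Prod.mk.injEq]
  constructor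
  · rintro (h | ⟨⟨a', b', ⟨h₁, h₁'⟩, rfl⟩, ⟨a'', b'', ⟨h₂, h₂'⟩, rfl⟩⟩)
    · exact .inl h
    · subst h₁' h₂'
      refine .inr ⟨?_, ?_⟩
      · rcases h₁ with h | ⟨rfl, _⟩ | ⟨h, h'⟩
        · exact .inr h
        · exact .inl rfl
        · exact .inl (h.trans h'.symm)
      · rcases h₂ with h | ⟨h, h'⟩ | ⟨_, rfl⟩
        · exact .inr h
        · exact .inl (h'.trans h.symm)
        · exact .inl rfl
  · rintro (h | ⟨h₁, h₂⟩)
    · exact .inl h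
    · refine .inr ⟨⟨a, τ₁, ⟨?_, rfl⟩, rfl⟩, ⟨τ₂, b, ⟨?_, rfl⟩, rfl⟩⟩
      · rcases h₁ with rfl | h
        · exact .inr (.inl ⟨rfl, rfl⟩)
        · exact .inl h
      · rcases h₂ with rfl | h
        · exact .inr (.inr ⟨rfl, rfl⟩)
        · exact .inl h

/-- The finite relation is transitive. -/
def TransRel (T : Finset (Typ ℕ × Typ ℕ)) : Prop :=
  ∀ a b c, (a, b) ∈ T → (b, c) ∈ T → (a, c) ∈ T

theorem TransRel.closeStep {T : Finset (Typ ℕ × Typ ℕ)} (h : TransRel T) (τ₁ τ₂ : Typ ℕ) :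
    TransRel (closeStep T τ₁ τ₂) := by
  intro a b c hab hbc
  rw [mem_closeStep] at *
  rcases hab with hab | ⟨ha, hb⟩ <;> rcases hbc with hbc | ⟨hb', hc⟩
  · exact .inl (h a b c hab hbc)
  · refine .inr ⟨.inr ?_, hc⟩
    rcases hb' with rfl | hb'
    · exact hab
    · exact h _ _ _ hab hb'
  · refine .inr ⟨ha, .inr ?_⟩
    rcases hb with rfl | hb
    · exact hbc
    · exact h _ _ _ hb hbc
  · exact .inr ⟨ha, hc⟩

/-- The canonical substitution for the closure `T`: linearity variables above `∘` become `∘`, the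
other ones `•`, and rows become empty. -/
def canonicalSubst (T : Finset (Typ ℕ × Typ ℕ)) : Subst ℕ ℕ where
  ty _ := .arrow (.var 0) .unl (.var 0) ⟨0, none⟩
  row _ := ⟨0, none⟩
  lin φ := if (Typ.lin .any, Typ.lin (.var φ)) ∈ T then .any else .unl

theorem entails_canonicalSubst {T : Finset (Typ ℕ × Typ ℕ)} (hT : TransRel T)
    (hT' : (Typ.lin Lin.any, Typ.lin Lin.unl) ∉ T) {τ τ' : Typ ℕ} (h : (τ, τ') ∈ T)
    (hd : (Pred.lin τ τ').Directed) (ha : (Pred.lin τ τ').Atomic) :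
    Entails ∅ ((Pred.lin τ τ').subst (canonicalSubst T)) := by
  have key : τ.subst (canonicalSubst T) = .lin .unl ∨
      (∃ A B R, τ.subst (canonicalSubst T) = .val (.arrow A .unl B R)) ∨
      (τ.subst (canonicalSubst T) = .lin .any ∧ (Typ.lin Lin.any, τ') ∈ T) := by
    rcases τ with (α | ⟨A, Y, B, R⟩) | R | (φ | _ | _)
    · exact .inr (.inl ⟨_, _, _, rfl⟩)
    · exact absurd rfl (ha.1 A Y B R)
    · exact absurd rfl (hd.1 R)
    · by_cases hφ : (Typ.lin Lin.any, Typ.lin (Lin.var φ)) ∈ T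
      · exact .inr (.inr ⟨by simp [Typ.subst, Lin.subst, canonicalSubst, hφ], hT _ _ _ hφ h⟩)
      · exact .inl (by simp [Typ.subst, Lin.subst, canonicalSubst, hφ])
    · exact .inl rfl
    · exact .inr (.inr ⟨rfl, h⟩)
  rw [Pred.subst]
  rcases key with h₁ | ⟨A, B, R, h₁⟩ | ⟨h₁, h₂⟩
  · rw [h₁]; exact .unl _
  · rw [h₁]; exact .func (.unl _)
  · rw [h₁]
    rcases τ' with A | R | (φ | _ | _)
    · exact absurd rfl (hd.2 A)
    · have hR := ha.2 R rfl
      exact entails_row_subst.2 ⟨by simp [hR], fun μ _ => .row (by simp [canonicalSubst])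
        (by simp [canonicalSubst])⟩
    · simp only [Typ.subst, Lin.subst, canonicalSubst, h₂, if_true]
      exact .refl _
    · exact absurd h₂ hT'
    · exact .refl _

end LinearityPredicates

/-! ## The invariant of the row solver -/

section Invariant

/-- The labels on both sides of a row inclusion. -/
def Pred.subLabels : Pred ℕ → Finset ℕ
  | .sub R₁ R₂ => CRow.dom R₁.labels ∪ CRow.dom R₂.labels
  | _ => ∅

/-- The labels of the row inclusions in the set. -/
def PSet.subLabels (P : PSet) : Finset ℕ := P.biUnion Pred.subLabels

/-- The row variables of the set. -/
def PSet.rowVars (P : PSet) : Finset ℕ := (P.fv.filter (fun x => x.1 = Kind.row)).image Prod.snd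

theorem PSet.mem_rowVars {P : PSet} {μ : ℕ} : μ ∈ P.rowVars ↔ (Kind.row, μ) ∈ P.fv := by
  simp [PSet.rowVars]

/-- The labels of the row are labels of `P₀`, and its row variable occurs in the image of a row
variable of `P₀` under `θ`. -/
def Row.Traced (P₀ : PSet) (θ : Subst ℕ ℕ) (R : Row ℕ) : Prop :=
  (∀ e ∈ R.labels, e.1 ∈ P₀.subLabels) ∧
    ∀ μ, R.tail = some μ → ∃ μ₀ ∈ P₀.rowVars, (θ.row μ₀).tail = some μ

/-- The rows of a row inclusion are traced. -/
def Pred.Traced (P₀ : PSet) (θ : Subst ℕ ℕ) : Pred ℕ → Prop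
  | .sub R₁ R₂ => R₁.Traced P₀ θ ∧ R₂.Traced P₀ θ
  | _ => True

/-- Predicates that the row solver counts as solved. -/
def Pred.Solved : Pred ℕ → Prop
  | .lin _ _ => True
  | .sub R₁ _ => ∃ μ, R₁ = Row.var μ
  | .lack R _ => ∃ μ, R = Row.var μ

theorem Row.Traced.subst {P₀ : PSet} {θ δ : Subst ℕ ℕ} {R : Row ℕ} (h : R.Traced P₀ θ)
    (hδ : ∀ μ, ∀ e ∈ (δ.row μ).labels, e.1 ∈ P₀.subLabels) :
    (R.subst δ).Traced P₀ (δ.comp θ) := by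
  refine ⟨fun e he => ?_, fun μ hμ => ?_⟩
  · rcases Row.mem_subst.1 he with ⟨e', he', rfl⟩ | ⟨μ, _, he⟩
    · exact h.1 e' he'
    · exact hδ μ e he
  · rw [Row.subst_tail, Option.bind_eq_some_iff] at hμ
    obtain ⟨ν, hν, hμ⟩ := hμ
    obtain ⟨μ₀, h₀, h₁⟩ := h.2 ν hν
    exact ⟨μ₀, h₀, by simp [Subst.comp, Row.subst_tail, h₁, hμ]⟩

theorem Pred.Traced.subst {P₀ : PSet} {θ δ : Subst ℕ ℕ} {π : Pred ℕ} (h : π.Traced P₀ θ)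
    (hδ : ∀ μ, ∀ e ∈ (δ.row μ).labels, e.1 ∈ P₀.subLabels) :
    (π.subst δ).Traced P₀ (δ.comp θ) := by
  cases π with
  | lin τ₁ τ₂ => trivial
  | sub R₁ R₂ => exact ⟨h.1.subst hδ, h.2.subst hδ⟩
  | lack R L => trivial

theorem Row.Traced.mono {P₀ : PSet} {θ : Subst ℕ ℕ} {R R' : Row ℕ} (h : R.Traced P₀ θ)
    (hl : ∀ e ∈ R'.labels, e ∈ R.labels) (ht : ∀ μ, R'.tail = some μ → R.tail = some μ) :
    R'.Traced P₀ θ := ⟨fun e he => h.1 e (hl e he), fun μ hμ => h.2 μ (ht μ hμ)⟩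

variable {μ : ℕ} {π : Pred ℕ} {δ : Subst ℕ ℕ} {X : PSet}

theorem Subst.LinOnly.labels {L : Finset ℕ} (h : δ.LinOnly) :
    ∀ μ, ∀ e ∈ (δ.row μ).labels, e.1 ∈ L := by
  intro μ e he
  simp [h.2, Row.var] at he

theorem Subst.extend_row {θ : Subst ℕ ℕ} (h : θ.LinOnly) (μ₂ : ℕ) (R : Row ℕ) :
    ((Subst.oneRow μ₂ R).comp θ).row = Function.update Subst.id.row μ₂ R := by
  funext ν
  change (θ.row ν).subst _ = _
  rw [h.2, Row.subst_var]
  rfl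

theorem Reduce.labels {P₀ : PSet} {θ : Subst ℕ ℕ} (h : Reduce μ π δ X) (hπ : π.Traced P₀ θ) :
    ∀ μ, ∀ e ∈ (δ.row μ).labels, e.1 ∈ P₀.subLabels := by
  cases h with
  | lin | lack_closed | lack_open => exact Subst.LinOnly.id.labels
  | sub hu _ => exact (hu.linOnly _ rfl).labels
  | @extend K₁ K₂ t₁ μ₂ θ' hu _ _ =>
    intro ν e he
    rw [Subst.extend_row (hu.linOnly _ rfl)] at he
    by_cases h : ν = μ₂
    · subst h
      rw [Function.update_self] at he
      obtain ⟨e', he', rfl⟩ := CRow.mem_subst.1 (CRow.mem_diff.1 he).1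
      exact hπ.1.1 e' he'
    · rw [Function.update_of_ne h] at he
      exact Subst.LinOnly.id.labels ν e he

theorem Reduce.traced {P₀ : PSet} {θ : Subst ℕ ℕ} (h : Reduce μ π δ X) (hπ : π.Traced P₀ θ) :
    ∀ κ ∈ X, κ.Traced P₀ (δ.comp θ) := by
  have hs := hπ.subst (h.labels hπ)
  intro κ hκ
  cases h with
  | lin τ₁ τ₂ => rw [Finset.mem_singleton.1 hκ]; trivial
  | lack_closed => simp at hκ
  | lack_open => rw [Finset.mem_singleton.1 hκ]; trivial
  | @sub K₁ K₂ t₁ t₂ _ hu _ =>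
    rw [Pred.subst, Row.subst_linOnly (hu.linOnly _ rfl),
      Row.subst_linOnly (hu.linOnly _ rfl)] at hs
    split_ifs at hκ with ht
    · simp at hκ
    · obtain ⟨μ₁, rfl, rfl⟩ := mem_leftover.1 hκ
      exact ⟨hs.1.mono (by simp [Row.var]) (by simp [Row.var]),
        hs.2.mono (fun e he => (CRow.mem_diff.1 he).1) (by simp)⟩
  | @extend K₁ K₂ t₁ μ₂ θ' hu ht _ =>
    rw [Pred.subst, ← Row.subst_comp, ← Row.subst_comp, Row.subst_linOnly (hu.linOnly _ rfl),
      Row.subst_linOnly (hu.linOnly _ rfl), Row.subst_oneRow_of_ne ht,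
      Row.subst_oneRow_self] at hs
    obtain ⟨μ₁, rfl, rfl⟩ := mem_leftover.1 hκ
    exact ⟨hs.1.mono (by simp [Row.var]) (by simp [Row.var]),
      hs.2.mono (fun e he => Multiset.mem_add.2 (.inl (CRow.mem_diff.1 he).1)) (by simp)⟩

theorem Reduce.solved (h : Reduce μ π δ X) : ∀ κ ∈ X, κ.Solved := by
  intro κ hκ
  cases h with
  | lin τ₁ τ₂ => rw [Finset.mem_singleton.1 hκ]; trivial
  | lack_closed => simp at hκ
  | lack_open => rw [Finset.mem_singleton.1 hκ]; exact ⟨_, rfl⟩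
  | sub =>
    split_ifs at hκ
    · simp at hκ
    · obtain ⟨μ₁, rfl, rfl⟩ := mem_leftover.1 hκ
      exact ⟨_, rfl⟩
  | extend =>
    obtain ⟨μ₁, rfl, rfl⟩ := mem_leftover.1 hκ
    exact ⟨_, rfl⟩

theorem Reduce.directed (h : Reduce μ π δ X) (hπ : π.Directed) : X.Directed := by
  intro κ hκ
  cases h with
  | lin τ₁ τ₂ => rw [Finset.mem_singleton.1 hκ]; exact hπ
  | lack_closed => simp at hκ
  | lack_open => rw [Finset.mem_singleton.1 hκ]; trivial
  | sub =>
    split_ifs at hκ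
    · simp at hκ
    · obtain ⟨μ₁, rfl, rfl⟩ := mem_leftover.1 hκ
      trivial
  | extend =>
    obtain ⟨μ₁, rfl, rfl⟩ := mem_leftover.1 hκ
    trivial

theorem Reduce.mapsVars {N : Finset (Kind × ℕ)} (h : Reduce μ π δ X) (hN : π.fv ⊆ N) :
    δ.MapsVars N (insert (Kind.row, μ) N) := by
  have hsub := Finset.subset_insert (Kind.row, μ) N
  cases h with
  | lin | lack_closed | lack_open => exact .id hsub
  | sub hu _ =>
    have hfv := Finset.union_subset_iff.1 hN
    have := (Subst.MapsVars.id hsub).comp (hu.mapsVars (Row.labels_fv_subset hfv.1)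
      (Row.labels_fv_subset hfv.2) _ rfl)
    rwa [Subst.id_comp] at this
  | extend hu _ _ =>
    have hfv := Finset.union_subset_iff.1 hN
    have hm := hu.mapsVars (Row.labels_fv_subset hfv.1) (Row.labels_fv_subset hfv.2) _ rfl
    refine (Subst.MapsVars.oneRow hsub (Row.fv_subset_iff.2 ⟨fun e he => ?_, ?_⟩)).comp hm
    · exact (CRow.fv_subst hm (Row.labels_fv_subset hfv.1) e (CRow.mem_diff.1 he).1).trans hsub
    · simp

theorem Reduce.fv_subset {N : Finset (Kind × ℕ)} (h : Reduce μ π δ X) (hN : π.fv ⊆ N) :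
    ∀ κ ∈ X, κ.fv ⊆ insert (Kind.row, μ) N := by
  have hs := Pred.fv_subst (h.mapsVars hN) hN
  have hsub := Finset.subset_insert (Kind.row, μ) N
  intro κ hκ
  cases h with
  | lin τ₁ τ₂ => rw [Finset.mem_singleton.1 hκ]; exact hN.trans hsub
  | lack_closed => simp at hκ
  | lack_open =>
    rw [Finset.mem_singleton.1 hκ]
    rw [Pred.fv, Row.fv_subset_iff] at *
    exact ⟨by simp [Row.var], fun ν hν => hsub (hN.2 ν hν)⟩
  | @sub K₁ K₂ t₁ t₂ _ hu _ =>
    rw [Pred.subst, Row.subst_linOnly (hu.linOnly _ rfl), Row.subst_linOnly (hu.linOnly _ rfl),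
      Pred.fv, Finset.union_subset_iff, Row.fv_subset_iff, Row.fv_subset_iff] at hs
    split_ifs at hκ with ht
    · simp at hκ
    · obtain ⟨μ₁, rfl, rfl⟩ := mem_leftover.1 hκ
      rw [Pred.fv, Finset.union_subset_iff, Row.fv_subset_iff, Row.fv_subset_iff]
      exact ⟨⟨by simp [Row.var], hs.1.2⟩, fun e he => hs.2.1 e (CRow.mem_diff.1 he).1, hs.2.2⟩
  | @extend K₁ K₂ t₁ μ₂ θ' hu ht _ =>
    rw [Pred.subst, ← Row.subst_comp, ← Row.subst_comp, Row.subst_linOnly (hu.linOnly _ rfl),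
      Row.subst_linOnly (hu.linOnly _ rfl), Row.subst_oneRow_of_ne ht, Row.subst_oneRow_self,
      Pred.fv, Finset.union_subset_iff, Row.fv_subset_iff, Row.fv_subset_iff] at hs
    obtain ⟨μ₁, rfl, rfl⟩ := mem_leftover.1 hκ
    rw [Pred.fv, Finset.union_subset_iff, Row.fv_subset_iff, Row.fv_subset_iff]
    exact ⟨⟨by simp [Row.var], hs.1.2⟩,
      fun e he => hs.2.1 e (Multiset.mem_add.2 (.inl (CRow.mem_diff.1 he).1)), hs.2.2⟩

theorem Pred.Solved.subst {π : Pred ℕ} (h : π.Solved) (hδ : δ.LinOnly) :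
    (π.subst δ).Solved := by
  cases π with
  | lin τ₁ τ₂ => trivial
  | sub R₁ R₂ =>
    obtain ⟨ν, rfl⟩ := h
    exact ⟨ν, by rw [Row.subst_var, hδ.2]⟩
  | lack R L =>
    obtain ⟨ν, rfl⟩ := h
    exact ⟨ν, by rw [Row.subst_var, hδ.2]⟩

/-- The substitution `t` solves all predicates of the set. -/
def Solves (t : Subst ℕ ℕ) (P : PSet) : Prop := ∀ π ∈ P, Entails ∅ (π.subst t)

theorem mem_Sat {s : Subst ℕ ℕ} {P : PSet} :
    s ∈ Sat P ↔ s.WF ∧ (∀ π ∈ P, (π.subst s).WF) ∧ Solves s P := by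
  simp only [Sat, Subst.WFFor, PSet.WF, EntailsSet, Solves, Set.mem_ofPred_eq, and_assoc,
    PSet.mem_subst, forall_exists_index, and_imp, forall_apply_eq_imp_iff₂]

/-- The invariant of the row solver on `P₀`, where the variables in `N₀` are in use initially. -/
structure RunInv (P₀ : PSet) (N₀ N : Finset (Kind × ℕ)) (θ : Subst ℕ ℕ) (P Q : PSet) : Prop where
  fv_subset : ∀ π ∈ P ∪ Q, π.fv ⊆ N
  mapsVars : θ.MapsVars N₀ N
  directed : PSet.Directed (P ∪ Q)
  solved : ∀ π ∈ P, π.Solved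
  traced : ∀ π ∈ P ∪ Q, π.Traced P₀ θ
  labels : ∀ μ ∈ P₀.rowVars, ∀ e ∈ (θ.row μ).labels, e.1 ∈ P₀.subLabels
  wf : (PSet.subst θ P₀).WF
  sound : ∀ t, Solves t (P ∪ Q) → Solves t (PSet.subst θ P₀)
  complete : ∀ s ∈ Sat P₀, ∃ t, (t.comp θ).AgreeOn N₀ s ∧ t ∈ Sat (P ∪ Q)

theorem RunInv.init {P₀ : PSet} {N₀ : Finset (Kind × ℕ)} (hd : P₀.Directed) (hwf : P₀.WF)
    (hN : P₀.fv ⊆ N₀) : RunInv P₀ N₀ N₀ Subst.id ∅ P₀ where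
  fv_subset π hπ := (Finset.subset_biUnion_of_mem Pred.fv (by simpa using hπ)).trans hN
  mapsVars := .id subset_rfl
  directed := by simpa using hd
  solved := by simp
  traced := by
    intro π hπ
    simp only [Finset.empty_union] at hπ
    cases π with
    | lin τ₁ τ₂ => trivial
    | lack R L => trivial
    | sub R₁ R₂ =>
      have hl : ∀ ℓ ∈ CRow.dom R₁.labels ∪ CRow.dom R₂.labels, ℓ ∈ P₀.subLabels :=
        fun ℓ hℓ => Finset.mem_biUnion.2 ⟨_, hπ, hℓ⟩
      have hv : ∀ μ, (Kind.row, μ) ∈ R₁.fv ∪ R₂.fv → μ ∈ P₀.rowVars :=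
        fun μ hμ => PSet.mem_rowVars.2 (Finset.mem_biUnion.2 ⟨_, hπ, hμ⟩)
      refine ⟨⟨fun e he => hl _ ?_, fun μ hμ => ⟨μ, hv μ ?_, rfl⟩⟩,
        ⟨fun e he => hl _ ?_, fun μ hμ => ⟨μ, hv μ ?_, rfl⟩⟩⟩
      · exact Finset.mem_union_left _ (CRow.mem_dom.2 ⟨e.2, he⟩)
      · exact Finset.mem_union_left _ (Row.mem_fv.2 (.inr ⟨μ, hμ, rfl⟩))
      · exact Finset.mem_union_right _ (CRow.mem_dom.2 ⟨e.2, he⟩)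
      · exact Finset.mem_union_right _ (Row.mem_fv.2 (.inr ⟨μ, hμ, rfl⟩))
  labels μ _ := Subst.LinOnly.id.labels μ
  wf := by rwa [PSet.subst_id]
  sound t ht := by rw [PSet.subst_id]; simpa using ht
  complete s hs := ⟨s, by rw [Subst.comp_id]; exact .refl _, by simpa using hs⟩

variable {P₀ : PSet} {N₀ N : Finset (Kind × ℕ)} {θ θ' : Subst ℕ ℕ} {P P' Q Q' : PSet}

theorem mem_union_erase {κ : Pred ℕ} (hκ : κ ∈ P ∪ Q.erase π) : κ ∈ P ∪ Q :=
  Finset.union_subset_union_right (Finset.erase_subset π Q) hκ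

/-- The solutions of `P₀` after one step of the row solver. -/
theorem RunInv.complete_step (h : RunInv P₀ N₀ N θ P Q) (hπ : π ∈ Q)
    (hμ : (Kind.row, μ) ∉ N)
    (hr : RowStep θ P (Q.erase π) μ π (some (θ', P', Q'))) {s : Subst ℕ ℕ} (hs : s ∈ Sat P₀) :
    ∃ t, (t.comp θ').AgreeOn N₀ s ∧ t ∈ Sat (P' ∪ Q') := by
  obtain ⟨δ, X, hred, rfl, hPQ, _⟩ := hr.reduce
  obtain ⟨t, hts, ht⟩ := h.complete s hs
  rw [mem_Sat] at ht
  have hπ' : π ∈ P ∪ Q := Finset.mem_union_right _ hπ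
  obtain ⟨t', ht', ha, hX⟩ := hred.complete ht.1 (ht.2.1 π hπ') (ht.2.2 π hπ')
    (h.fv_subset π hπ') hμ
  have hrest : ∀ κ ∈ PSet.subst δ (P ∪ Q.erase π), (κ.subst t').WF ∧ Entails ∅ (κ.subst t') := by
    intro κ hκ
    obtain ⟨κ, hmem, rfl⟩ := PSet.mem_subst.1 hκ
    have hκ' := mem_union_erase hmem
    rw [Pred.subst_comp, Pred.subst_congr ha (h.fv_subset κ hκ')]
    exact ⟨ht.2.1 κ hκ', ht.2.2 κ hκ'⟩
  refine ⟨t', ?_, mem_Sat.2 ⟨ht', fun κ hκ => ?_, fun κ hκ => ?_⟩⟩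
  · rw [← Subst.comp_assoc]
    exact (ha.comp_right h.mapsVars).trans hts
  · rw [hPQ] at hκ
    exact ((Finset.mem_union.1 hκ).elim (hX κ) (hrest κ)).1
  · rw [hPQ] at hκ
    exact ((Finset.mem_union.1 hκ).elim (hX κ) (hrest κ)).2

theorem RunInv.step (h : RunInv P₀ N₀ N θ P Q) (hπ : π ∈ Q) (hμ : (Kind.row, μ) ∉ N)
    (hr : RowStep θ P (Q.erase π) μ π (some (θ', P', Q'))) (hwf : (PSet.subst θ' P₀).WF) :
    RunInv P₀ N₀ (insert (Kind.row, μ) N) θ' P' Q' := by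
  have hcomplete := fun s => h.complete_step hπ hμ hr (s := s)
  obtain ⟨δ, X, hred, rfl, hPQ, hcases⟩ := hr.reduce
  have hπ' : π ∈ P ∪ Q := Finset.mem_union_right _ hπ
  have hmaps := hred.mapsVars (h.fv_subset π hπ')
  have hlab := hred.labels (h.traced π hπ')
  have hall : ∀ p : Pred ℕ → Prop, (∀ κ ∈ X, p κ) → (∀ κ ∈ P ∪ Q, p (κ.subst δ)) →
      ∀ κ ∈ P' ∪ Q', p κ := by
    intro p hX hrest κ hκ
    rw [hPQ] at hκ
    rcases Finset.mem_union.1 hκ with hκ | hκ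
    · exact hX κ hκ
    · obtain ⟨κ, hmem, rfl⟩ := PSet.mem_subst.1 hκ
      exact hrest κ (mem_union_erase hmem)
  refine ⟨?_, hmaps.comp h.mapsVars, ?_, ?_, ?_, ?_, hwf, ?_, hcomplete⟩
  · exact hall _ (hred.fv_subset (h.fv_subset π hπ'))
      fun κ hκ => Pred.fv_subst hmaps (h.fv_subset κ hκ)
  · exact hall _ (hred.directed (h.directed π hπ')) fun κ hκ => (h.directed κ hκ).subst δ
  · intro κ hκ
    rcases hcases with ⟨hδ, rfl, _⟩ | ⟨rfl, _⟩
    · rcases Finset.mem_union.1 hκ with hκ | hκ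
      · exact hred.solved κ hκ
      · obtain ⟨κ, hmem, rfl⟩ := PSet.mem_subst.1 hκ
        exact (h.solved κ hmem).subst hδ
    · exact hred.solved κ hκ
  · exact hall _ (hred.traced (h.traced π hπ')) fun κ hκ => (h.traced κ hκ).subst hlab
  · intro ν hν e he
    change e ∈ ((θ.row ν).subst δ).labels at he
    rcases Row.mem_subst.1 he with ⟨e', he', rfl⟩ | ⟨ν', _, he⟩
    · exact h.labels ν hν e' he'
    · exact hlab ν' e he
  · intro t ht κ hκ
    rw [hPQ] at ht
    have hsolves : Solves (t.comp δ) (P ∪ Q) := by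
      intro κ hκ
      rw [← Pred.subst_comp]
      by_cases hκπ : κ = π
      · subst hκπ
        exact hred.sound fun κ' hκ' => ht κ' (Finset.mem_union_left _ hκ')
      · refine ht _ (Finset.mem_union_right _ (PSet.mem_subst.2 ⟨κ, ?_, rfl⟩))
        rcases Finset.mem_union.1 hκ with hκ | hκ
        · exact Finset.mem_union_left _ hκ
        · exact Finset.mem_union_right _ (Finset.mem_erase.2 ⟨hκπ, hκ⟩)
    obtain ⟨κ, hmem, rfl⟩ := PSet.mem_subst.1 hκ
    have := h.sound _ hsolves _ (PSet.mem_subst.2 ⟨κ, hmem, rfl⟩)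
    rwa [Pred.subst_comp, Subst.comp_assoc, ← Pred.subst_comp] at this

theorem RunInv.not_satisfiable_of_none (h : RunInv P₀ N₀ N θ P Q) (hπ : π ∈ Q)
    (hr : RowStep θ P (Q.erase π) μ π none) : ¬ Satisfiable P₀ := by
  rintro ⟨s, hs⟩
  obtain ⟨t, _, ht⟩ := h.complete s hs
  rw [mem_Sat] at ht
  have hπ' : π ∈ P ∪ Q := Finset.mem_union_right _ hπ
  exact hr.not_entails (ht.2.1 π hπ') (ht.2.2 π hπ')

theorem RunInv.wf_of_satisfiable (h : RunInv P₀ N₀ N θ P Q) (hN₀ : P₀.fv ⊆ N₀) (hπ : π ∈ Q)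
    (hμ : (Kind.row, μ) ∉ N)
    (hr : RowStep θ P (Q.erase π) μ π (some (θ', P', Q'))) (hsat : Satisfiable P₀) :
    (PSet.subst θ' P₀).WF := by
  obtain ⟨s, hs⟩ := hsat
  obtain ⟨t, ht, _⟩ := h.complete_step hπ hμ hr hs
  refine PSet.WF.of_subst (t := t) ?_
  rw [PSet.subst_congr ht hN₀]
  exact hs.1.2

end Invariant

/-! ## Correctness -/

section Correctness

/-- The invariant of the closure phase for the solved set `Q`. -/
structure CloseInv (Q : PSet) (T : Finset (Typ ℕ × Typ ℕ)) (W : PSet) : Prop where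
  cover : ∀ τ τ', Pred.lin τ τ' ∈ factoriseSet Q → Pred.lin τ τ' ∈ W ∨ (τ, τ') ∈ T
  subset : W ⊆ factoriseSet Q
  trans : TransRel T
  aboveAny : ∀ t, Solves t Q → ∀ τ τ', (τ, τ') ∈ T → τ.AboveAny t → τ'.AboveAny t

theorem CloseInv.init (Q : PSet) : CloseInv Q ∅ (factoriseSet Q) :=
  ⟨fun _ _ h => .inl h, subset_rfl, fun _ _ _ h => by simp at h, fun _ _ _ _ h => by simp at h⟩

theorem CloseInv.erase {Q W : PSet} {T : Finset (Typ ℕ × Typ ℕ)} (h : CloseInv Q T W)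
    {π : Pred ℕ} (hπ : ∀ τ τ', π ≠ .lin τ τ') : CloseInv Q T (W.erase π) :=
  ⟨fun τ τ' hτ => (h.cover τ τ' hτ).imp_left fun h' => Finset.mem_erase.2 ⟨(hπ τ τ').symm, h'⟩,
    (Finset.erase_subset _ _).trans h.subset, h.trans, h.aboveAny⟩

theorem Solves.factorise_lin {t : Subst ℕ ℕ} {Q : PSet} (ht : Solves t Q) {τ τ' : Typ ℕ}
    (h : Pred.lin τ τ' ∈ factoriseSet Q) : Entails ∅ ((Pred.lin τ τ').subst t) := by
  obtain ⟨τ₁, τ₂, h₁, h₂⟩ := mem_factoriseSet_lin h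
  exact entails_factLin.2 (ht _ h₁) _ h₂

theorem CloseInv.step {Q W : PSet} {T : Finset (Typ ℕ × Typ ℕ)} (h : CloseInv Q T W)
    (hQ : Q.Directed) {τ₁ τ₂ : Typ ℕ} (hτ : Pred.lin τ₁ τ₂ ∈ W) :
    CloseInv Q (closeStep T τ₁ τ₂) (W.erase (.lin τ₁ τ₂)) := by
  refine ⟨fun τ τ' hmem => ?_, (Finset.erase_subset _ _).trans h.subset, h.trans.closeStep _ _,
    fun t ht τ τ' hmem hup => ?_⟩
  · by_cases heq : Pred.lin τ τ' = .lin τ₁ τ₂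
    · cases heq
      exact .inr (mem_closeStep.2 (.inr ⟨.inl rfl, .inl rfl⟩))
    · exact (h.cover τ τ' hmem).imp (fun h' => Finset.mem_erase.2 ⟨heq, h'⟩)
        fun h' => mem_closeStep.2 (.inl h')
  · rcases mem_closeStep.1 hmem with hmem | ⟨h₁, h₂⟩
    · exact h.aboveAny t ht τ τ' hmem hup
    · have hup₁ : τ₁.AboveAny t := by
        rcases h₁ with rfl | h₁
        · exact hup
        · exact h.aboveAny t ht _ _ h₁ hup
      have hup₂ : τ₂.AboveAny t := hup₁.mono (hQ.factoriseSet _ (h.subset hτ))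
        (ht.factorise_lin (h.subset hτ))
      rcases h₂ with rfl | h₂
      · exact hup₂
      · exact h.aboveAny t ht _ _ h₂ hup₂

theorem canonicalSubst_wf (T : Finset (Typ ℕ × Typ ℕ)) : (canonicalSubst T).WF :=
  ⟨fun _ => ⟨trivial, trivial, by simp [Row.WF]⟩, fun _ => by simp [canonicalSubst, Row.WF]⟩

theorem exists_lin_of_mem_factAtom {τ τ' : Typ ℕ} {κ : Pred ℕ} (h : κ ∈ factAtom τ τ') :
    ∃ τ₁ τ₂, κ = .lin τ₁ τ₂ := by
  unfold factAtom at h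
  split_ifs at h
  · simp at h
  · exact ⟨_, _, Finset.mem_singleton.1 h⟩

theorem exists_lin_of_mem_factRight {τ τ' : Typ ℕ} {κ : Pred ℕ} (h : κ ∈ factRight τ τ') :
    ∃ τ₁ τ₂, κ = .lin τ₁ τ₂ := by
  unfold factRight at h
  split_ifs at h
  · simp at h
  · rcases τ' with A | R | Y
    · exact exists_lin_of_mem_factAtom h
    · rcases Finset.mem_union.1 h with h | h
      · obtain ⟨e, _, h⟩ := Finset.mem_biUnion.1 h
        exact exists_lin_of_mem_factAtom h
      · cases hR : R.tail <;> rw [hR] at h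
        · simp at h
        · exact exists_lin_of_mem_factAtom h
    · exact exists_lin_of_mem_factAtom h

theorem exists_lin_of_mem_factLin {τ τ' : Typ ℕ} {κ : Pred ℕ} (h : κ ∈ factLin τ τ') :
    ∃ τ₁ τ₂, κ = .lin τ₁ τ₂ := by
  unfold factLin at h
  split_ifs at h
  · simp at h
  · rcases τ with (α | ⟨A, Y, B, R⟩) | R | Y <;> exact exists_lin_of_mem_factRight h

theorem CloseInv.solves_canonicalSubst {Q : PSet} {T : Finset (Typ ℕ × Typ ℕ)}
    (h : CloseInv Q T ∅) (hQ : Q.Directed) (hs : ∀ π ∈ Q, π.Solved)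
    (hT : (Typ.lin Lin.any, Typ.lin Lin.unl) ∉ T) : Solves (canonicalSubst T) Q := by
  intro π hπ
  cases π with
  | lin τ τ' =>
    refine entails_factLin.1 fun κ hκ => ?_
    have hκ' : κ ∈ factoriseSet Q := Finset.mem_biUnion.2 ⟨_, hπ, hκ⟩
    have hd := directed_of_mem_factLin (hQ _ hπ) κ hκ
    have ha := atomic_of_mem_factLin κ hκ
    have hlin : ∃ τ₁ τ₂, κ = .lin τ₁ τ₂ := exists_lin_of_mem_factLin hκ
    obtain ⟨τ₁, τ₂, rfl⟩ := hlin
    exact entails_canonicalSubst h.trans hT ((h.cover _ _ hκ').resolve_left (by simp)) hd ha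
  | sub R₁ R₂ =>
    obtain ⟨μ, rfl⟩ := hs _ hπ
    rw [Pred.subst, entails_empty_sub, Row.subst_var]
    exact ⟨by simp [canonicalSubst], by simp [canonicalSubst]⟩
  | lack R L =>
    obtain ⟨μ, rfl⟩ := hs _ hπ
    rw [Pred.subst, entails_empty_lack, Row.subst_var]
    simp [canonicalSubst, CRow.dom]

/-- A well-formed substitution that solves the result of the row solver gives a solution. -/
theorem RunInv.satisfiable {P₀ Q : PSet} {N₀ N : Finset (Kind × ℕ)} {θ t : Subst ℕ ℕ}
    (h : RunInv P₀ N₀ N θ Q ∅) (ht : t.WF) (htQ : Solves t Q)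
    (hrow : ∀ μ, t.row μ = ⟨0, none⟩) : Satisfiable P₀ := by
  let s : Subst ℕ ℕ :=
    { ty := fun α => if (Kind.ty, α) ∈ P₀.fv then (θ.ty α).subst t else .var α
      row := fun μ => if (Kind.row, μ) ∈ P₀.fv then (θ.row μ).subst t else ⟨0, none⟩
      lin := (t.comp θ).lin }
  have hs : s.AgreeOn P₀.fv (t.comp θ) :=
    ⟨fun α hα => by simp [s, hα, Subst.comp], fun μ hμ => by simp [s, hμ, Subst.comp],
      fun _ _ => rfl⟩
  have heq : ∀ π ∈ P₀, π.subst s = (π.subst θ).subst t := fun π hπ => by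
    rw [Pred.subst_congr hs (Finset.subset_biUnion_of_mem Pred.fv hπ), Pred.subst_comp]
  refine ⟨s, mem_Sat.2 ⟨⟨fun α => ?_, fun μ => ?_⟩, fun π hπ => ?_, fun π hπ => ?_⟩⟩
  · by_cases hα : (Kind.ty, α) ∈ P₀.fv
    · simp only [s, hα, if_true]
      exact Ty.WF.subst_closed hrow ht.1 (h.wf.ty_of_subst hα)
    · simp only [s, hα, if_false]
      trivial
  · by_cases hμ : (Kind.row, μ) ∈ P₀.fv
    · simp only [s, hμ, if_true]
      exact Row.WF.subst_closed hrow (h.wf.row_of_subst hμ)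
    · simp [s, hμ, Row.WF]
  · rw [heq π hπ]
    exact Pred.WF.subst_closed hrow ht.1 (h.wf _ (PSet.mem_subst.2 ⟨π, hπ, rfl⟩))
  · rw [heq π hπ]
    exact h.sound t (by simpa using htQ) _ (PSet.mem_subst.2 ⟨π, hπ, rfl⟩)

theorem RunInv.sat_eq {P₀ Q : PSet} {N₀ N : Finset (Kind × ℕ)} {θ : Subst ℕ ℕ}
    (h : RunInv P₀ N₀ N θ Q ∅) (hN₀ : P₀.fv ⊆ N₀) : Sat P₀ = composeSet N₀ P₀ (Sat Q) θ := by
  ext s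
  constructor
  · intro hs
    obtain ⟨t, hts, ht⟩ := h.complete s hs
    rw [Finset.union_empty] at ht
    exact ⟨hs.1, t, ht, Subst.AgreeOn.symm hts⟩
  · rintro ⟨hs, t, ht, hst⟩
    refine ⟨hs, fun π hπ => ?_⟩
    rw [PSet.subst_congr hst hN₀] at hπ
    obtain ⟨κ, hκ, rfl⟩ := PSet.mem_subst.1 hπ
    rw [← Pred.subst_comp]
    exact h.sound t (by simpa using (mem_Sat.1 ht).2.2) _ (PSet.mem_subst.2 ⟨κ, hκ, rfl⟩)

/-- The invariant of the solver. -/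
def Config.Inv (P₀ : PSet) (N₀ : Finset (Kind × ℕ)) : Config → Prop
  | .run N θ P Q => RunInv P₀ N₀ N θ P Q
  | .close θ Q T W => (∃ N, RunInv P₀ N₀ N θ Q ∅) ∧ CloseInv Q T W
  | .done θ Q => Satisfiable P₀ ∧ Sat P₀ = composeSet N₀ P₀ (Sat Q) θ
  | .fail => ¬ Satisfiable P₀

theorem Step.inv {P₀ : PSet} {N₀ : Finset (Kind × ℕ)} (hN₀ : P₀.fv ⊆ N₀) {c c' : Config}
    (h : Step P₀ c c') (hc : c.Inv P₀ N₀) : c'.Inv P₀ N₀ := by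
  cases h with
  | row hπ hμ hr hwf => exact RunInv.step hc hπ hμ hr hwf
  | row_fail hπ hμ hr => exact RunInv.not_satisfiable_of_none hc hπ hr
  | row_dup hπ hμ hr hwf => exact fun hsat => hwf (RunInv.wf_of_satisfiable hc hN₀ hπ hμ hr hsat)
  | row_done => exact ⟨⟨_, hc⟩, CloseInv.init _⟩
  | close_lin hτ =>
    obtain ⟨⟨N, hrun⟩, hcl⟩ := hc
    exact ⟨⟨N, hrun⟩, hcl.step (by simpa using hrun.directed) hτ⟩
  | close_sub _ => exact ⟨hc.1, hc.2.erase (by simp)⟩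
  | close_lack _ => exact ⟨hc.1, hc.2.erase (by simp)⟩
  | accept hT =>
    obtain ⟨⟨N, hrun⟩, hcl⟩ := hc
    exact ⟨hrun.satisfiable (canonicalSubst_wf _)
      (hcl.solves_canonicalSubst (by simpa using hrun.directed) hrun.solved hT) fun _ => rfl,
      hrun.sat_eq hN₀⟩
  | reject hT =>
    obtain ⟨⟨N, hrun⟩, hcl⟩ := hc
    rintro ⟨s, hs⟩
    obtain ⟨t, _, ht⟩ := hrun.complete s hs
    rw [Finset.union_empty] at ht
    exact Typ.AboveAny.not_unl t (hcl.aboveAny t (mem_Sat.1 ht).2.2 _ _ hT (.any t))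

theorem inv_of_reachable {P₀ : PSet} {N₀ : Finset (Kind × ℕ)} (hd : P₀.Directed) (hwf : P₀.WF)
    (hN₀ : P₀.fv ⊆ N₀) {c : Config}
    (h : Relation.ReflTransGen (Step P₀) (solveInit N₀ P₀) c) : c.Inv P₀ N₀ := by
  induction h with
  | refl => exact RunInv.init hd hwf hN₀
  | tail _ hstep ih => exact hstep.inv hN₀ ih

end Correctness

/-! ## Termination -/

section Termination

theorem exists_fresh (N : Finset (Kind × ℕ)) : ∃ μ, (Kind.row, μ) ∉ N := by
  obtain ⟨μ, hμ⟩ := Infinite.exists_notMem_finset (N.image Prod.snd)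
  exact ⟨μ, fun h => hμ (Finset.mem_image_of_mem Prod.snd h)⟩

/-- A configuration from which no step is possible is a result. -/
theorem progress (P₀ : PSet) (c : Config) :
    (∃ c', Step P₀ c c') ∨ c = .fail ∨ ∃ θ Q, c = .done θ Q := by
  cases c with
  | run N θ P Q =>
    left
    rcases Q.eq_empty_or_nonempty with rfl | ⟨π, hπ⟩
    · exact ⟨_, .row_done⟩
    · obtain ⟨μ, hμ⟩ := exists_fresh N
      obtain ⟨_ | ⟨θ', P', Q'⟩, hr⟩ := RowStep.exists_result θ P (Q.erase π) μ π
      · exact ⟨_, .row_fail hπ hμ hr⟩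
      · by_cases hwf : (PSet.subst θ' P₀).WF
        · exact ⟨_, .row hπ hμ hr hwf⟩
        · exact ⟨_, .row_dup hπ hμ hr hwf⟩
  | close θ Q T W =>
    left
    rcases W.eq_empty_or_nonempty with rfl | ⟨π, hπ⟩
    · by_cases hT : (Typ.lin Lin.any, Typ.lin Lin.unl) ∈ T
      · exact ⟨_, .reject hT⟩
      · exact ⟨_, .accept hT⟩
    · cases π with
      | lin τ₁ τ₂ => exact ⟨_, .close_lin hπ⟩
      | sub R₁ R₂ => exact ⟨_, .close_sub hπ⟩
      | lack R L => exact ⟨_, .close_lack hπ⟩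
  | done θ Q => exact .inr (.inr ⟨θ, Q, rfl⟩)
  | fail => exact .inr (.inl rfl)

theorem acc_fail (P₀ : PSet) : Acc (fun c' c => Step P₀ c c') .fail :=
  ⟨_, fun _ h => nomatch h⟩

theorem acc_done (P₀ : PSet) (θ : Subst ℕ ℕ) (Q : PSet) :
    Acc (fun c' c => Step P₀ c c') (.done θ Q) :=
  ⟨_, fun _ h => nomatch h⟩

theorem acc_close (P₀ : PSet) (θ : Subst ℕ ℕ) (Q : PSet) (T : Finset (Typ ℕ × Typ ℕ))
    (W : PSet) : Acc (fun c' c => Step P₀ c c') (.close θ Q T W) := by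
  induction hn : W.card using Nat.strong_induction_on generalizing T W with
  | _ n ih =>
    subst hn
    refine ⟨_, fun c' h => ?_⟩
    cases h with
    | close_lin hτ => exact ih _ (Finset.card_erase_lt_of_mem hτ) _ _ rfl
    | close_sub hτ => exact ih _ (Finset.card_erase_lt_of_mem hτ) _ _ rfl
    | close_lack hτ => exact ih _ (Finset.card_erase_lt_of_mem hτ) _ _ rfl
    | accept _ => exact acc_done _ _ _
    | reject _ => exact acc_fail _

/-- The number of labels in the images of the row variables of `P₀`. -/
def labelCount (P₀ : PSet) (θ : Subst ℕ ℕ) : ℕ :=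
  ∑ μ ∈ P₀.rowVars, (θ.row μ).labels.card

theorem Row.card_labels_le {R : Row ℕ} (h : R.WF) {L : Finset ℕ}
    (hL : ∀ e ∈ R.labels, e.1 ∈ L) : R.labels.card ≤ L.card := by
  rw [← Multiset.card_map Prod.fst, ← Multiset.toFinset_card_of_nodup h]
  refine Finset.card_le_card fun ℓ hℓ => ?_
  obtain ⟨e, he, rfl⟩ := Multiset.mem_map.1 (Multiset.mem_toFinset.1 hℓ)
  exact hL e he

theorem RunInv.labelCount_le {P₀ P Q : PSet} {N₀ N : Finset (Kind × ℕ)} {θ : Subst ℕ ℕ}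
    (h : RunInv P₀ N₀ N θ P Q) :
    labelCount P₀ θ ≤ P₀.rowVars.card * P₀.subLabels.card := by
  refine Finset.sum_le_card_nsmul _ _ _ fun μ hμ => ?_
  exact Row.card_labels_le (h.wf.row_of_subst (PSet.mem_rowVars.1 hμ)) (h.labels μ hμ)

theorem Row.card_labels_subst (δ : Subst ℕ ℕ) (R : Row ℕ) :
    (R.subst δ).labels.card = R.labels.card + R.tail.elim 0 fun μ => (δ.row μ).labels.card := by
  rw [Row.subst_labels]
  cases R.tail <;> simp [CRow.subst]

theorem labelCount_mono (P₀ : PSet) (θ δ : Subst ℕ ℕ) :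
    labelCount P₀ θ ≤ labelCount P₀ (δ.comp θ) :=
  Finset.sum_le_sum fun μ _ => by
    change _ ≤ ((θ.row μ).subst δ).labels.card
    rw [Row.card_labels_subst]
    omega

theorem labelCount_lt {P₀ : PSet} {θ δ : Subst ℕ ℕ} {μ₀ μ₂ : ℕ} (hμ₀ : μ₀ ∈ P₀.rowVars)
    (ht : (θ.row μ₀).tail = some μ₂) (hδ : 0 < (δ.row μ₂).labels.card) :
    labelCount P₀ θ < labelCount P₀ (δ.comp θ) := by
  refine Finset.sum_lt_sum (fun μ _ => ?_) ⟨μ₀, hμ₀, ?_⟩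
  · change _ ≤ ((θ.row μ).subst δ).labels.card
    rw [Row.card_labels_subst]
    omega
  · change _ < ((θ.row μ₀).subst δ).labels.card
    rw [Row.card_labels_subst, ht]
    exact Nat.lt_add_of_pos_right hδ

theorem RunInv.acc {P₀ : PSet} {N₀ : Finset (Kind × ℕ)} {N : Finset (Kind × ℕ)}
    {θ : Subst ℕ ℕ} {P Q : PSet} (h : RunInv P₀ N₀ N θ P Q) :
    Acc (fun c' c => Step P₀ c c') (.run N θ P Q) := by
  induction hk : P₀.rowVars.card * P₀.subLabels.card - labelCount P₀ θ
    using Nat.strong_induction_on generalizing N θ P Q with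
  | _ k ihk =>
    induction hn : Q.card using Nat.strong_induction_on generalizing N θ P Q with
    | _ n ihn =>
      subst hk hn
      refine ⟨_, fun c' hstep => ?_⟩
      cases hstep with
      | row hπ hμ hr hwf =>
        have h' := h.step hπ hμ hr hwf
        obtain ⟨δ, X, hred, rfl, _, ⟨_, _, hQ⟩ | ⟨_, K₁, t₁, K₂, μ₂, K, rfl, hδ, hK⟩⟩ := hr.reduce
        · have hcard := (Finset.card_image_le (f := Pred.subst δ)).trans_lt
            (Finset.card_erase_lt_of_mem hπ)
          rw [← PSet.subst, ← hQ] at hcard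
          rcases (labelCount_mono P₀ θ δ).lt_or_eq with hlt | heq
          · have := h'.labelCount_le
            exact ihk _ (by omega) h' rfl
          · exact ihn _ hcard h' (by rw [heq]) rfl
        · obtain ⟨μ₀, hμ₀, ht⟩ := (h.traced _ (Finset.mem_union_right _ hπ)).2.2 μ₂ rfl
          have hlt := labelCount_lt (P₀ := P₀) (δ := δ) hμ₀ ht (by rw [hδ]; exact hK)
          have := h'.labelCount_le
          exact ihk _ (by omega) h' rfl
      | row_fail => exact acc_fail _
      | row_dup => exact acc_fail _
      | row_done => exact acc_close _ _ _ _ _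

end Termination

end Qeff

theorem mainTheorem7 (P : Qeff.PSet) (hgen : Qeff.Generated P) (hwf : P.WF)
    (N : Finset (Qeff.Kind × ℕ)) (hN : P.fv ⊆ N) :
    Qeff.SolveTerminates N P ∧
    (Qeff.SolveFails N P → ¬ Qeff.Satisfiable P) ∧
    (∀ (θ : Qeff.Subst ℕ ℕ) (Q : Qeff.PSet), Qeff.SolveReturns N P θ Q →
      Qeff.Satisfiable P ∧ Qeff.Sat P = Qeff.composeSet N P (Qeff.Sat Q) θ) :=
  ⟨⟨(Qeff.RunInv.init hgen.directed hwf hN).acc, fun c _ => Qeff.progress P c⟩,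
    fun h => Qeff.inv_of_reachable hgen.directed hwf hN h,
    fun _ _ h => Qeff.inv_of_reachable hgen.directed hwf hN h⟩
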